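/- **Setting.** On a probability space let $T\in[0,\infty)$ be a failure time, $T'\in[0,\infty]$ a censoring time and $Z\in\mathbb R^k$ a covariate with law $\mu$; $T$ and $T'$ are conditionally independent given $Z$. Observed are $X=T\wedge T'$, $\delta=1(X=T)$ and $Z$; $P$ is the law of $(X,\delta,Z)$, $L_2^0(P)$ is the space of mean-zero elements of $L_2(P)$, $\tau_0=\sup\{t:P(X\ge t)>0\}$, $\tau_F=\sup\{t:P(T\ge t)>0\}$, $Y(u)=1(X\ge u)$, $N(t)=1(X\le t,\delta=1)$, $EN$ is the measure $EN(du)=P(X\in du,\delta=1)$, and $Q$, $Q_c$ are the joint subdistributions of $(X,Z)$ on $\{\delta=1\}$, $\{\delta=0\}$. With $\bar A(du,z)=P(X\in du,\delta=1\mid X\ge u,Z=z)$ and $\bar A_c(du,z)=P(X\in du,\delta=0\mid X\ge u,Z=z)$ put $$\int h\,dM=\delta h(X,Z)-\int_{[0,X]}h(u,Z)\bar A(du,Z),\qquad \int h\,dM_c=(1-\delta)h(X,Z)-\int_{[0,X]}h(u,Z)\bar A_c(du,Z).$$ **Core model.** $\Theta\subset\mathbb R^d$; for $\theta\in\Theta$,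 $A(x,\theta,z)=\int_0^x\alpha(y,\theta,z)\,dy$ with $\alpha(\cdot,\theta,\cdot)$ measurable, and $\theta_0\in\Theta$. Assume: 1. $\Theta$ is open and $\theta$ is identifiable: if $A(\cdot,\theta,z)=A(\cdot,\theta',z)$ on $[0,\infty)$ for $\mu$-a.e. $z$, then $\theta=\theta'$. 2. For $\mu$-a.e. $z$ and all $\theta\in\Theta$: $\alpha(x,\theta,z)>0$ for $x\ge0$, $A(x,\theta,z)\to\infty$ as $x\to\infty$ (so $A(\cdot,\theta,z)$ is the cumulative hazard function of a proper distribution), and $m_1\le\alpha(0,\theta,z)\le m_2$ for some constants $0<m_1<m_2<\infty$. 3. For $\mu$-a.e. $z$, $\ell=\log\alpha$ is continuously differentiable in $(x,\theta)\in[0,\infty)\times\Theta$; $\ell'$ denotes the derivative in $x$. 4. The densities $p_\theta=\alpha(x,\theta,z)e^{-A(x,\theta,z)}$ with respect to $dx\otimes\mu$ on $(0,\infty)\times\mathbb R^k$ form a regular parametric model: $\theta\mapsto\sqrt{p_\theta}\in L_2(dx\otimes\mu)$ is continuously Fréchet differentiable on $\Theta$, with (finite) positive definite information. **Transformation, censoring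 and nuisance conditions.** $\mu$ is not a point mass. $\Gamma_0$ is increasing (not necessarily strictly) and continuous on $[0,\tau_F)$, $\Gamma_0(0)=0$, $\lim_{t\uparrow\tau_F}\Gamma_0(t)=\infty$. For $\mu$-a.e. $z$, $T$ given $Z=z$ has cumulative hazard $A(\Gamma_0(t),\theta_0,z)$, i.e. $P(T>t\mid Z=z)=\exp(-A(\Gamma_0(t),\theta_0,z))$ for $0\le t<\tau_F$. If $\tau_0<\tau_F$, then $P(T'=\tau_0)>0$. The censoring hazard $\bar A_c$ and the covariate law $\mu$ are otherwise unrestricted and vary independently of $(\theta,\Gamma)$. **Notation at $(\theta_0,\Gamma_0)$.** Write $\ell'$ also for the function $(u,z)\mapsto\ell'(\Gamma_0(u),\theta_0,z)$. Let $$s[f](u)=E\,Y(u)f(u,Z)\alpha(\Gamma_0(u),\theta_0,Z),\quad e[f]=s[f]/s[1],\quad \mathrm{cov}[f_1,f_2]=e[f_1f_2]-e[f_1]e[f_2],\quad \mathrm{var}[f]=\mathrm{cov}[f,f],$$ $$C(du)=s[1](u)^{-2}EN(du),\quad B(du)=\mathrm{var}[\ell'](u)EN(du),\quad \mathcal P(u,t)=\exp\Big(-\int_u^t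 s[\ell']\,dC\Big),$$ $$K(t,t')=\int_0^{t\wedge t'}C(du)\mathcal P(u,t)\mathcal P(u,t'),\quad D[f](t)=-\int_0^t s[f](u)\mathcal P(u,t)\,C(du),\quad \rho[f,\phi]=\mathrm{cov}[f,\ell']-\phi\,\mathrm{var}[\ell'].$$ **Integrability condition.** $e[(\ell')^2]<\infty$ $EN$-a.e. and $\int_0^t|s[\ell']|\,dC<\infty$ for all $t<\tau_0$ (so that $B$ and $\mathcal P$ are well defined), and $$\kappa(\tau_0)=\iint_{0<u\le t\le\tau_0}C(du)\,\mathcal P(u,t)^2\,B(dt)<\infty .$$ **Tangent spaces.** Let $\dot{\mathcal P}_2,\dot{\mathcal P}_3,\dot{\mathcal P}_4$ be the closed linear spans in $L_2^0(P)$ of, respectively: $\int\{g(u)+\ell'(u,Z)\int_0^u g\,d\Gamma_0\}\,M(du)$ over all $g$ that are $d\Gamma_0$-integrable on $(0,t]$ for every $t<\tau_0$ and satisfy $g(X)+\ell'(X,Z)\int_0^X g\,d\Gamma_0\in L_2(Q)$; $\int b\,dM_c$ over $b\in L_2(Q_c)$; and $c(Z)$ over $c\in L_2^0(\mu)$. The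 nuisance tangent space is $\dot{\mathcal P}_\eta=\dot{\mathcal P}_2+\dot{\mathcal P}_3+\dot{\mathcal P}_4$, and $\dot{\mathcal P}_\eta^\perp$ is its orthocomplement in $L_2^0(P)$. **Proposition 2.1.** Under these conditions, for every $f\in L_2(Q)$ the Fredholm equation $$\phi(t)=-D[f](t)-\int_0^{\tau_0}K(t,u)\phi(u)\,B(du)+\int_0^{\tau_0}K(t,u)\,\mathrm{cov}[f,\ell'](u)\,EN(du)\qquad(B\text{-a.e. }t)$$ has a solution $\phi^*\in L_2(B)$, unique up to $B$-null sets. For any version of $\phi^*$ put $$W_f(t,Z)=f(t,Z)-e[f](t)-\big(\ell'(t,Z)-e[\ell'](t)\big)\phi^*(t)-\frac1{s[1](t)}\int_t^{\tau_0}\mathcal P(t,v)\,\rho[f,\phi^*](v)\,EN(dv),\qquad U(f,\theta_0)=\int W_f\,dM .$$ Then: (i) for every $f\in L_2(Q)$, $U(f,\theta_0)\in L_2^0(P)$ and $U(f,\theta_0)\perp\dot{\mathcal P}_\eta$; (ii) for every $b\in L_2^0(P)$, the function $R_1(b)(x,z)=b(x,1,z)-E[b(X,\delta,Z)\mid X\ge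 x,Z=z]$ is in $L_2(Q)$ and the orthogonal projection of $b$ onto $\dot{\mathcal P}_\eta^\perp$ is $U(R_1(b),\theta_0)$; (iii) $\dot{\mathcal P}_\eta^\perp=\{U(f,\theta_0):f\in L_2(Q)\}$. -/

import Mathlib

open MeasureTheory ProbabilityTheory Set Filter Topology
open scoped NNReal ENNReal InnerProductSpace

noncomputable section

namespace CensTrans

/-- Column vectors. -/
abbrev Vec (n : ℕ) : Type := EuclideanSpace ℝ (Fin n)

/-- The observation space of `(X, δ, Z)`; `true` codes `δ = 1` (failure). -/
abbrev Obs (k : ℕ) : Type := ℝ × Bool × Vec k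

/-! ### Time intervals and the Lebesgue-Stieltjes measure of the transformation -/

/-- The time interval `[0, τ)`. -/
def timeIco (τ : ℝ≥0∞) : Set ℝ := {t | 0 ≤ t ∧ ENNReal.ofReal t < τ}

/-- The time interval `(a, τ]` (without the point `∞` if `τ = ∞`). -/
def timeIoc (a : ℝ) (τ : ℝ≥0∞) : Set ℝ := {t | a < t ∧ ENNReal.ofReal t ≤ τ}

/-- `Γ` is an increasing continuous function on `[0, τ)` with `Γ 0 = 0` and
`Γ t → ∞` as `t ↑ τ` (for an increasing `Γ` this is unboundedness; it entails `0 < τ`). -/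
structure IsTransformation (Γ : ℝ → ℝ) (τ : ℝ≥0∞) : Prop where
  zero : Γ 0 = 0
  monotoneOn : MonotoneOn Γ (timeIco τ)
  continuousOn : ContinuousOn Γ (timeIco τ)
  unbounded : ∀ r : ℝ, ∃ t ∈ timeIco τ, r ≤ Γ t

/-- The generalized inverse `x ↦ inf {t ∈ [0, τ) : x ≤ Γ t}`. -/
def genInv (Γ : ℝ → ℝ) (τ : ℝ≥0∞) (x : ℝ) : ℝ := sInf {t | t ∈ timeIco τ ∧ x ≤ Γ t}

/-- The Lebesgue-Stieltjes measure `dΓ` on `[0, τ)`, as the image of Lebesgue measure on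
`(0, ∞)` under the generalized inverse of `Γ`; see `stieltjes_Ioc` and `stieltjes_compl`. -/
def stieltjes (Γ : ℝ → ℝ) (τ : ℝ≥0∞) : Measure ℝ :=
  ((volume : Measure ℝ).restrict (Ioi 0)).map (genInv Γ τ)

lemma timeIco_mono {τ : ℝ≥0∞} {s t : ℝ} (hs : 0 ≤ s) (hst : s ≤ t) (ht : t ∈ timeIco τ) :
    s ∈ timeIco τ :=
  ⟨hs, lt_of_le_of_lt (ENNReal.ofReal_le_ofReal hst) ht.2⟩

lemma genInv_mem {Γ : ℝ → ℝ} {τ : ℝ≥0∞} (h : IsTransformation Γ τ) {x : ℝ} :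
    genInv Γ τ x ∈ timeIco τ ∧ x ≤ Γ (genInv Γ τ x) := by
  obtain ⟨b, hb, hxb⟩ := h.unbounded x
  have hIcc : Icc 0 b ⊆ timeIco τ := fun s hs => timeIco_mono hs.1 hs.2 hb
  have hbdd : BddBelow {t | t ∈ timeIco τ ∧ x ≤ Γ t} := ⟨0, fun t ht => ht.1.1⟩
  have hK : IsCompact (Icc 0 b ∩ Γ ⁻¹' Ici x) :=
    isCompact_Icc.of_isClosed_subset
      ((h.continuousOn.mono hIcc).preimage_isClosed_of_isClosed isClosed_Icc isClosed_Ici)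
      inter_subset_left
  obtain ⟨m, hm, hmin⟩ := hK.exists_isLeast ⟨b, ⟨hb.1, le_rfl⟩, hxb⟩
  have hmem : m ∈ {t | t ∈ timeIco τ ∧ x ≤ Γ t} := ⟨hIcc hm.1, hm.2⟩
  have : genInv Γ τ x = m := by
    refine le_antisymm (csInf_le hbdd hmem) (le_csInf ⟨m, hmem⟩ ?_)
    intro t ht
    rcases le_total t b with htb | htb
    · exact hmin ⟨⟨ht.1.1, htb⟩, ht.2⟩
    · exact hm.1.2.trans htb
  rw [this]
  exact hmem

lemma genInv_le_iff {Γ : ℝ → ℝ} {τ : ℝ≥0∞} (h : IsTransformation Γ τ) {x t : ℝ}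
    (ht : t ∈ timeIco τ) : genInv Γ τ x ≤ t ↔ x ≤ Γ t := by
  constructor
  · intro hle
    exact (genInv_mem h).2.trans (h.monotoneOn (genInv_mem h).1 ht hle)
  · intro hx
    exact csInf_le ⟨0, fun t ht => ht.1.1⟩ ⟨ht, hx⟩

lemma genInv_measurable {Γ : ℝ → ℝ} {τ : ℝ≥0∞} (h : IsTransformation Γ τ) :
    Measurable (genInv Γ τ) := by
  refine Monotone.measurable fun x y hxy => ?_
  exact csInf_le ⟨0, fun t ht => ht.1.1⟩ ⟨(genInv_mem h).1, hxy.trans (genInv_mem h).2⟩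

/-- `dΓ (a, b] = Γ b - Γ a`. -/
lemma stieltjes_Ioc {Γ : ℝ → ℝ} {τ : ℝ≥0∞} (h : IsTransformation Γ τ) {a b : ℝ}
    (ha : 0 ≤ a) (hab : a ≤ b) (hb : b ∈ timeIco τ) :
    stieltjes Γ τ (Ioc a b) = ENNReal.ofReal (Γ b - Γ a) := by
  have haτ := timeIco_mono ha hab hb
  have hΓa : 0 ≤ Γ a := by
    rw [← h.zero]
    exact h.monotoneOn (timeIco_mono le_rfl ha haτ) haτ ha
  rw [stieltjes, Measure.map_apply (genInv_measurable h) measurableSet_Ioc,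
    Measure.restrict_apply ((genInv_measurable h) measurableSet_Ioc)]
  have : genInv Γ τ ⁻¹' Ioc a b ∩ Ioi 0 = Ioc (Γ a) (Γ b) := by
    ext x
    simp only [mem_inter_iff, mem_preimage, mem_Ioc, mem_Ioi, genInv_le_iff h hb]
    rw [← not_le, genInv_le_iff h haτ, not_le]
    exact ⟨fun hx => hx.1, fun hx => ⟨hx, hΓa.trans_lt hx.1⟩⟩
  rw [this, Real.volume_Ioc]

/-- `dΓ` is carried by `(0, τ)`. -/
lemma stieltjes_compl {Γ : ℝ → ℝ} {τ : ℝ≥0∞} (h : IsTransformation Γ τ) :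
    stieltjes Γ τ (timeIco τ \ {0})ᶜ = 0 := by
  have hms : MeasurableSet (timeIco τ) :=
    (measurableSet_le measurable_const measurable_id).inter
      (measurableSet_lt ENNReal.measurable_ofReal measurable_const)
  have hms' := (hms.diff (measurableSet_singleton (0 : ℝ))).compl
  rw [stieltjes, Measure.map_apply (genInv_measurable h) hms',
    Measure.restrict_apply ((genInv_measurable h) hms')]
  have : genInv Γ τ ⁻¹' (timeIco τ \ {0})ᶜ ∩ Ioi 0 = ∅ := by
    ext x
    simp only [mem_inter_iff, mem_preimage, mem_compl_iff, mem_Ioi, mem_empty_iff_false,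
      iff_false, not_and]
    intro hx hpos
    refine hx ⟨(genInv_mem h).1, fun h0 => ?_⟩
    have h2 := (genInv_mem h (x := x)).2
    rw [mem_singleton_iff.1 h0, h.zero] at h2
    exact absurd hpos (not_lt.2 h2)
  rw [this, measure_empty]

/-! ### The core model -/

/-- The core cumulative hazard `A(x, θ, z) = ∫₀ˣ α(y, θ, z) dy`. -/
def cumHaz {d k : ℕ} (α : ℝ → Vec d → Vec k → ℝ) (x : ℝ) (θ : Vec d) (z : Vec k) : ℝ :=
  ∫ y in (0 : ℝ)..x, α y θ z

/-- `ℓ'(x, θ, z)`, the derivative of `log α` in `x ∈ [0, ∞)`. -/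
def logHazDeriv {d k : ℕ} (α : ℝ → Vec d → Vec k → ℝ) (x : ℝ) (θ : Vec d) (z : Vec k) : ℝ :=
  derivWithin (fun y => Real.log (α y θ z)) (Ici 0) x

/-- The core models, with densities `α e^{-A}` with respect to `ν = dx ⊗ μ` on `(0, ∞) × ℝᵏ`,
form a regular parametric model: `θ ↦ √p_θ ∈ L₂(ν)` is continuously Fréchet differentiable
on `Θ`, and the information, that is the quadratic form `v ↦ 4 ‖s'(θ) v‖²`, is
(finite and) positive definite. -/
def IsRegularParametric {d k : ℕ} (Θ : Set (Vec d)) (α : ℝ → Vec d → Vec k → ℝ)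
    (μ : Measure (Vec k)) : Prop :=
  let ν : Measure (ℝ × Vec k) := ((volume : Measure ℝ).restrict (Ioi 0)).prod μ
  ∃ (s : Vec d → Lp ℝ 2 ν) (s' : Vec d → (Vec d →L[ℝ] Lp ℝ 2 ν)),
    (∀ θ ∈ Θ,
      ((s θ : ℝ × Vec k → ℝ) =ᵐ[ν]
        fun p => Real.sqrt (α p.1 θ p.2 * Real.exp (-cumHaz α p.1 θ p.2))) ∧
      HasFDerivAt s (s' θ) θ ∧ ∀ v, v ≠ 0 → 0 < 4 * ‖s' θ v‖ ^ 2) ∧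
    ContinuousOn s' Θ

/-- The conditions on the core model `{A(·, θ, z) : θ ∈ Θ}` with hazard rates `α`. -/
structure CoreConditions {d k : ℕ} (Θ : Set (Vec d)) (α : ℝ → Vec d → Vec k → ℝ)
    (μ : Measure (Vec k)) : Prop where
  measurable : ∀ θ ∈ Θ, Measurable fun p : ℝ × Vec k => α p.1 θ p.2
  isOpen : IsOpen Θ
  identifiable : ∀ θ ∈ Θ, ∀ θ' ∈ Θ,
    (∀ᵐ z ∂μ, ∀ x, 0 ≤ x → cumHaz α x θ z = cumHaz α x θ' z) → θ = θ'
  /-- The hazard rate is supported on the whole half-line. -/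
  pos : ∀ᵐ z ∂μ, ∀ θ ∈ Θ, ∀ x, 0 ≤ x → 0 < α x θ z
  /-- `A(·, θ, z)` is the cumulative hazard of a (proper) distribution on `(0, ∞)`. -/
  proper : ∀ᵐ z ∂μ, ∀ θ ∈ Θ, Tendsto (fun x => cumHaz α x θ z) atTop atTop
  bounds : ∃ m₁ m₂ : ℝ, 0 < m₁ ∧ m₁ < m₂ ∧
    ∀ᵐ z ∂μ, ∀ θ ∈ Θ, m₁ ≤ α 0 θ z ∧ α 0 θ z ≤ m₂
  smooth : ∀ᵐ z ∂μ,
    ContDiffOn ℝ 1 (fun p : ℝ × Vec d => Real.log (α p.1 p.2 z)) (Ici 0 ×ˢ Θ)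
  regular : IsRegularParametric Θ α μ

/-! ### Right censored observations -/

section Sampling

variable {Ω : Type*} [MeasurableSpace Ω] {k : ℕ}

/-- The withdrawal time `X = T ∧ T'`. The censoring time may be `∞` (no censoring). -/
def withdrawal (T : Ω → ℝ≥0) (T' : Ω → ℝ≥0∞) (ω : Ω) : ℝ := (min (T ω : ℝ≥0∞) (T' ω)).toReal

open Classical in
/-- The failure indicator `δ = 1(X = T)`. -/
def failed (T : Ω → ℝ≥0) (T' : Ω → ℝ≥0∞) (ω : Ω) : Bool := decide (withdrawal T T' ω = T ω)

/-- The law `P` of `(X, δ, Z)`. -/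
def obsLaw (Pr : Measure Ω) (T : Ω → ℝ≥0) (T' : Ω → ℝ≥0∞) (Z : Ω → Vec k) : Measure (Obs k) :=
  Pr.map fun ω => (withdrawal T T' ω, failed T T' ω, Z ω)

instance (Pr : Measure Ω) [IsFiniteMeasure Pr] (T : Ω → ℝ≥0) (T' : Ω → ℝ≥0∞) (Z : Ω → Vec k) :
    IsFiniteMeasure (obsLaw Pr T T' Z) := by
  unfold obsLaw; infer_instance

/-- `τ_F = sup {t : P(T ≥ t) > 0}`. -/
def tauF (Pr : Measure Ω) (T : Ω → ℝ≥0) : ℝ≥0∞ :=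
  sSup {t : ℝ≥0∞ | 0 < Pr {ω | t ≤ (T ω : ℝ≥0∞)}}

end Sampling

section Functionals

/-! In this section `P` is the law of `(X, δ, Z)`; an observation is `p = (X, δ, Z)`, i.e.
`p.1 = X`, `p.2.1 = δ`, `p.2.2 = Z`. -/

variable {d k : ℕ} (P : Measure (Obs k))

/-- `τ₀ = sup {t : P(X ≥ t) > 0}`. -/
def tau0 : ℝ≥0∞ := sSup {t : ℝ≥0∞ | 0 < P {p | t ≤ ENNReal.ofReal p.1}}

/-- The joint subdistribution of `(X, Z)` on `{δ = b}`: `Q` for `b = true`, `Q_c` for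
`b = false`. -/
def subLaw (b : Bool) : Measure (ℝ × Vec k) :=
  (P.restrict {p | p.2.1 = b}).map fun p => (p.1, p.2.2)

/-- The measure `EN(du)`, where `N(t) = 1(X ≤ t, δ = 1)`. -/
def EN : Measure ℝ := (P.restrict {p | p.2.1 = true}).map fun p => p.1

/-- The conditional law of `(X, δ)` given `Z = z`. -/
def condObs [IsFiniteMeasure P] : Kernel (Vec k) (ℝ × Bool) :=
  condDistrib (fun p : Obs k => (p.1, p.2.1)) (fun p => p.2.2) P

/-- The conditional hazard measure `P(X ∈ du, δ = b | X ≥ u, Z = z)`: `Ā(du, z)` for `b = true`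
and `Ā_c(du, z)` for `b = false`. -/
def condHaz [IsFiniteMeasure P] (b : Bool) (z : Vec k) : Measure ℝ :=
  (((condObs P z).restrict {q | q.2 = b}).map Prod.fst).withDensity
    fun u => (condObs P z {q | u ≤ q.1})⁻¹

/-- `∫ h(u, Z) M(du)` for `b = true` and `∫ h(u, Z) M_c(du)` for `b = false`, where `M` and
`M_c` are the compensated failure and censoring counting processes, e.g.
`M(t) = 1(X ≤ t, δ = 1) - ∫₀ᵗ 1(X ≥ u) Ā(du, Z)`. -/
def martInt [IsFiniteMeasure P] (b : Bool) (h : ℝ → Vec k → ℝ) (p : Obs k) : ℝ :=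
  (if p.2.1 = b then h p.1 p.2.2 else 0) - ∫ u in Iic p.1, h u p.2.2 ∂(condHaz P b p.2.2)

/-- `R₁[b](x, z) = b(x, 1, z) - E[b(X, δ, Z) | X ≥ x, Z = z]`. -/
def R1 [IsFiniteMeasure P] (b : Obs k → ℝ) (x : ℝ) (z : Vec k) : ℝ :=
  b (x, true, z) -
    (∫ q in {q : ℝ × Bool | x ≤ q.1}, b (q.1, q.2, z) ∂(condObs P z)) /
      (condObs P z).real {q | x ≤ q.1}

/-! #### The functionals at `(θ, Γ)` -/

variable (α : ℝ → Vec d → Vec k → ℝ) (θ : Vec d) (Γ : ℝ → ℝ)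

/-- `s[f](u) = E Y(u) f(u, Z) α(Γ(u), θ, Z)`, with `Y(u) = 1(X ≥ u)`. -/
def s (f : ℝ → Vec k → ℝ) (u : ℝ) : ℝ :=
  ∫ p in {p : Obs k | u ≤ p.1}, f u p.2.2 * α (Γ u) θ p.2.2 ∂P

/-- `e[f] = s[f] / s[1]`. -/
def e (f : ℝ → Vec k → ℝ) (u : ℝ) : ℝ := s P α θ Γ f u / s P α θ Γ (fun _ _ => 1) u

/-- `cov[f₁, f₂] = e[f₁ f₂] - e[f₁] e[f₂]`. -/
def cov (f₁ f₂ : ℝ → Vec k → ℝ) (u : ℝ) : ℝ :=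
  e P α θ Γ (fun t z => f₁ t z * f₂ t z) u - e P α θ Γ f₁ u * e P α θ Γ f₂ u

/-- The function `(t, z) ↦ ℓ'(Γ(t), θ, z)`. -/
def ellPrime (t : ℝ) (z : Vec k) : ℝ := logHazDeriv α (Γ t) θ z

/-- `var[ℓ']`. -/
def varEll : ℝ → ℝ := cov P α θ Γ (ellPrime α θ Γ) (ellPrime α θ Γ)

/-- `C(du) = s[1](u)⁻² EN(du)`. -/
def C : Measure ℝ :=
  (EN P).withDensity fun u => ENNReal.ofReal ((s P α θ Γ (fun _ _ => 1) u ^ 2)⁻¹)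

/-- `B(du) = var[ℓ'](u) EN(du)`. -/
def B : Measure ℝ := (EN P).withDensity fun u => ENNReal.ofReal (varEll P α θ Γ u)

/-- `𝒫(u, t) = exp(-∫_u^t s[ℓ'] dC)`. -/
def prodInt (u t : ℝ) : ℝ :=
  Real.exp (-∫ v in Ioc u t, s P α θ Γ (ellPrime α θ Γ) v ∂(C P α θ Γ))

/-- `K(t, t') = ∫_0^{t ∧ t'} C(du) 𝒫(u, t) 𝒫(u, t')`. -/
def K (t t' : ℝ) : ℝ :=
  ∫ u in Ioc 0 (min t t'), prodInt P α θ Γ u t * prodInt P α θ Γ u t' ∂(C P α θ Γ)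

/-- `D[f](t) = -∫_0^t s[f](u) C(du) 𝒫(u, t)`. -/
def D (f : ℝ → Vec k → ℝ) (t : ℝ) : ℝ :=
  -∫ u in Ioc 0 t, s P α θ Γ f u * prodInt P α θ Γ u t ∂(C P α θ Γ)

/-- `κ(τ₀) = ∫∫_{0 < u ≤ t ≤ τ₀} C(du) 𝒫(u, t)² B(dt)`. -/
def kappa : ℝ≥0∞ :=
  ∫⁻ t in timeIoc 0 (tau0 P), ∫⁻ u in Ioc 0 t,
    ENNReal.ofReal (prodInt P α θ Γ u t ^ 2) ∂(C P α θ Γ) ∂(B P α θ Γ)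

/-- The integrability condition `κ(τ₀) < ∞`, together with what makes `κ(τ₀)` meaningful:
`var[ℓ']` is finite and the exponents of `𝒫(u, t)`, `t < τ₀`, exist. -/
structure IntegrabilityCondition : Prop where
  var_finite : ∀ᵐ u ∂(EN P), IntegrableOn
    (fun p : Obs k => ellPrime α θ Γ u p.2.2 ^ 2 * α (Γ u) θ p.2.2) {p | u ≤ p.1} P
  exponent : ∀ t ∈ timeIco (tau0 P),
    IntegrableOn (s P α θ Γ (ellPrime α θ Γ)) (Ioc 0 t) (C P α θ Γ)
  kappa_lt : kappa P α θ Γ < ∞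

/-- `ρ[f, φ] = cov[f, ℓ'] - φ var[ℓ']`. -/
def rho (f : ℝ → Vec k → ℝ) (φ : ℝ → ℝ) (u : ℝ) : ℝ :=
  cov P α θ Γ f (ellPrime α θ Γ) u - φ u * varEll P α θ Γ u

/-- `φ` is a solution in `L₂(B)` of the Fredholm equation
`φ(t) = -D[f](t) - ∫ K(t, u) φ(u) B(du) + ∫ K(t, u) cov[f, ℓ'](u) EN(du)`,
the integrals being over `(0, τ₀]`. -/
def IsFredholmSol (f : ℝ → Vec k → ℝ) (φ : ℝ → ℝ) : Prop :=
  MemLp φ 2 (B P α θ Γ) ∧ ∀ᵐ t ∂(B P α θ Γ),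
    φ t = -D P α θ Γ f t
      - (∫ u in timeIoc 0 (tau0 P), K P α θ Γ t u * φ u ∂(B P α θ Γ))
      + ∫ u in timeIoc 0 (tau0 P), K P α θ Γ t u * cov P α θ Γ f (ellPrime α θ Γ) u ∂(EN P)

/-- `W_f(t, θ, z)`, formed with the solution `φ` of the Fredholm equation. -/
def W (f : ℝ → Vec k → ℝ) (φ : ℝ → ℝ) (t : ℝ) (z : Vec k) : ℝ :=
  f t z - e P α θ Γ f t
    - (ellPrime α θ Γ t z - e P α θ Γ (ellPrime α θ Γ) t) * φ t
    - (s P α θ Γ (fun _ _ => 1) t)⁻¹ *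
        ∫ v in timeIoc t (tau0 P), prodInt P α θ Γ t v * rho P α θ Γ f φ v ∂(EN P)

/-- `U(f, θ) = ∫ W_f(u, θ, Z) M(du)`. -/
def U [IsFiniteMeasure P] (f : ℝ → Vec k → ℝ) (φ : ℝ → ℝ) : Obs k → ℝ :=
  martInt P true (W P α θ Γ f φ)

/-! #### Tangent spaces -/

/-- `L₂⁰(P)`, the mean zero elements of `L₂(P)`. -/
def meanZero [IsFiniteMeasure P] : Submodule ℝ (Lp ℝ 2 P) where
  carrier := {u | ∫ p, u p ∂P = 0}
  add_mem' := by
    intro u v hu hv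
    have hint : ∀ w : Lp ℝ 2 P, Integrable w P := fun w =>
      (Lp.memLp w).integrable (by norm_num)
    simp only [mem_ofPred_eq] at hu hv ⊢
    rw [integral_congr_ae (Lp.coeFn_add u v)]
    simp only [Pi.add_apply]
    rw [integral_add (hint u) (hint v), hu, hv, add_zero]
  zero_mem' := by
    simp only [mem_ofPred_eq]
    rw [integral_congr_ae (Lp.coeFn_zero ℝ 2 P)]
    simp
  smul_mem' := by
    intro c u hu
    simp only [mem_ofPred_eq] at hu ⊢
    rw [integral_congr_ae (Lp.coeFn_smul c u)]
    simp only [Pi.smul_apply, smul_eq_mul]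
    rw [integral_const_mul, hu, mul_zero]

/-- The function `(u, z) ↦ g(u) + ℓ'(Γ(u), θ, z) ∫_0^u g dΓ`. -/
def transDir (τ : ℝ≥0∞) (g : ℝ → ℝ) (u : ℝ) (z : Vec k) : ℝ :=
  g u + ellPrime α θ Γ u z * ∫ v in Ioc 0 u, g v ∂(stieltjes Γ τ)

/-- The directions `g` for the transformation: `∫_0^u g dΓ` exists for `u < τ₀` and
`g(X) + ℓ'(Γ(X), θ, Z) ∫_0^X g dΓ ∈ L₂(Q)`. Here `dΓ` lives on `[0, τ)`, `τ = τ_F`. -/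
def IsTransDir (τ : ℝ≥0∞) (g : ℝ → ℝ) : Prop :=
  (∀ t ∈ timeIco (tau0 P), IntegrableOn g (Ioc 0 t) (stieltjes Γ τ)) ∧
    MemLp (fun q : ℝ × Vec k => transDir α θ Γ τ g q.1 q.2) 2 (subLaw P true)

/-- The closed linear span in `L₂(P)` of the functions in `S`. -/
def closedSpan (S : Set (Obs k → ℝ)) : Submodule ℝ (Lp ℝ 2 P) :=
  (Submodule.span ℝ {u : Lp ℝ 2 P | ∃ h ∈ S, (u : Obs k → ℝ) =ᵐ[P] h}).topologicalClosure

/-- The tangent space for the transformation, spanned by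
`ℓ̇₂[g] = ∫ [g(u) + ℓ'(Γ(u), θ, Z) ∫_0^u g dΓ] M(du)`. -/
def tangentTrans [IsFiniteMeasure P] (τ : ℝ≥0∞) : Submodule ℝ (Lp ℝ 2 P) :=
  closedSpan P {h | ∃ g, IsTransDir P α θ Γ τ g ∧ h = martInt P true (transDir α θ Γ τ g)}

/-- The tangent space for the censoring hazard, spanned by `ℓ̇₃[b] = ∫ b(u, Z) M_c(du)`,
`b ∈ L₂(Q_c)`. -/
def tangentCens [IsFiniteMeasure P] : Submodule ℝ (Lp ℝ 2 P) :=
  closedSpan P {h | ∃ b : ℝ → Vec k → ℝ,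
    MemLp (fun q : ℝ × Vec k => b q.1 q.2) 2 (subLaw P false) ∧ h = martInt P false b}

/-- The tangent space for the law `μ` of the covariate, spanned by `ℓ̇₄[c] = c(Z)`,
`c ∈ L₂⁰(μ)`. -/
def tangentCov : Submodule ℝ (Lp ℝ 2 P) :=
  closedSpan P {h | ∃ c : Vec k → ℝ, MemLp c 2 (P.map fun p => p.2.2) ∧
    ∫ z, c z ∂(P.map fun p => p.2.2) = 0 ∧ h = fun p => c p.2.2}

/-- The nuisance tangent space, the sum of the tangent spaces of the three nuisance
parameters. -/
def nuisance [IsFiniteMeasure P] (τ : ℝ≥0∞) : Submodule ℝ (Lp ℝ 2 P) :=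
  tangentTrans P α θ Γ τ ⊔ tangentCens P ⊔ tangentCov P

/-- The orthocomplement in `L₂⁰(P)` of the nuisance tangent space. -/
def nuisancePerp [IsFiniteMeasure P] (τ : ℝ≥0∞) : Submodule ℝ (Lp ℝ 2 P) :=
  meanZero P ⊓ (nuisance P α θ Γ τ)ᗮ

lemma meanZero_eq [IsFiniteMeasure P] :
    meanZero P =
      (Submodule.span ℝ {indicatorConstLp 2 MeasurableSet.univ (measure_ne_top P univ)
        (1 : ℝ)})ᗮ := by
  ext u
  rw [Submodule.mem_orthogonal_singleton_iff_inner_right, L2.inner_indicatorConstLp_one,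
    setIntegral_univ]
  rfl

instance [IsFiniteMeasure P] (τ : ℝ≥0∞) :
    (nuisancePerp P α θ Γ τ).HasOrthogonalProjection := by
  have hc : IsClosed (nuisancePerp P α θ Γ τ : Set (Lp ℝ 2 P)) := by
    rw [nuisancePerp, meanZero_eq, Submodule.coe_inf]
    exact (Submodule.isClosed_orthogonal _).inter (Submodule.isClosed_orthogonal _)
  have : CompleteSpace (nuisancePerp P α θ Γ τ) := hc.completeSpace_coe
  infer_instance

end Functionals

/-! ### The transformation model and the censoring conditions -/

section Model

variable {Ω : Type*} [MeasurableSpace Ω] {d k : ℕ} (Pr : Measure Ω) [IsFiniteMeasure Pr]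
  (T : Ω → ℝ≥0) (T' : Ω → ℝ≥0∞) (Z : Ω → Vec k)

/-- `T` and `T'` are conditionally independent given `Z`, and the conditional cumulative hazard
of `T` given `Z = z` is `A(Γ(t), θ, z)`, `t ∈ [0, τ_F)`. -/
structure IsTransformationModel (α : ℝ → Vec d → Vec k → ℝ) (θ : Vec d) (Γ : ℝ → ℝ) : Prop where
  condIndep : ∀ᵐ z ∂(Pr.map Z), condDistrib (fun ω => (T ω, T' ω)) Z Pr z =
    (condDistrib T Z Pr z).prod (condDistrib T' Z Pr z)
  survival : ∀ᵐ z ∂(Pr.map Z), ∀ t ∈ timeIco (tauF Pr T),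
    condDistrib T Z Pr z {x | t < (x : ℝ)} = ENNReal.ofReal (Real.exp (-cumHaz α (Γ t) θ z))

/-- The conditions on the nuisance parameters. (That the censoring hazard and the covariate law
carry no information on `(θ, Γ)` is expressed by the tangent spaces: the three nuisance
parameters and `θ` vary independently of each other.) -/
structure NuisanceConditions (Γ : ℝ → ℝ) : Prop where
  nondegenerate : ∀ z, Pr.map Z ≠ Measure.dirac z
  transformation : IsTransformation Γ (tauF Pr T)
  atom : tau0 (obsLaw Pr T T' Z) < tauF Pr T → 0 < Pr {ω | T' ω = tau0 (obsLaw Pr T T' Z)}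

end Model

end CensTrans

end

open CensTrans

/-!
The proof has a probabilistic half, which turns the statement into one about the Hilbert space
`L₂(Q)`, and a functional-analytic half, which solves a least squares problem there.

*Martingales.* The time transformation is continuous, so the conditional law of an observed
failure time given `Z` has no atoms. For this reason `h ↦ ∫ h dM` is an isometry of `L₂(Q)` into
`L₂(P)` whose adjoint is the residual map `R₁` (`memLp_martInt`, `memLp_residual`,
`integral_martInt_mul`). Both facts are first shown for a fixed value of `Z` and bounded integrands
that vanish where the risk of `X ≥ u` is small, and then extended by approximation. The map `R₁` is
a left inverse of `h ↦ ∫ h dM` and kills the integrals `∫ b dM_c` and the functions of `Z`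
(`residual_martInt`, `residual_cov`). Conversely an element of `L₂⁰(P)` orthogonal to these is
`∫ R₁(b) dM` (`ae_eq_martInt_residual`); this is a completeness statement, and comes down to the
fact that an element of conditional mean zero given `Z` which equals its own mean residual values
vanishes (`ae_eq_zero_of_eq_meanResidual`). Hence the orthocomplement of the nuisance tangent space
consists of the integrals `∫ h dM` with `h` orthogonal in
`L₂(Q)` to all directions `g + ℓ' ∫ g dΓ`.

*The transformation model.* The observed failures have intensity `s[1] dΓ`, and given a failure at
`u` the covariate is distributed as on `X ≥ u`, reweighted by the hazard rate (`coreFacts_obsLaw`).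
This follows from the change of variables along the generalized inverse of `Γ`
(`eq_stieltjes_withDensity`) and from independent censoring (`failures_withDensity`). It
identifies `e[f](u)` with the conditional expectation of `f(u, Z)` given a failure at `u`, so that
`J₁ h = h / s[1]` and `J₂ φ = (ℓ' - e[ℓ']) φ` embed `L₂(C)` and `L₂(B)` isometrically into `L₂(Q)`,
with orthogonal ranges (`IsWeight`, `weightOp`).

*Normal equations.* Let `V` be the integral operator from `L₂(C)` to `L₂(B)` with the Volterra
kernel `𝒫(u, t)`, `u ≤ t`. It is Hilbert–Schmidt with squared norm `κ(τ₀)`. By variation of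
constants, the square integrable directions `g + ℓ' ∫ g dΓ` are exactly the range of `J₁ + J₂ V`
(`CoreFacts.exists_isTransDir`, `CoreFacts.exists_of_isTransDir`). The residual of
projecting `f` on that range is `f - J₁ h - J₂ φ`, where `h = J₁* f + V* (J₂* f - φ)` and `φ = V h`
(`inner_residual_eq_zero`). Eliminating `h` leaves `(1 + V V*) φ = V (J₁* f + V* J₂* f)`. As `K` is
the kernel of `V V*`, this is the Fredholm equation (`CoreFacts.isFredholmSol_iff`); it has exactly
one solution because `1 + V V*` is invertible (`bijective_one_add_mul_adjoint`), and the residual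
is `W_f` (`CoreFacts.W_decomposition`). The projection of `b` onto the orthocomplement is
therefore `∫ W dM` with `W` the residual of `f = R₁(b)`
(`martInt_mem_nuisancePerp`, `starProjection_nuisancePerp_ae_eq`).
-/

namespace CensTrans

/-! ### Square integrability -/

section SquareIntegrable

variable {X Y : Type*} [MeasurableSpace X] [MeasurableSpace Y]

/-- The Cauchy–Schwarz inequality for the lower Lebesgue integral. -/
lemma sq_lintegral_mul_le {μ : Measure X} {f g : X → ℝ≥0∞} (hf : AEMeasurable f μ)
    (hg : AEMeasurable g μ) :
    (∫⁻ x, f x * g x ∂μ) ^ 2 ≤ (∫⁻ x, f x ^ 2 ∂μ) * ∫⁻ x, g x ^ 2 ∂μ := by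
  have h := ENNReal.lintegral_mul_le_Lp_mul_Lq μ Real.HolderConjugate.two_two hf hg
  simp only [Pi.mul_apply, ENNReal.rpow_two] at h
  have h2 := pow_le_pow_left₀ zero_le h 2
  rw [mul_pow, ← ENNReal.rpow_natCast, ← ENNReal.rpow_natCast, ← ENNReal.rpow_natCast,
    ← ENNReal.rpow_mul, ← ENNReal.rpow_mul] at h2
  simpa using h2

lemma sq_eLpNorm_two {μ : Measure X} (f : X → ℝ) :
    eLpNorm f 2 μ ^ 2 = ∫⁻ x, ‖f x‖ₑ ^ 2 ∂μ := by
  have := eLpNorm_nnreal_pow_eq_lintegral (f := f) (μ := μ) (p := 2) (by norm_num)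
  norm_num at this
  exact_mod_cast this

lemma memLp_two_iff_lintegral {μ : Measure X} {f : X → ℝ} (hf : AEStronglyMeasurable f μ) :
    MemLp f 2 μ ↔ ∫⁻ x, ‖f x‖ₑ ^ 2 ∂μ < ∞ := by
  rw [← sq_eLpNorm_two, MemLp, and_iff_right hf]
  simp

lemma integral_inner_eq {μ : Measure X} (f g : Lp ℝ 2 μ) : ⟪f, g⟫_ℝ = ∫ x, f x * g x ∂μ := by
  rw [L2.inner_def]
  refine integral_congr_ae (ae_of_all _ fun x => ?_)
  simp [mul_comm]

lemma memLp_two_mul_integrable {μ : Measure X} {f g : X → ℝ} (hf : MemLp f 2 μ)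
    (hg : MemLp g 2 μ) : Integrable (fun x => f x * g x) μ :=
  hf.integrable_mul hg

lemma norm_sq_eq_integral {μ : Measure X} {f : X → ℝ} (hf : MemLp f 2 μ) :
    ‖hf.toLp f‖ ^ 2 = ∫ x, f x ^ 2 ∂μ := by
  rw [← real_inner_self_eq_norm_sq, integral_inner_eq]
  refine integral_congr_ae ?_
  filter_upwards [hf.coeFn_toLp] with x hx
  rw [hx, sq]

lemma memLp_tensor {B : Measure Y} {C : Measure X} [SFinite B] [SFinite C]
    {ψ : Y → ℝ} {h : X → ℝ} (hψ : MemLp ψ 2 B) (hh : MemLp h 2 C) :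
    MemLp (fun p : Y × X => ψ p.1 * h p.2) 2 (B.prod C) := by
  have hm1 : AEStronglyMeasurable (fun p : Y × X => ψ p.1) (B.prod C) := hψ.1.comp_fst
  have hm2 : AEStronglyMeasurable (fun p : Y × X => h p.2) (B.prod C) := hh.1.comp_snd
  have hm : AEStronglyMeasurable (fun p : Y × X => ψ p.1 * h p.2) (B.prod C) := hm1.mul hm2
  rw [memLp_two_iff_lintegral hm]
  have e1 := (memLp_two_iff_lintegral hψ.1).1 hψ
  have e2 := (memLp_two_iff_lintegral hh.1).1 hh
  calc ∫⁻ p : Y × X, ‖ψ p.1 * h p.2‖ₑ ^ 2 ∂(B.prod C)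
      = ∫⁻ p : Y × X, (‖ψ p.1‖ₑ ^ 2) * (‖h p.2‖ₑ ^ 2) ∂(B.prod C) := by
        refine lintegral_congr fun p => ?_
        rw [enorm_mul, mul_pow]
    _ = (∫⁻ y, ‖ψ y‖ₑ ^ 2 ∂B) * ∫⁻ x, ‖h x‖ₑ ^ 2 ∂C :=
        lintegral_prod_mul (hψ.1.enorm.pow_const 2) (hh.1.enorm.pow_const 2)
    _ < ∞ := ENNReal.mul_lt_top e1 e2

/-! ### Hilbert–Schmidt integral operators -/

lemma lintegral_integral_kernel_sq_le {B : Measure Y} {C : Measure X} [SFinite C]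
    {k : Y → X → ℝ} (hk : AEStronglyMeasurable (fun p : Y × X => k p.1 p.2) (B.prod C))
    {h : X → ℝ} (hh : AEStronglyMeasurable h C) :
    ∫⁻ y, ‖∫ x, k y x * h x ∂C‖ₑ ^ 2 ∂B ≤
      (∫⁻ p : Y × X, ‖k p.1 p.2‖ₑ ^ 2 ∂(B.prod C)) * ∫⁻ x, ‖h x‖ₑ ^ 2 ∂C := by
  have hsec := hk.prodMk_left
  rw [lintegral_prod _ (hk.enorm.pow_const 2)]
  have hm : AEMeasurable (fun y => ∫⁻ x, ‖k y x‖ₑ ^ 2 ∂C) B :=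
    (hk.enorm.pow_const 2).lintegral_prod_right'
  rw [← lintegral_mul_const'' _ hm]
  refine lintegral_mono_ae ?_
  filter_upwards [hsec] with y hy
  calc ‖∫ x, k y x * h x ∂C‖ₑ ^ 2 ≤ (∫⁻ x, ‖k y x * h x‖ₑ ∂C) ^ 2 :=
        pow_le_pow_left₀ zero_le (enorm_integral_le_lintegral_enorm _) 2
    _ = (∫⁻ x, ‖k y x‖ₑ * ‖h x‖ₑ ∂C) ^ 2 := by simp_rw [enorm_mul]
    _ ≤ _ := sq_lintegral_mul_le hy.enorm hh.enorm

lemma memLp_integral_kernel {B : Measure Y} {C : Measure X} [SFinite C] {k : Y → X → ℝ}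
    (hk : MemLp (fun p : Y × X => k p.1 p.2) 2 (B.prod C)) {h : X → ℝ} (hh : MemLp h 2 C) :
    MemLp (fun y => ∫ x, k y x * h x ∂C) 2 B := by
  have hm : AEStronglyMeasurable (fun y => ∫ x, k y x * h x ∂C) B :=
    AEStronglyMeasurable.integral_prod_right' (f := fun p : Y × X => k p.1 p.2 * h p.2)
      (hk.1.mul hh.1.comp_snd)
  rw [memLp_two_iff_lintegral hm]
  exact (lintegral_integral_kernel_sq_le hk.1 hh.1).trans_lt
    (ENNReal.mul_lt_top ((memLp_two_iff_lintegral hk.1).1 hk) ((memLp_two_iff_lintegral hh.1).1 hh))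

lemma integrable_kernel_mul {B : Measure Y} {C : Measure X} [SFinite B] [SFinite C]
    {k : Y → X → ℝ} (hk : MemLp (fun p : Y × X => k p.1 p.2) 2 (B.prod C)) {h : X → ℝ}
    (hh : MemLp h 2 C) : ∀ᵐ y ∂B, Integrable (fun x => k y x * h x) C := by
  have h1 : ∀ᵐ y ∂B, MemLp (k y) 2 C := by
    have hlt := (memLp_two_iff_lintegral hk.1).1 hk
    rw [lintegral_prod _ (hk.1.enorm.pow_const 2)] at hlt
    filter_upwards [hk.1.prodMk_left,
      ae_lt_top' (hk.1.enorm.pow_const 2).lintegral_prod_right' hlt.ne] with y hy1 hy2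
    exact (memLp_two_iff_lintegral hy1).2 hy2
  filter_upwards [h1] with y hy
  exact memLp_two_mul_integrable hy hh

/-- The Hilbert–Schmidt operator `h ↦ ∫ k(·, x) h(x) C(dx)` from `L₂(C)` to `L₂(B)`. -/
noncomputable def hsOp {B : Measure Y} {C : Measure X} [SFinite B] [SFinite C] (k : Y → X → ℝ)
    (hk : MemLp (fun p : Y × X => k p.1 p.2) 2 (B.prod C)) : Lp ℝ 2 C →L[ℝ] Lp ℝ 2 B :=
  LinearMap.mkContinuous
    { toFun := fun h => (memLp_integral_kernel hk (Lp.memLp h)).toLp _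
      map_add' := by
        intro h h'
        refine Lp.ext ?_
        refine (MemLp.coeFn_toLp _).trans (EventuallyEq.trans ?_ (Lp.coeFn_add _ _).symm)
        filter_upwards [integrable_kernel_mul hk (Lp.memLp h),
          integrable_kernel_mul hk (Lp.memLp h'),
          (memLp_integral_kernel hk (Lp.memLp h)).coeFn_toLp,
          (memLp_integral_kernel hk (Lp.memLp h')).coeFn_toLp] with y h1 h2 h3 h4
        rw [Pi.add_apply, h3, h4, ← integral_add h1 h2]
        refine integral_congr_ae ?_
        filter_upwards [Lp.coeFn_add h h'] with x hx
        rw [hx, Pi.add_apply, mul_add]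
      map_smul' := by
        intro c h
        refine Lp.ext ?_
        refine (MemLp.coeFn_toLp _).trans (EventuallyEq.trans ?_ (Lp.coeFn_smul _ _).symm)
        filter_upwards [(memLp_integral_kernel hk (Lp.memLp h)).coeFn_toLp] with y h3
        rw [Pi.smul_apply, RingHom.id_apply, h3, smul_eq_mul, ← integral_const_mul]
        refine integral_congr_ae ?_
        filter_upwards [Lp.coeFn_smul c h] with x hx
        rw [hx, Pi.smul_apply, smul_eq_mul]
        ring }
    (eLpNorm (fun p : Y × X => k p.1 p.2) 2 (B.prod C)).toReal
    (by
      intro h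
      rw [LinearMap.coe_mk, AddHom.coe_mk, Lp.norm_toLp, Lp.norm_def, ← ENNReal.toReal_mul]
      refine ENNReal.toReal_mono (ENNReal.mul_ne_top hk.2.ne (Lp.memLp h).2.ne) ?_
      rw [← ENNReal.pow_le_pow_left_iff two_ne_zero, mul_pow,
        sq_eLpNorm_two, sq_eLpNorm_two, sq_eLpNorm_two]
      exact lintegral_integral_kernel_sq_le hk.1 (Lp.memLp h).1)

lemma hsOp_coeFn {B : Measure Y} {C : Measure X} [SFinite B] [SFinite C] (k : Y → X → ℝ)
    (hk : MemLp (fun p : Y × X => k p.1 p.2) 2 (B.prod C)) (h : Lp ℝ 2 C) :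
    hsOp k hk h =ᵐ[B] fun y => ∫ x, k y x * h x ∂C :=
  (memLp_integral_kernel hk (Lp.memLp h)).coeFn_toLp

lemma memLp_kernel_swap {B : Measure Y} {C : Measure X} [SFinite B] [SFinite C] {k : Y → X → ℝ}
    (hk : MemLp (fun p : Y × X => k p.1 p.2) 2 (B.prod C)) :
    MemLp (fun p : X × Y => k p.2 p.1) 2 (C.prod B) := by
  have := (Measure.measurePreserving_swap (μ := C) (ν := B))
  exact hk.comp_measurePreserving this

/-- The adjoint of an integral operator has the transposed kernel. -/
lemma hsOp_adjoint {B : Measure Y} {C : Measure X} [SFinite B] [SFinite C] (k : Y → X → ℝ)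
    (hk : MemLp (fun p : Y × X => k p.1 p.2) 2 (B.prod C)) :
    ContinuousLinearMap.adjoint (hsOp k hk) =
      hsOp (fun x y => k y x) (memLp_kernel_swap hk) := by
  symm
  rw [ContinuousLinearMap.eq_adjoint_iff]
  intro ψ h
  rw [integral_inner_eq, integral_inner_eq]
  have hint : Integrable (fun p : Y × X => k p.1 p.2 * (ψ p.1 * h p.2)) (B.prod C) :=
    memLp_two_mul_integrable hk (memLp_tensor (Lp.memLp ψ) (Lp.memLp h))
  calc ∫ x, hsOp (fun x y => k y x) (memLp_kernel_swap hk) ψ x * h x ∂C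
      = ∫ x, ∫ y, k y x * (ψ y * h x) ∂B ∂C := by
        refine integral_congr_ae ?_
        filter_upwards [hsOp_coeFn (fun x y => k y x) (memLp_kernel_swap hk) ψ] with x hx
        rw [hx, ← integral_mul_const]
        simp only [mul_assoc]
    _ = ∫ y, ∫ x, k y x * (ψ y * h x) ∂C ∂B := (integral_integral_swap hint).symm
    _ = ∫ y, ψ y * hsOp k hk h y ∂B := by
        refine integral_congr_ae ?_
        filter_upwards [hsOp_coeFn _ hk h] with y hy
        rw [hy, ← integral_const_mul]
        refine integral_congr_ae (ae_of_all _ fun x => ?_)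
        ring

end SquareIntegrable

/-! ### The normal equations in Hilbert space -/

section Hilbert

variable {H HB HC : Type*} [NormedAddCommGroup H] [InnerProductSpace ℝ H] [CompleteSpace H]
  [NormedAddCommGroup HB] [InnerProductSpace ℝ HB] [CompleteSpace HB]
  [NormedAddCommGroup HC] [InnerProductSpace ℝ HC] [CompleteSpace HC]

open ContinuousLinearMap (adjoint)

/-- The operator `1 + V V*` is bounded below by `1`, hence invertible. -/
lemma bijective_one_add_mul_adjoint (V : HC →L[ℝ] HB) :
    Function.Bijective fun φ : HB => φ + V (adjoint V φ) := by
  have h : IsUnit (1 + V ∘L adjoint V : HB →L[ℝ] HB) := by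
    refine ContinuousLinearMap.isUnit_of_forall_le_norm_inner_map _ (c := 1) one_pos fun x => ?_
    have : ⟪(1 + V ∘L adjoint V : HB →L[ℝ] HB) x, x⟫_ℝ = ‖x‖ ^ 2 + ‖adjoint V x‖ ^ 2 := by
      rw [_root_.add_apply, one_apply_eq_self,
        ContinuousLinearMap.comp_apply, inner_add_left, real_inner_self_eq_norm_sq,
        ← ContinuousLinearMap.adjoint_inner_right, real_inner_self_eq_norm_sq]
    rw [this, Real.norm_of_nonneg (by positivity)]
    simp only [NNReal.coe_one, mul_one, le_add_iff_nonneg_right]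
    positivity
  exact (ContinuousLinearMap.isUnit_iff_bijective).1 h

/-- Let `J₁`, `J₂` be isometries with orthogonal ranges and `h = J₁* f + V* (J₂* f - φ)`. Then
`f - J₁ h - J₂ φ` is orthogonal to the range of `J₁ + J₂ V`. (If moreover `φ = V h`, which is an
equation for `φ`, it is the residual of the projection of `f` onto that range.) -/
lemma inner_residual_eq_zero (V : HC →L[ℝ] HB) (J₁ : HC →L[ℝ] H) (J₂ : HB →L[ℝ] H)
    (h₁ : ∀ h h', ⟪J₁ h, J₁ h'⟫_ℝ = ⟪h, h'⟫_ℝ) (h₂ : ∀ φ φ', ⟪J₂ φ, J₂ φ'⟫_ℝ = ⟪φ, φ'⟫_ℝ)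
    (h₁₂ : ∀ h φ, ⟪J₁ h, J₂ φ⟫_ℝ = 0) (f : H) (φ : HB)
    (h' : HC) :
    ⟪f - J₁ (adjoint J₁ f + adjoint V (adjoint J₂ f - φ)) - J₂ φ, J₁ h' + J₂ (V h')⟫_ℝ = 0 := by
  have h21 : ∀ φ h, ⟪J₂ φ, J₁ h⟫_ℝ = 0 := fun φ h => by rw [real_inner_comm, h₁₂]
  simp only [inner_sub_left, inner_add_right, h₁, h₂, h₁₂, h21, inner_add_left,
    ContinuousLinearMap.adjoint_inner_left, map_add, map_sub]
  ring

end Hilbert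

/-! ### Linear integral equations with respect to an atomless measure -/

section Primitive

variable {C : Measure ℝ}

lemma norm_primitive_le {a : ℝ → ℝ} {t u : ℝ} (ha : IntegrableOn a (Ioc 0 t) C) (hu : u ≤ t) :
    ‖∫ v in Ioc 0 u, a v ∂C‖ ≤ ∫ v in Ioc 0 t, ‖a v‖ ∂C :=
  (norm_integral_le_integral_norm _).trans
    (setIntegral_mono_set ha.norm (ae_of_all _ fun _ => norm_nonneg _)
      (Ioc_subset_Ioc_right hu).eventuallyLE)

lemma setIntegral_Ioc_eq_indicator {a : ℝ → ℝ} {t u : ℝ} (hu : u ≤ t) :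
    ∫ v in Ioc 0 u, a v ∂C = ∫ v in Ioc 0 t, (Iic u).indicator a v ∂C := by
  rw [setIntegral_indicator measurableSet_Iic, Ioc_inter_Iic, min_eq_right hu]

lemma aestronglyMeasurable_primitive [SFinite C] {a : ℝ → ℝ} {t : ℝ}
    (ha : AEStronglyMeasurable a (C.restrict (Ioc 0 t))) :
    AEStronglyMeasurable (fun u => ∫ v in Ioc 0 u, a v ∂C) (C.restrict (Ioc 0 t)) := by
  have h1 : AEStronglyMeasurable (fun p : ℝ × ℝ => {q : ℝ × ℝ | q.2 ≤ q.1}.indicator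
      (fun q => a q.2) p) ((C.restrict (Ioc 0 t)).prod (C.restrict (Ioc 0 t))) :=
    AEStronglyMeasurable.indicator ha.comp_snd (measurableSet_le measurable_snd measurable_fst)
  refine h1.integral_prod_right'.congr ?_
  filter_upwards [ae_restrict_mem measurableSet_Ioc] with u hu
  rw [setIntegral_Ioc_eq_indicator hu.2]
  refine integral_congr_ae (ae_of_all _ fun v => ?_)
  simp [indicator]

lemma integrableOn_mul_primitive [SFinite C] {a b : ℝ → ℝ} {t : ℝ}
    (ha : IntegrableOn a (Ioc 0 t) C) (hb : IntegrableOn b (Ioc 0 t) C) :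
    IntegrableOn (fun u => a u * ∫ v in Ioc 0 u, b v ∂C) (Ioc 0 t) C := by
  refine Integrable.mul_bdd (c := ∫ v in Ioc 0 t, ‖b v‖ ∂C) ha
    (aestronglyMeasurable_primitive hb.1) ?_
  filter_upwards [ae_restrict_mem measurableSet_Ioc] with u hu using norm_primitive_le hb hu.2

/-- Integration by parts for primitives with respect to an atomless measure. -/
lemma primitive_mul_primitive [SFinite C] [NullSingletonClass C] {a b : ℝ → ℝ} {t : ℝ}
    (ha : IntegrableOn a (Ioc 0 t) C) (hb : IntegrableOn b (Ioc 0 t) C) :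
    (∫ u in Ioc 0 t, a u ∂C) * (∫ u in Ioc 0 t, b u ∂C) =
      ∫ u in Ioc 0 t, (a u * (∫ v in Ioc 0 u, b v ∂C) + b u * ∫ v in Ioc 0 u, a v ∂C) ∂C := by
  rw [integral_add (integrableOn_mul_primitive ha hb) (integrableOn_mul_primitive hb ha)]
  set m := C.restrict (Ioc 0 t) with hm
  have hprod : Integrable (fun p : ℝ × ℝ => a p.1 * b p.2) (m.prod m) := ha.mul_prod hb
  have hle : MeasurableSet {p : ℝ × ℝ | p.2 ≤ p.1} := measurableSet_le measurable_snd measurable_fst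
  have key : ∫ p, {p : ℝ × ℝ | p.2 ≤ p.1}.indicator (fun p => a p.1 * b p.2) p ∂(m.prod m) =
      ∫ u in Ioc 0 t, a u * (∫ v in Ioc 0 u, b v ∂C) ∂C := by
    rw [integral_prod _ (hprod.indicator hle)]
    refine setIntegral_congr_fun measurableSet_Ioc fun u hu => ?_
    rw [setIntegral_Ioc_eq_indicator hu.2, ← integral_const_mul]
    refine integral_congr_ae (ae_of_all _ fun v => ?_)
    by_cases h : v ≤ u <;> simp [indicator, h]
  have key2 : ∫ p, {p : ℝ × ℝ | p.2 ≤ p.1}ᶜ.indicator (fun p => a p.1 * b p.2) p ∂(m.prod m) =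
      ∫ u in Ioc 0 t, b u * (∫ v in Ioc 0 u, a v ∂C) ∂C := by
    rw [integral_prod_symm _ (hprod.indicator hle.compl)]
    refine setIntegral_congr_fun measurableSet_Ioc fun u hu => ?_
    rw [setIntegral_Ioc_eq_indicator hu.2, ← integral_const_mul]
    refine integral_congr_ae ?_
    have hne : ∀ᵐ v ∂m, v ≠ u := by
      refine ae_restrict_of_ae ?_
      rw [ae_iff]; simp
    filter_upwards [hne] with v hv
    by_cases h : v ≤ u
    · simp [indicator, h, lt_of_le_of_ne h hv, mul_comm]
    · simp [indicator, h, not_lt.2 (not_le.1 h).le]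
  rw [← key, ← key2, ← integral_add (hprod.indicator hle) (hprod.indicator hle.compl),
    ← integral_prod_mul]
  refine integral_congr_ae (ae_of_all _ fun p => ?_)
  exact (congrFun (indicator_self_add_compl {p : ℝ × ℝ | p.2 ≤ p.1} fun p => a p.1 * b p.2) p).symm

/-- The powers of a primitive `∫_{(0, r]} s dC` with respect to an atomless measure satisfy the
usual chain rule. -/
lemma primitive_pow [SFinite C] [NullSingletonClass C] {s : ℝ → ℝ} {t : ℝ}
    (hs : IntegrableOn s (Ioc 0 t) C) (n : ℕ) :
    ∀ r ≤ t, IntegrableOn (fun u => (n + 1) * (∫ v in Ioc 0 u, s v ∂C) ^ n * s u) (Ioc 0 r) C ∧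
      (∫ u in Ioc 0 r, s u ∂C) ^ (n + 1) =
      ∫ u in Ioc 0 r, (n + 1) * (∫ v in Ioc 0 u, s v ∂C) ^ n * s u ∂C := by
  induction n with
  | zero =>
    intro r hr
    simpa using hs.mono_set (Ioc_subset_Ioc_right hr)
  | succ n ih =>
    intro r hr
    have hsr := hs.mono_set (Ioc_subset_Ioc_right hr)
    have hi := integrableOn_mul_primitive (ih r hr).1 hsr
    have e : ∀ u ∈ Ioc 0 r, ((n + 1 : ℕ) + 1) * (∫ v in Ioc 0 u, s v ∂C) ^ (n + 1) * s u =
        (n + 1) * (∫ v in Ioc 0 u, s v ∂C) ^ n * s u * (∫ v in Ioc 0 u, s v ∂C) +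
        s u * ∫ v in Ioc 0 u, (n + 1) * (∫ w in Ioc 0 v, s w ∂C) ^ n * s v ∂C := by
      intro u hu
      rw [← (ih u (hu.2.trans hr)).2]
      push_cast
      ring
    refine ⟨?_, ?_⟩
    · refine IntegrableOn.congr_fun ?_ (fun u hu => (e u hu).symm) measurableSet_Ioc
      exact hi.add (integrableOn_mul_primitive hsr (ih r hr).1)
    · rw [pow_succ, (ih r hr).2, primitive_mul_primitive (ih r hr).1 hsr]
      exact (setIntegral_congr_fun measurableSet_Ioc e).symm

/-- The chain rule for the exponential of a primitive, from the exponential series. -/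
lemma exp_primitive [SFinite C] [NullSingletonClass C] {s : ℝ → ℝ} {t : ℝ}
    (hs : IntegrableOn s (Ioc 0 t) C) :
    IntegrableOn (fun u => Real.exp (∫ v in Ioc 0 u, s v ∂C) * s u) (Ioc 0 t) C ∧
    Real.exp (∫ u in Ioc 0 t, s u ∂C) =
      1 + ∫ u in Ioc 0 t, Real.exp (∫ v in Ioc 0 u, s v ∂C) * s u ∂C := by
  set L : ℝ → ℝ := fun u => ∫ v in Ioc 0 u, s v ∂C with hL
  set M := ∫ v in Ioc 0 t, ‖s v‖ ∂C with hM
  have hM0 : 0 ≤ M := integral_nonneg fun _ => norm_nonneg _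
  have hLM : ∀ u ∈ Ioc 0 t, ‖L u‖ ≤ M := fun u hu => norm_primitive_le hs hu.2
  have hLm : AEStronglyMeasurable L (C.restrict (Ioc 0 t)) := aestronglyMeasurable_primitive hs.1
  have hint : ∀ n : ℕ, IntegrableOn (fun u => L u ^ n / n.factorial * s u) (Ioc 0 t) C := by
    intro n
    refine Integrable.bdd_mul (c := M ^ n / n.factorial) hs ?_ ?_
    · exact ((continuous_pow n).div_const (n.factorial : ℝ)).comp_aestronglyMeasurable hLm
    · filter_upwards [ae_restrict_mem measurableSet_Ioc] with u hu
      rw [norm_div, norm_pow, Real.norm_natCast]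
      gcongr
      exact hLM u hu
  have hsum : Summable fun n : ℕ => ∫ u in Ioc 0 t, ‖L u ^ n / n.factorial * s u‖ ∂C := by
    refine Summable.of_nonneg_of_le (fun n => integral_nonneg fun _ => norm_nonneg _) (fun n => ?_)
      ((Real.summable_pow_div_factorial M).mul_right M)
    rw [hM, ← integral_const_mul, ← hM]
    refine setIntegral_mono_on (hint n).norm (hs.norm.const_mul _) measurableSet_Ioc fun u hu => ?_
    rw [norm_mul, norm_div, norm_pow, Real.norm_natCast]
    gcongr
    exact hLM u hu
  have hexp : ∀ u, ∑' n : ℕ, L u ^ n / n.factorial * s u = Real.exp (L u) * s u := by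
    intro u
    rw [tsum_mul_right, Real.exp_eq_exp_ℝ, NormedSpace.exp_eq_tsum_div]
  have h2 := hasSum_integral_of_summable_integral_norm (fun n => hint n) hsum
  simp only [hexp] at h2
  have h3 : ∀ n : ℕ, ∫ u in Ioc 0 t, L u ^ n / n.factorial * s u ∂C =
      L t ^ (n + 1) / (n + 1).factorial := by
    intro n
    rw [(primitive_pow hs n t le_rfl).2, ← integral_div]
    refine integral_congr_ae (ae_of_all _ fun u => ?_)
    simp only [Nat.factorial_succ, hL]
    push_cast
    field_simp
  simp only [h3] at h2
  refine ⟨?_, ?_⟩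
  · refine Integrable.bdd_mul (c := Real.exp M) hs
      (Real.continuous_exp.comp_aestronglyMeasurable hLm) ?_
    filter_upwards [ae_restrict_mem measurableSet_Ioc] with u hu
    rw [Real.norm_of_nonneg (Real.exp_pos _).le]
    exact Real.exp_le_exp.2 ((Real.le_norm_self _).trans (hLM u hu))
  · have h4 := NormedSpace.expSeries_div_hasSum_exp (L t)
    rw [← Real.exp_eq_exp_ℝ] at h4
    have h5 := (hasSum_nat_add_iff' 1).2 h4
    simp at h5
    have := h5.unique h2
    linarith

lemma primitive_neg {s : ℝ → ℝ} (u : ℝ) :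
    ∫ v in Ioc 0 u, -s v ∂C = -∫ v in Ioc 0 u, s v ∂C := integral_neg _

lemma exp_neg_setIntegral_Ioc {s : ℝ → ℝ} {u t : ℝ} (hs : IntegrableOn s (Ioc 0 t) C)
    (hu : 0 ≤ u) (hut : u ≤ t) :
    Real.exp (-∫ v in Ioc u t, s v ∂C) =
      Real.exp (-∫ v in Ioc 0 t, s v ∂C) * Real.exp (∫ v in Ioc 0 u, s v ∂C) := by
  rw [← Real.exp_add, ← Ioc_union_Ioc_eq_Ioc hu hut, setIntegral_union
    (Ioc_disjoint_Ioc_of_le le_rfl) measurableSet_Ioc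
    (hs.mono_set (Ioc_subset_Ioc_right hut)) (hs.mono_set (Ioc_subset_Ioc_left hu))]
  congr 1
  ring

lemma setIntegral_exp_mul {s h : ℝ → ℝ} {t : ℝ} (hs : IntegrableOn s (Ioc 0 t) C) :
    ∫ u in Ioc 0 t, Real.exp (-∫ v in Ioc u t, s v ∂C) * h u ∂C =
      Real.exp (-∫ v in Ioc 0 t, s v ∂C) *
        ∫ u in Ioc 0 t, Real.exp (∫ v in Ioc 0 u, s v ∂C) * h u ∂C := by
  rw [← integral_const_mul]
  refine setIntegral_congr_fun measurableSet_Ioc fun u hu => ?_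
  rw [exp_neg_setIntegral_Ioc hs hu.1.le hu.2, mul_assoc]

lemma integrableOn_exp_primitive_mul [SFinite C] {s h : ℝ → ℝ} {t : ℝ}
    (hs : IntegrableOn s (Ioc 0 t) C) (hh : IntegrableOn h (Ioc 0 t) C) :
    IntegrableOn (fun u => Real.exp (∫ v in Ioc 0 u, s v ∂C) * h u) (Ioc 0 t) C := by
  refine Integrable.bdd_mul (c := Real.exp (∫ v in Ioc 0 t, ‖s v‖ ∂C)) hh
    (Real.continuous_exp.comp_aestronglyMeasurable (aestronglyMeasurable_primitive hs.1)) ?_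
  filter_upwards [ae_restrict_mem measurableSet_Ioc] with u hu
  rw [Real.norm_of_nonneg (Real.exp_pos _).le]
  exact Real.exp_le_exp.2 ((Real.le_norm_self _).trans (norm_primitive_le hs hu.2))

/-- `φ(t) = ∫_0^t exp(-∫_u^t s dC) h(u) C(du)` solves `dφ = (h - s φ) dC`. -/
lemma variation_of_constants [SFinite C] [NullSingletonClass C] {s h : ℝ → ℝ} {t : ℝ}
    (hs : IntegrableOn s (Ioc 0 t) C) (hh : IntegrableOn h (Ioc 0 t) C) {φ : ℝ → ℝ}
    (hφ : ∀ r ∈ Icc 0 t, φ r = ∫ u in Ioc 0 r, Real.exp (-∫ v in Ioc u r, s v ∂C) * h u ∂C) :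
    IntegrableOn (fun u => h u - s u * φ u) (Ioc 0 t) C ∧
      (0 ≤ t → φ t = ∫ u in Ioc 0 t, (h u - s u * φ u) ∂C) := by
  set L : ℝ → ℝ := fun u => ∫ v in Ioc 0 u, s v ∂C with hL
  set F : ℝ → ℝ := fun r => ∫ u in Ioc 0 r, Real.exp (L u) * h u ∂C with hF
  have hφ' : ∀ r ∈ Icc 0 t, φ r = Real.exp (-L r) * F r := by
    intro r hr
    rw [hφ r hr, setIntegral_exp_mul (hs.mono_set (Ioc_subset_Ioc_right hr.2))]
  have heh : IntegrableOn (fun u => Real.exp (L u) * h u) (Ioc 0 t) C :=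
    integrableOn_exp_primitive_mul hs hh
  have hns : IntegrableOn (fun u => - s u) (Ioc 0 t) C := hs.neg
  have hexp : ∀ r ≤ t, Real.exp (-L r) = 1 + ∫ u in Ioc 0 r, Real.exp (-L u) * -s u ∂C := by
    intro r hr
    have := (exp_primitive (hns.mono_set (Ioc_subset_Ioc_right hr))).2
    simpa only [primitive_neg] using this
  have hes : IntegrableOn (fun u => Real.exp (-L u) * -s u) (Ioc 0 t) C := by
    have := (exp_primitive hns).1
    simpa only [primitive_neg] using this
  have hint2 := integrableOn_mul_primitive hes heh
  have hint1 := integrableOn_mul_primitive heh hes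
  have hi : IntegrableOn (fun u => h u - s u * φ u) (Ioc 0 t) C := by
    refine IntegrableOn.congr_fun (hh.add hint2) (fun u hu => ?_) measurableSet_Ioc
    simp only [Pi.add_apply]
    rw [hφ' u ⟨hu.1.le, hu.2⟩]
    simp only [hF]
    ring
  refine ⟨hi, fun ht => ?_⟩
  have hibp := primitive_mul_primitive heh hes
  have e : ∀ u ∈ Ioc 0 t, (Real.exp (L u) * h u * (∫ v in Ioc 0 u, Real.exp (-L v) * -s v ∂C) +
      Real.exp (-L u) * -s u * ∫ v in Ioc 0 u, Real.exp (L v) * h v ∂C) =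
      (h u - s u * φ u) - Real.exp (L u) * h u := by
    intro u hu
    have h1 : ∫ v in Ioc 0 u, Real.exp (-L v) * -s v ∂C = Real.exp (-L u) - 1 := by
      rw [hexp u hu.2]; ring
    have h2 : Real.exp (L u) * Real.exp (-L u) = 1 := by rw [← Real.exp_add]; simp
    rw [h1, hφ' u ⟨hu.1.le, hu.2⟩]
    simp only [hF]
    linear_combination h u * h2
  rw [setIntegral_congr_fun measurableSet_Ioc e, integral_sub hi heh] at hibp
  have h1 : ∫ v in Ioc 0 t, Real.exp (-L v) * -s v ∂C = Real.exp (-L t) - 1 := by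
    rw [hexp t le_rfl]; ring
  rw [h1] at hibp
  rw [hφ' t ⟨ht, le_rfl⟩]
  simp only [hF]
  linear_combination hibp

/-- The solution of `dφ = y dC` is `φ(t) = ∫_0^t exp(-∫_u^t s dC) (y + s φ)(u) C(du)`. -/
lemma eq_variation_of_constants [SFinite C] [NullSingletonClass C] {s y : ℝ → ℝ} {t : ℝ}
    (hs : IntegrableOn s (Ioc 0 t) C) (hy : IntegrableOn y (Ioc 0 t) C) {φ : ℝ → ℝ}
    (hφ : ∀ r ∈ Icc 0 t, φ r = ∫ u in Ioc 0 r, y u ∂C) (ht : 0 ≤ t) :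
    φ t = ∫ u in Ioc 0 t, Real.exp (-∫ v in Ioc u t, s v ∂C) * (y u + s u * φ u) ∂C := by
  rw [setIntegral_exp_mul hs]
  set L : ℝ → ℝ := fun u => ∫ v in Ioc 0 u, s v ∂C with hL
  have hexp : ∀ r ≤ t, Real.exp (L r) = 1 + ∫ u in Ioc 0 r, Real.exp (L u) * s u ∂C :=
    fun r hr => (exp_primitive (hs.mono_set (Ioc_subset_Ioc_right hr))).2
  have hes := (exp_primitive hs).1
  have hibp := primitive_mul_primitive hy hes
  have e : ∀ u ∈ Ioc 0 t, (y u * (∫ v in Ioc 0 u, Real.exp (L v) * s v ∂C) +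
      Real.exp (L u) * s u * ∫ v in Ioc 0 u, y v ∂C) =
      Real.exp (L u) * (y u + s u * φ u) - y u := by
    intro u hu
    have h1 : ∫ v in Ioc 0 u, Real.exp (L v) * s v ∂C = Real.exp (L u) - 1 := by
      rw [hexp u hu.2]; ring
    rw [h1, hφ u ⟨hu.1.le, hu.2⟩]
    ring
  have hi : IntegrableOn (fun u => Real.exp (L u) * (y u + s u * φ u)) (Ioc 0 t) C := by
    refine IntegrableOn.congr_fun (((integrableOn_mul_primitive hy hes).add
      (integrableOn_mul_primitive hes hy)).add hy) (fun u hu => ?_) measurableSet_Ioc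
    have := e u hu
    simp only [Pi.add_apply]
    linarith
  rw [setIntegral_congr_fun measurableSet_Ioc e, integral_sub hi hy] at hibp
  have h1 : ∫ v in Ioc 0 t, Real.exp (L v) * s v ∂C = Real.exp (L t) - 1 := by
    rw [hexp t le_rfl]; ring
  rw [h1, ← hφ t ⟨ht, le_rfl⟩] at hibp
  have h2 : Real.exp (-L t) * Real.exp (L t) = 1 := by rw [← Real.exp_add]; simp
  linear_combination Real.exp (-L t) * hibp - φ t * h2

end Primitive

/-! ### Counting process martingales for a fixed value of the covariate -/

section Fibre

variable (G : Measure (ℝ × Bool))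

/-- The probability `G(X ≥ u)` of being at risk at time `u`, where `G` is a law of `(X, δ)`. -/
noncomputable def atRisk (u : ℝ) : ℝ := G.real {q | u ≤ q.1}

/-- The integral of `h` over `(-∞, x]` with respect to the hazard of `X` on `{δ = b}`. -/
noncomputable def hazInt (b : Bool) (h : ℝ → ℝ) (x : ℝ) : ℝ :=
  ∫ q, {q : ℝ × Bool | q.2 = b ∧ q.1 ≤ x}.indicator (fun q => h q.1 * (atRisk G q.1)⁻¹) q ∂G

/-- The stochastic integral of `h` with respect to the compensated process that counts `X` on
`{δ = b}`, for a law `G` of `(X, δ)`. -/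
noncomputable def fibreMart (b : Bool) (h : ℝ → ℝ) (q : ℝ × Bool) : ℝ :=
  (if q.2 = b then h q.1 else 0) - hazInt G b h q.1

variable {G}

lemma measurableSet_snd_eq (b : Bool) : MeasurableSet {q : ℝ × Bool | q.2 = b} :=
  measurable_snd (measurableSet_singleton b)

lemma measurableSet_le_fst (u : ℝ) : MeasurableSet {q : ℝ × Bool | u ≤ q.1} :=
  measurableSet_le measurable_const measurable_fst

lemma measurableSet_snd_fst (b : Bool) (x : ℝ) :
    MeasurableSet {q : ℝ × Bool | q.2 = b ∧ q.1 ≤ x} :=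
  (measurableSet_snd_eq b).inter (measurableSet_le measurable_fst measurable_const)

lemma atRisk_nonneg (u : ℝ) : 0 ≤ atRisk G u := measureReal_nonneg

variable [IsFiniteMeasure G]

lemma atRisk_antitone : Antitone (atRisk G) := fun _ _ hab =>
  measureReal_mono fun _ hq => hab.trans hq

lemma measurable_atRisk : Measurable (atRisk G) := atRisk_antitone.measurable

/-- The at-risk probability is positive at almost all observed times. -/
lemma atRisk_pos_ae : ∀ᵐ q ∂G, 0 < atRisk G q.1 := by
  set U : Set (ℝ × Bool) := {q | atRisk G q.1 = 0} with hU
  have hUm : MeasurableSet U := (measurable_atRisk.comp measurable_fst) (measurableSet_singleton 0)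
  -- of two points of `U × U`, the one to the right is at risk at the time of the other
  have hzero : (G.prod G) ((U ×ˢ univ) ∩ {p | p.1.1 ≤ p.2.1}) = 0 := by
    rw [Measure.prod_apply ((hUm.prod MeasurableSet.univ).inter
      (measurableSet_le measurable_fst.fst measurable_snd.fst)), lintegral_eq_zero_iff'
      (measurable_measure_prodMk_left ((hUm.prod MeasurableSet.univ).inter
      (measurableSet_le measurable_fst.fst measurable_snd.fst))).aemeasurable]
    refine ae_of_all _ fun q => ?_
    by_cases hq : q ∈ U
    · have : atRisk G q.1 = 0 := hq
      rw [atRisk, measureReal_eq_zero_iff] at this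
      refine measure_mono_null (fun r hr => ?_) this
      exact hr.2
    · simp [hq]
  have hsw : (G.prod G) ((univ ×ˢ U) ∩ {p | p.2.1 ≤ p.1.1}) = 0 := by
    rw [← Measure.prod_swap, Measure.map_apply measurable_swap ((MeasurableSet.univ.prod hUm).inter
      (measurableSet_le measurable_snd.fst measurable_fst.fst))]
    refine measure_mono_null ?_ hzero
    rintro ⟨p, q⟩ h
    exact ⟨⟨h.1.2, trivial⟩, h.2⟩
  have hUU : (G.prod G) (U ×ˢ U) = 0 := by
    refine measure_mono_null ?_ (measure_union_null hzero hsw)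
    rintro ⟨p, q⟩ h
    rcases le_total p.1 q.1 with hle | hle
    · exact Or.inl ⟨⟨h.1, trivial⟩, hle⟩
    · exact Or.inr ⟨⟨trivial, h.2⟩, hle⟩
  rw [Measure.prod_prod, mul_self_eq_zero] at hUU
  rw [ae_iff]
  refine measure_mono_null (fun q hq => ?_) hUU
  exact le_antisymm (not_lt.1 hq) (atRisk_nonneg _)

/-- The kernel of the compensator, as a function of the observation `r` and the time `q`. -/
lemma integrable_compensator {b : Bool} {h : ℝ → ℝ}
    (hh : IntegrableOn (fun q : ℝ × Bool => h q.1) {q | q.2 = b} G) :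
    Integrable (fun p : (ℝ × Bool) × (ℝ × Bool) =>
      {q : ℝ × Bool | q.2 = b ∧ q.1 ≤ p.1.1}.indicator
        (fun q => h q.1 * (atRisk G q.1)⁻¹) p.2) (G.prod G) := by
  have hm : AEStronglyMeasurable (fun q : ℝ × Bool => {q : ℝ × Bool | q.2 = b}.indicator
      (fun q => h q.1 * (atRisk G q.1)⁻¹) q) G :=
    (aestronglyMeasurable_indicator_iff (measurableSet_snd_eq b)).2
      (hh.1.mul (measurable_atRisk.comp measurable_fst).inv.aestronglyMeasurable)
  have hm2 : AEStronglyMeasurable (fun p : (ℝ × Bool) × (ℝ × Bool) =>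
      {q : ℝ × Bool | q.2 = b ∧ q.1 ≤ p.1.1}.indicator
        (fun q => h q.1 * (atRisk G q.1)⁻¹) p.2) (G.prod G) := by
    refine ((hm.comp_snd (μ := G)).indicator (s := {p | p.2.1 ≤ p.1.1})
      (measurableSet_le measurable_snd.fst measurable_fst.fst)).congr (ae_of_all _ fun p => ?_)
    by_cases h1 : p.2.2 = b <;> by_cases h2 : p.2.1 ≤ p.1.1 <;> simp [indicator, h1, h2]
  rw [integrable_prod_iff' hm2]
  have hind : ∀ q : ℝ × Bool, (fun r : ℝ × Bool => {q : ℝ × Bool | q.2 = b ∧ q.1 ≤ r.1}.indicator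
      (fun q => h q.1 * (atRisk G q.1)⁻¹) q) = {r | q.1 ≤ r.1}.indicator
        (fun _ => {q : ℝ × Bool | q.2 = b}.indicator (fun q => h q.1 * (atRisk G q.1)⁻¹) q) := by
    intro q
    ext r
    by_cases h1 : q.2 = b <;> by_cases h2 : q.1 ≤ r.1 <;> simp [indicator, h1, h2]
  refine ⟨ae_of_all _ fun q => ?_, ?_⟩
  · rw [hind]
    exact (integrable_const _).indicator (measurableSet_le_fst _)
  · refine ((integrable_indicator_iff (measurableSet_snd_eq b)).2 hh.norm).congr ?_
    filter_upwards [atRisk_pos_ae (G := G)] with q hq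
    rw [show (fun r : ℝ × Bool => ‖{q : ℝ × Bool | q.2 = b ∧ q.1 ≤ r.1}.indicator
      (fun q => h q.1 * (atRisk G q.1)⁻¹) q‖) = {r | q.1 ≤ r.1}.indicator
        (fun _ => ‖{q : ℝ × Bool | q.2 = b}.indicator (fun q => h q.1 * (atRisk G q.1)⁻¹) q‖) from by
        ext r
        rw [show {q : ℝ × Bool | q.2 = b ∧ q.1 ≤ r.1}.indicator
          (fun q => h q.1 * (atRisk G q.1)⁻¹) q = _ from congrFun (hind q) r]
        by_cases h2 : q.1 ≤ r.1 <;> simp [indicator, h2]]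
    rw [integral_indicator (measurableSet_le_fst _), setIntegral_const, smul_eq_mul]
    change _ = atRisk G q.1 * _
    by_cases h1 : q.2 = b
    · simp only [mem_ofPred_eq, h1, indicator_of_mem, norm_mul, norm_inv]
      rw [Real.norm_of_nonneg hq.le]
      field_simp
    · simp [h1]

/-- Fubini's theorem for the compensator. -/
lemma integral_mul_hazInt {b : Bool} {h : ℝ → ℝ} {v : ℝ × Bool → ℝ}
    (hint : Integrable (fun p : (ℝ × Bool) × (ℝ × Bool) => v p.1 *
      {q : ℝ × Bool | q.2 = b ∧ q.1 ≤ p.1.1}.indicator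
        (fun q => h q.1 * (atRisk G q.1)⁻¹) p.2) (G.prod G)) :
    Integrable (fun r => v r * hazInt G b h r.1) G ∧
    Integrable (fun q => {q : ℝ × Bool | q.2 = b}.indicator
        (fun q => h q.1 * (atRisk G q.1)⁻¹ * ∫ r in {r | q.1 ≤ r.1}, v r ∂G) q) G ∧
    ∫ r, v r * hazInt G b h r.1 ∂G = ∫ q, {q : ℝ × Bool | q.2 = b}.indicator
        (fun q => h q.1 * (atRisk G q.1)⁻¹ * ∫ r in {r | q.1 ≤ r.1}, v r ∂G) q ∂G := by
  have e1 : ∀ r, v r * hazInt G b h r.1 = ∫ q, v r * {q : ℝ × Bool | q.2 = b ∧ q.1 ≤ r.1}.indicator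
        (fun q => h q.1 * (atRisk G q.1)⁻¹) q ∂G := fun r => by
    rw [hazInt, integral_const_mul]
  have e2 : ∀ q, {q : ℝ × Bool | q.2 = b}.indicator
        (fun q => h q.1 * (atRisk G q.1)⁻¹ * ∫ r in {r | q.1 ≤ r.1}, v r ∂G) q =
      ∫ r, v r * {q : ℝ × Bool | q.2 = b ∧ q.1 ≤ r.1}.indicator
        (fun q => h q.1 * (atRisk G q.1)⁻¹) q ∂G := by
    intro q
    by_cases h1 : q.2 = b
    · rw [indicator_of_mem (by exact h1), ← integral_indicator (measurableSet_le_fst _),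
        ← integral_const_mul]
      refine integral_congr_ae (ae_of_all _ fun r => ?_)
      by_cases h2 : q.1 ≤ r.1 <;> simp [indicator, h1, h2, mul_comm]
    · simp [h1]
  simp_rw [e1, e2]
  exact ⟨hint.integral_prod_left, hint.integral_prod_right, integral_integral_swap hint⟩

/-- Restarted at time `x`, the martingale has mean zero: given `X ≥ x`, its expectation is the
value `-∫_{(-∞, x)} h dA` reached just before `x`. -/
lemma setIntegral_fibreMart {b : Bool} {h : ℝ → ℝ}
    (hh : IntegrableOn (fun q : ℝ × Bool => h q.1) {q | q.2 = b} G) {x : ℝ}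
    (hx : 0 < atRisk G x) :
    IntegrableOn (fun q => h q.1 * (atRisk G q.1)⁻¹) {q : ℝ × Bool | q.2 = b ∧ q.1 ≤ x} G ∧
    ∫ r in {r | x ≤ r.1}, fibreMart G b h r ∂G =
      -(atRisk G x * ∫ q in {q : ℝ × Bool | q.2 = b ∧ q.1 < x}, h q.1 * (atRisk G q.1)⁻¹ ∂G) := by
  have hI : IntegrableOn (fun q => h q.1 * (atRisk G q.1)⁻¹)
      {q : ℝ × Bool | q.2 = b ∧ q.1 ≤ x} G := by
    refine Integrable.mul_bdd (c := (atRisk G x)⁻¹) (hh.mono_set fun q hq => hq.1)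
      (measurable_atRisk.comp measurable_fst).inv.aestronglyMeasurable ?_
    filter_upwards [ae_restrict_mem (measurableSet_snd_fst b x)] with q hq
    have hle := atRisk_antitone (G := G) hq.2
    rw [norm_inv, Real.norm_of_nonneg (atRisk_nonneg _)]
    exact inv_anti₀ hx hle
  refine ⟨hI, ?_⟩
  have hv := integral_mul_hazInt (G := G) (b := b) (h := h)
    (v := {r : ℝ × Bool | x ≤ r.1}.indicator fun _ => 1) (by
      refine ((integrable_compensator hh).indicator
        (s := {p : (ℝ × Bool) × (ℝ × Bool) | x ≤ p.1.1})
        (measurableSet_le measurable_const measurable_fst.fst)).congr (ae_of_all _ fun p => ?_)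
      by_cases h1 : x ≤ p.1.1 <;> simp [indicator, h1])
  have h1 : IntegrableOn (fun q : ℝ × Bool => if q.2 = b then h q.1 else 0) {r | x ≤ r.1} G :=
    (((integrable_indicator_iff (measurableSet_snd_eq b)).2 hh).congr
      (ae_of_all _ fun q => by simp [indicator])).integrableOn
  have e1 : (fun r : ℝ × Bool => {r : ℝ × Bool | x ≤ r.1}.indicator (fun _ => (1 : ℝ)) r *
      hazInt G b h r.1) = {r : ℝ × Bool | x ≤ r.1}.indicator fun r => hazInt G b h r.1 := by
    ext r
    by_cases h1 : x ≤ r.1 <;> simp [indicator, h1]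
  rw [e1, integrable_indicator_iff (measurableSet_le_fst x),
    integral_indicator (measurableSet_le_fst x)] at hv
  have hlt : MeasurableSet {q : ℝ × Bool | q.2 = b ∧ q.1 < x} :=
    (measurableSet_snd_eq b).inter (measurableSet_lt measurable_fst measurable_const)
  have hI' : IntegrableOn (fun q => h q.1 * (atRisk G q.1)⁻¹)
      {q : ℝ × Bool | q.2 = b ∧ q.1 < x} G := hI.mono_set fun q hq => ⟨hq.1, hq.2.le⟩
  simp only [fibreMart]
  rw [integral_sub h1 hv.1, hv.2.2, ← integral_indicator (measurableSet_le_fst x),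
    ← integral_indicator hlt, ← integral_const_mul, ← integral_neg, ← integral_sub
      (h1.integrable_indicator (measurableSet_le_fst x)) hv.2.1]
  have hJ : ∀ y : ℝ, ∫ r in {r : ℝ × Bool | y ≤ r.1}, {r : ℝ × Bool | x ≤ r.1}.indicator
      (fun _ => (1 : ℝ)) r ∂G = atRisk G (max y x) := by
    intro y
    have : {r : ℝ × Bool | y ≤ r.1} ∩ {r | x ≤ r.1} = {r | max y x ≤ r.1} := by
      ext r; simp
    rw [setIntegral_indicator (measurableSet_le_fst x), this, setIntegral_const, smul_eq_mul,
      mul_one, atRisk]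
  simp_rw [hJ]
  refine integral_congr_ae ?_
  filter_upwards [atRisk_pos_ae (G := G)] with q hq
  by_cases hb : q.2 = b
  · rcases lt_or_ge q.1 x with hqx | hqx
    · simp only [indicator, mem_ofPred_eq, hb, hqx, not_le.2 hqx, and_true, if_true, if_false,
        max_eq_right hqx.le, zero_sub]
      ring
    · simp only [indicator, mem_ofPred_eq, hb, hqx, not_lt.2 hqx, and_false, if_true, if_false,
        max_eq_left hqx]
      field_simp
      ring
  · simp [indicator, hb]

/-- Almost every value with an atomless law is not an atom of any other law. -/
lemma ae_measure_singleton_eq_zero {G₁ : Measure ℝ} [NullSingletonClass G₁] {G₂ : Measure ℝ}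
    [SFinite G₂] : ∀ᵐ x ∂G₁, G₂ {x} = 0 := by
  have hc : {x | 0 < G₂ {x}}.Countable := Measure.countable_meas_pos_of_disjoint_iUnion
    (fun x => measurableSet_singleton x) (fun x y hxy => by simpa using hxy)
  rw [ae_iff]
  refine (hc.mono fun x hx => ?_).measure_zero G₁
  exact pos_iff_ne_zero.2 hx

/-- A square integrable `v` with mean zero whose value at almost every observation is the mean
residual value `E[v | X ≥ x]` vanishes: expanding the square `(∫ v dG)² = 0` over the order of
two observations gives `∫ v(q)² G(X ≥ q.1) G(dq) ≤ 0`. -/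
lemma ae_eq_zero_of_eq_meanResidual {v : ℝ × Bool → ℝ} (hv : MemLp v 2 G)
    (h0 : ∫ q, v q ∂G = 0)
    (hres : ∀ᵐ q ∂G, v q * atRisk G q.1 = ∫ r in {r | q.1 ≤ r.1}, v r ∂G) : v =ᵐ[G] 0 := by
  have hvi : Integrable v G := hv.integrable (by norm_num)
  have hprod : Integrable (fun p : (ℝ × Bool) × (ℝ × Bool) => v p.1 * v p.2) (G.prod G) :=
    hvi.mul_prod hvi
  have hS : Integrable (fun q => v q ^ 2 * atRisk G q.1) G := by
    refine Integrable.mul_bdd (c := G.real univ) hv.integrable_sq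
      (measurable_atRisk.comp measurable_fst).aestronglyMeasurable (ae_of_all _ fun q => ?_)
    rw [Real.norm_of_nonneg (atRisk_nonneg _)]
    exact measureReal_mono (subset_univ _)
  have hle : MeasurableSet {p : (ℝ × Bool) × (ℝ × Bool) | p.1.1 ≤ p.2.1} :=
    measurableSet_le measurable_fst.fst measurable_snd.fst
  have hge : MeasurableSet {p : (ℝ × Bool) × (ℝ × Bool) | p.2.1 ≤ p.1.1} :=
    measurableSet_le measurable_snd.fst measurable_fst.fst
  have heq : MeasurableSet {p : (ℝ × Bool) × (ℝ × Bool) | p.1.1 = p.2.1} :=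
    measurableSet_eq_fun measurable_fst.fst measurable_snd.fst
  have I1 : ∫ p, {p : (ℝ × Bool) × (ℝ × Bool) | p.1.1 ≤ p.2.1}.indicator
      (fun p => v p.1 * v p.2) p ∂(G.prod G) = ∫ q, v q ^ 2 * atRisk G q.1 ∂G := by
    rw [integral_prod _ (hprod.indicator hle)]
    refine integral_congr_ae ?_
    filter_upwards [hres] with q hq
    rw [sq, mul_assoc, hq, ← integral_indicator (measurableSet_le_fst _), ← integral_const_mul]
    refine integral_congr_ae (ae_of_all _ fun r => ?_)
    by_cases h1 : q.1 ≤ r.1 <;> simp [indicator, h1]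
  have I2 : ∫ p, {p : (ℝ × Bool) × (ℝ × Bool) | p.2.1 ≤ p.1.1}.indicator
      (fun p => v p.1 * v p.2) p ∂(G.prod G) = ∫ q, v q ^ 2 * atRisk G q.1 ∂G := by
    rw [← I1, ← integral_prod_swap]
    refine integral_congr_ae (ae_of_all _ fun p => ?_)
    by_cases h1 : p.1.1 ≤ p.2.1 <;> simp [indicator, h1, mul_comm]
  have I3 : ∫ p, {p : (ℝ × Bool) × (ℝ × Bool) | p.1.1 = p.2.1}.indicator
      (fun p => v p.1 * v p.2) p ∂(G.prod G) ≤ ∫ q, v q ^ 2 * atRisk G q.1 ∂G := by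
    -- on the diagonal `2 v(q) v(r) ≤ v(q)² + v(r)²`
    have hmaj : Integrable (fun p : (ℝ × Bool) × (ℝ × Bool) =>
        {p : (ℝ × Bool) × (ℝ × Bool) | p.1.1 = p.2.1}.indicator (fun p => v p.1 ^ 2) p)
        (G.prod G) := (hv.integrable_sq.comp_fst G).indicator heq
    have hmaj' : Integrable (fun p : (ℝ × Bool) × (ℝ × Bool) =>
        {p : (ℝ × Bool) × (ℝ × Bool) | p.1.1 = p.2.1}.indicator (fun p => v p.2 ^ 2) p)
        (G.prod G) := (hv.integrable_sq.comp_snd G).indicator heq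
    have hs : ∫ p, {p : (ℝ × Bool) × (ℝ × Bool) | p.1.1 = p.2.1}.indicator
        (fun p => v p.2 ^ 2) p ∂(G.prod G) = ∫ p, {p : (ℝ × Bool) × (ℝ × Bool) |
        p.1.1 = p.2.1}.indicator (fun p => v p.1 ^ 2) p ∂(G.prod G) := by
      rw [← integral_prod_swap]
      refine integral_congr_ae (ae_of_all _ fun p => ?_)
      by_cases h1 : p.1.1 = p.2.1
      · simp [indicator, h1]
      · simp [indicator, h1, Ne.symm h1]
    have hd : ∫ p, {p : (ℝ × Bool) × (ℝ × Bool) | p.1.1 = p.2.1}.indicator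
        (fun p => v p.1 ^ 2) p ∂(G.prod G) ≤ ∫ q, v q ^ 2 * atRisk G q.1 ∂G := by
      rw [integral_prod _ hmaj]
      refine integral_mono hmaj.integral_prod_left hS fun q => ?_
      have : (fun r : ℝ × Bool => {p : (ℝ × Bool) × (ℝ × Bool) | p.1.1 = p.2.1}.indicator
        (fun p => v p.1 ^ 2) (q, r)) = {r : ℝ × Bool | q.1 = r.1}.indicator fun _ => v q ^ 2 := by
        ext r; simp [indicator]
      simp only [this]
      rw [integral_indicator (measurableSet_eq_fun measurable_const measurable_fst),
        setIntegral_const, smul_eq_mul, mul_comm]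
      exact mul_le_mul_of_nonneg_left (measureReal_mono fun r hr => le_of_eq hr) (sq_nonneg _)
    have hmono := integral_mono ((hprod.indicator heq).const_mul 2) (hmaj.add hmaj') fun p => by
      by_cases h1 : p.1.1 = p.2.1
      · simp only [indicator, mem_ofPred_eq, h1, if_true, Pi.add_apply]
        nlinarith [sq_nonneg (v p.1 - v p.2)]
      · simp [indicator, h1]
    rw [integral_const_mul, integral_add' hmaj hmaj', hs] at hmono
    linarith
  have I4 : ∫ p, (fun p : (ℝ × Bool) × (ℝ × Bool) => v p.1 * v p.2) p ∂(G.prod G) = 0 := by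
    rw [integral_prod_mul, h0, zero_mul]
  have I5 : ∫ p, (fun p : (ℝ × Bool) × (ℝ × Bool) => v p.1 * v p.2) p ∂(G.prod G) =
      ∫ p, {p : (ℝ × Bool) × (ℝ × Bool) | p.1.1 ≤ p.2.1}.indicator
      (fun p => v p.1 * v p.2) p ∂(G.prod G) + ∫ p, {p : (ℝ × Bool) × (ℝ × Bool) |
      p.2.1 ≤ p.1.1}.indicator (fun p => v p.1 * v p.2) p ∂(G.prod G) -
      ∫ p, {p : (ℝ × Bool) × (ℝ × Bool) | p.1.1 = p.2.1}.indicator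
      (fun p => v p.1 * v p.2) p ∂(G.prod G) := by
    rw [← integral_add' (hprod.indicator hle) (hprod.indicator hge), ← integral_sub'
      ((hprod.indicator hle).add (hprod.indicator hge)) (hprod.indicator heq)]
    refine integral_congr_ae (ae_of_all _ fun p => ?_)
    rcases lt_trichotomy p.1.1 p.2.1 with h | h | h
    · simp [indicator, h.le, h.ne, not_le.2 h]
    · simp [indicator, h]
    · simp [indicator, h.le, h.ne', not_le.2 h]
  have hzero : ∫ q, v q ^ 2 * atRisk G q.1 ∂G = 0 := by
    refine le_antisymm (by linarith) (integral_nonneg fun q => ?_)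
    exact mul_nonneg (sq_nonneg _) (atRisk_nonneg _)
  rw [integral_eq_zero_iff_of_nonneg (fun q => mul_nonneg (sq_nonneg _) (atRisk_nonneg _)) hS]
    at hzero
  filter_upwards [hzero, atRisk_pos_ae (G := G)] with q h1 h2
  simpa [h2.ne'] using h1

end Fibre

/-! ### Disintegration of the law of the observations over the covariate -/

section Disintegration

variable {k : ℕ} (P : Measure (Obs k))

/-- The law of the covariate. -/
noncomputable def covLaw : Measure (Vec k) := P.map fun p => p.2.2

instance [IsFiniteMeasure P] : IsFiniteMeasure (covLaw P) := by
  unfold covLaw; infer_instance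

instance [IsFiniteMeasure P] : IsMarkovKernel (condObs P) := by
  unfold condObs; infer_instance

instance [IsFiniteMeasure P] (b : Bool) : IsFiniteMeasure (subLaw P b) := by
  unfold subLaw; infer_instance

lemma measurableSet_status (b : Bool) : MeasurableSet {p : Obs k | p.2.1 = b} :=
  measurable_snd.fst (measurableSet_singleton b)

lemma measurable_ofFibre :
    Measurable fun x : Vec k × (ℝ × Bool) => ((x.2.1, x.2.2, x.1) : Obs k) := by fun_prop

lemma map_compProd_condObs [IsFiniteMeasure P] :
    (covLaw P ⊗ₘ condObs P).map (fun x => ((x.2.1, x.2.2, x.1) : Obs k)) = P := by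
  rw [covLaw, condObs, compProd_map_condDistrib (by fun_prop), Measure.map_map
    measurable_ofFibre (by fun_prop)]
  exact Measure.map_id

lemma lintegral_obs [IsFiniteMeasure P] {F : Obs k → ℝ≥0∞} (hF : Measurable F) :
    ∫⁻ p, F p ∂P = ∫⁻ z, ∫⁻ q, F (q.1, q.2, z) ∂(condObs P z) ∂(covLaw P) := by
  conv_lhs => rw [← map_compProd_condObs P]
  rw [lintegral_map hF measurable_ofFibre,
    Measure.lintegral_compProd (f := fun x : Vec k × (ℝ × Bool) => F (x.2.1, x.2.2, x.1))
      (hF.comp measurable_ofFibre)]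

variable {P}

lemma integrable_ofFibre [IsFiniteMeasure P] {F : Obs k → ℝ} (hF : Integrable F P) :
    Integrable (fun x : Vec k × (ℝ × Bool) => F (x.2.1, x.2.2, x.1)) (covLaw P ⊗ₘ condObs P) := by
  rw [← map_compProd_condObs P] at hF
  exact hF.comp_measurable measurable_ofFibre

lemma integrable_fibre [IsFiniteMeasure P] {F : Obs k → ℝ} (hF : Integrable F P) :
    ∀ᵐ z ∂(covLaw P), Integrable (fun q : ℝ × Bool => F (q.1, q.2, z)) (condObs P z) :=
  ((Measure.integrable_compProd_iff (integrable_ofFibre hF).1).1 (integrable_ofFibre hF)).1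

lemma integrable_integral_fibre [IsFiniteMeasure P] {F : Obs k → ℝ} (hF : Integrable F P) :
    Integrable (fun z => ∫ q, F (q.1, q.2, z) ∂(condObs P z)) (covLaw P) :=
  Integrable.integral_compProd (f := fun x : Vec k × (ℝ × Bool) => F (x.2.1, x.2.2, x.1))
    (κ := Kernel.const Unit (covLaw P)) (η := Kernel.prodMkLeft Unit (condObs P)) (a := ())
    (integrable_ofFibre hF)

lemma integral_obs [IsFiniteMeasure P] {F : Obs k → ℝ} (hF : Integrable F P) :
    ∫ p, F p ∂P = ∫ z, ∫ q, F (q.1, q.2, z) ∂(condObs P z) ∂(covLaw P) := by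
  rw [← Measure.integral_compProd (f := fun x : Vec k × (ℝ × Bool) => F (x.2.1, x.2.2, x.1))
    (integrable_ofFibre hF)]
  have h1 : AEStronglyMeasurable F
      ((covLaw P ⊗ₘ condObs P).map (fun x => ((x.2.1, x.2.2, x.1) : Obs k))) := by
    rw [map_compProd_condObs P]; exact hF.1
  rw [← integral_map measurable_ofFibre.aemeasurable h1, map_compProd_condObs]

lemma ae_fibre_of_ae [IsFiniteMeasure P] {pr : Obs k → Prop} (h : ∀ᵐ p ∂P, pr p) :
    ∀ᵐ z ∂(covLaw P), ∀ᵐ q ∂(condObs P z), pr (q.1, q.2, z) := by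
  rw [← map_compProd_condObs P] at h
  exact Measure.ae_ae_of_ae_compProd (ae_of_ae_map measurable_ofFibre.aemeasurable h)

lemma ae_of_ae_fibre [IsFiniteMeasure P] {pr : Obs k → Prop} (hpr : MeasurableSet {p | pr p})
    (h : ∀ᵐ z ∂(covLaw P), ∀ᵐ q ∂(condObs P z), pr (q.1, q.2, z)) : ∀ᵐ p ∂P, pr p := by
  rw [← map_compProd_condObs P, ae_map_iff measurable_ofFibre.aemeasurable hpr]
  exact (Measure.ae_compProd_iff (measurable_ofFibre hpr)).2 h

/-! ### Subdistributions -/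

lemma measurable_timeCov : Measurable fun p : Obs k => ((p.1, p.2.2) : ℝ × Vec k) := by fun_prop

lemma memLp_subLaw_iff {b : Bool} {F : ℝ × Vec k → ℝ} {r : ℝ≥0∞}
    (hF : AEStronglyMeasurable F (subLaw P b)) :
    MemLp F r (subLaw P b) ↔
      MemLp ({p : Obs k | p.2.1 = b}.indicator fun p => F (p.1, p.2.2)) r P := by
  rw [memLp_indicator_iff_restrict (measurableSet_status b)]
  exact memLp_map_measure_iff hF measurable_timeCov.aemeasurable

lemma integrable_subLaw_iff {b : Bool} {F : ℝ × Vec k → ℝ}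
    (hF : AEStronglyMeasurable F (subLaw P b)) :
    Integrable F (subLaw P b) ↔
      Integrable ({p : Obs k | p.2.1 = b}.indicator fun p => F (p.1, p.2.2)) P := by
  rw [← memLp_one_iff_integrable, memLp_subLaw_iff hF, memLp_one_iff_integrable]

lemma integral_subLaw {b : Bool} {F : ℝ × Vec k → ℝ}
    (hF : AEStronglyMeasurable F (subLaw P b)) :
    ∫ q, F q ∂(subLaw P b) =
      ∫ p, {p : Obs k | p.2.1 = b}.indicator (fun p => F (p.1, p.2.2)) p ∂P := by
  rw [integral_indicator (measurableSet_status b)]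
  exact integral_map measurable_timeCov.aemeasurable hF

lemma ae_of_ae_subLaw {b : Bool} {pr : ℝ × Vec k → Prop} (h : ∀ᵐ q ∂(subLaw P b), pr q) :
    ∀ᵐ p ∂P, p.2.1 = b → pr (p.1, p.2.2) :=
  (ae_restrict_iff' (measurableSet_status b)).1 (ae_of_ae_map measurable_timeCov.aemeasurable h)

lemma ae_subLaw_of_ae {b : Bool} {pr : ℝ × Vec k → Prop} (hpr : MeasurableSet {q | pr q})
    (h : ∀ᵐ p ∂P, p.2.1 = b → pr (p.1, p.2.2)) : ∀ᵐ q ∂(subLaw P b), pr q := by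
  rw [subLaw, ae_map_iff measurable_timeCov.aemeasurable hpr]
  exact (ae_restrict_iff' (measurableSet_status b)).2 h

lemma ae_cov_subLaw {b : Bool} {pr : Vec k → Prop} (h : ∀ᵐ z ∂(covLaw P), pr z) :
    ∀ᵐ q ∂(subLaw P b), pr q.2 := by
  obtain ⟨N, hN, hNm, hN0⟩ := exists_measurable_superset_of_null (ae_iff.1 h)
  have h1 : ∀ᵐ z ∂(covLaw P), z ∈ Nᶜ := by
    rw [ae_iff]; simpa using hN0
  have h2 : ∀ᵐ p ∂P, p.2.2 ∈ Nᶜ := ae_of_ae_map (by fun_prop) h1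
  have h3 : ∀ᵐ q ∂(subLaw P b), q.2 ∈ Nᶜ :=
    ae_subLaw_of_ae (measurable_snd hNm.compl) (h2.mono fun p hp _ => hp)
  filter_upwards [h3] with q hq
  by_contra hc
  exact hq (hN hc)

/-- The law of `X` on `{δ = b}` given the covariate. -/
noncomputable def condTime (P : Measure (Obs k)) [IsFiniteMeasure P] (b : Bool) (z : Vec k) :
    Measure ℝ := ((condObs P z).restrict {q | q.2 = b}).map Prod.fst

lemma ae_condTime_of_ae [IsFiniteMeasure P] {b : Bool} {pr : ℝ × Vec k → Prop}
    (h : ∀ᵐ q ∂(subLaw P b), pr q) :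
    ∀ᵐ z ∂(covLaw P), ∀ᵐ u ∂(condTime P b z), pr (u, z) := by
  obtain ⟨N, hN, hNm, hN0⟩ := exists_measurable_superset_of_null (ae_iff.1 h)
  have h1 : ∀ᵐ q ∂(subLaw P b), q ∈ Nᶜ := by
    rw [ae_iff]; simpa using hN0
  filter_upwards [ae_fibre_of_ae (ae_of_ae_subLaw h1)] with z hz
  have h2 : ∀ᵐ u ∂(condTime P b z), (u, z) ∈ Nᶜ := by
    rw [condTime, ae_map_iff measurable_fst.aemeasurable (measurable_prodMk_right hNm.compl),
      ae_restrict_iff' (measurableSet_snd_eq b)]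
    filter_upwards [hz] with q hq hb using hq hb
  filter_upwards [h2] with u hu
  by_contra hc
  exact hu (hN hc)

lemma ae_of_ae_condTime [IsFiniteMeasure P] {b : Bool} {pr : ℝ × Vec k → Prop}
    (hpr : MeasurableSet {q | pr q})
    (h : ∀ᵐ z ∂(covLaw P), ∀ᵐ u ∂(condTime P b z), pr (u, z)) : ∀ᵐ q ∂(subLaw P b), pr q := by
  refine ae_subLaw_of_ae hpr (ae_of_ae_fibre ?_ ?_)
  · have := (measurableSet_status (k := k) b).compl.union (measurable_timeCov hpr)
    convert this using 1
    ext p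
    simp [imp_iff_not_or]
  · filter_upwards [h] with z hz
    have hm : MeasurableSet {u | pr (u, z)} := measurable_prodMk_right hpr
    rw [condTime, ae_map_iff measurable_fst.aemeasurable hm,
      ae_restrict_iff' (measurableSet_snd_eq b)] at hz
    exact hz

/-! ### Stochastic integrals -/

/-- Joint measurability of parametric integrals against `condObs`. -/
lemma measurable_integral_condObs [IsFiniteMeasure P] {F : (ℝ × Vec k) × (ℝ × Bool) → ℝ}
    (hF : Measurable F) : Measurable fun x : ℝ × Vec k => ∫ q, F (x, q) ∂(condObs P x.2) := by
  have := hF.stronglyMeasurable.integral_kernel_prod_right'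
    (κ := (condObs P).comap Prod.snd measurable_snd)
  simp only [Kernel.comap_apply] at this
  exact this.measurable

lemma measurable_atRisk_condObs [IsFiniteMeasure P] :
    Measurable fun x : ℝ × Vec k => atRisk (condObs P x.2) x.1 := by
  have h1 : Measurable fun p : (ℝ × Vec k) × (ℝ × Bool) =>
      {p : (ℝ × Vec k) × (ℝ × Bool) | p.1.1 ≤ p.2.1}.indicator (fun _ => (1 : ℝ)) p :=
    measurable_const.indicator (measurableSet_le measurable_fst.fst measurable_snd.fst)
  convert measurable_integral_condObs (P := P) h1 using 1
  ext x
  have : (fun q : ℝ × Bool => {p : (ℝ × Vec k) × (ℝ × Bool) | p.1.1 ≤ p.2.1}.indicator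
      (fun _ => (1 : ℝ)) (x, q)) = {q : ℝ × Bool | x.1 ≤ q.1}.indicator fun _ => 1 := by
    ext q; simp [indicator]
  simp only [this]
  rw [integral_indicator (measurableSet_le_fst _), setIntegral_const, smul_eq_mul, mul_one, atRisk]

lemma martInt_congr [IsFiniteMeasure P] {b : Bool} {h h' : ℝ → Vec k → ℝ}
    (hh : (fun q : ℝ × Vec k => h q.1 q.2) =ᵐ[subLaw P b] fun q => h' q.1 q.2) :
    martInt P b h =ᵐ[P] martInt P b h' := by
  have h1 := ae_of_ae_subLaw hh
  have h2 : ∀ᵐ p ∂P, ∀ᵐ u ∂(condTime P b p.2.2), h u p.2.2 = h' u p.2.2 :=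
    ae_of_ae_map (f := fun p : Obs k => p.2.2) (by fun_prop) (ae_condTime_of_ae hh)
  filter_upwards [h1, h2] with p hp1 hp2
  simp only [martInt]
  congr 1
  · by_cases hb : p.2.1 = b
    · simp [hb, hp1 hb]
    · simp [hb]
  · refine integral_congr_ae (ae_restrict_of_ae ?_)
    exact (withDensity_absolutelyContinuous _ _).ae_le hp2

lemma martInt_eq_fibreMart [IsFiniteMeasure P] {b : Bool} {h : ℝ → Vec k → ℝ}
    (hh : Measurable fun q : ℝ × Vec k => h q.1 q.2) (x : ℝ) (d : Bool) (z : Vec k) :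
    martInt P b h (x, d, z) = fibreMart (condObs P z) b (h · z) (x, d) := by
  simp only [martInt, fibreMart, hazInt]
  congr 1
  have hz : Measurable fun u => h u z := hh.comp measurable_prodMk_right
  have hS : Measurable fun u : ℝ => condObs P z {q | u ≤ q.1} :=
    Antitone.measurable fun a c hac => measure_mono fun q hq => hac.trans hq
  have hSi : Measurable fun u : ℝ => (condObs P z {q | u ≤ q.1})⁻¹ := hS.inv
  have hfin : ∀ᵐ u ∂(((condObs P z).restrict {q | q.2 = b}).map Prod.fst),
      (condObs P z {q | u ≤ q.1})⁻¹ < ∞ := by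
    rw [ae_map_iff measurable_fst.aemeasurable (measurableSet_lt hSi measurable_const)]
    refine ae_restrict_of_ae ?_
    filter_upwards [atRisk_pos_ae (G := condObs P z)] with q hq
    rw [ENNReal.inv_lt_top]
    exact pos_iff_ne_zero.2 fun h0 => hq.ne' (by simp [atRisk, measureReal_def, h0])
  have hsm : Measurable fun u => (condObs P z {q | u ≤ q.1})⁻¹.toReal • h u z :=
    hSi.ennreal_toReal.smul hz
  rw [condHaz, setIntegral_withDensity_eq_setIntegral_toReal_smul hSi
    (ae_restrict_of_ae hfin) _ measurableSet_Iic, setIntegral_map measurableSet_Iic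
    hsm.aestronglyMeasurable measurable_fst.aemeasurable,
    Measure.restrict_restrict (measurable_fst measurableSet_Iic),
    integral_indicator (measurableSet_snd_fst b x)]
  have : (Prod.fst ⁻¹' Iic x ∩ {q : ℝ × Bool | q.2 = b}) = {q | q.2 = b ∧ q.1 ≤ x} := by
    ext q; simp [and_comm]
  rw [this]
  refine integral_congr_ae (ae_of_all _ fun q => ?_)
  simp only [atRisk, measureReal_def, ENNReal.toReal_inv, smul_eq_mul]
  ring

lemma measurable_martInt [IsFiniteMeasure P] {b : Bool} {h : ℝ → Vec k → ℝ}
    (hh : Measurable fun q : ℝ × Vec k => h q.1 q.2) : Measurable (martInt P b h) := by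
  have h1 : Measurable fun p : (ℝ × Vec k) × (ℝ × Bool) =>
      {p : (ℝ × Vec k) × (ℝ × Bool) | p.2.2 = b ∧ p.2.1 ≤ p.1.1}.indicator
        (fun p => h p.2.1 p.1.2 * (atRisk (condObs P p.1.2) p.2.1)⁻¹) p := by
    refine Measurable.indicator ?_ ?_
    · exact (hh.comp (f := fun p : (ℝ × Vec k) × (ℝ × Bool) => (p.2.1, p.1.2)) (by fun_prop)).mul
        ((measurable_atRisk_condObs (P := P)).comp
        (f := fun p : (ℝ × Vec k) × (ℝ × Bool) => (p.2.1, p.1.2)) (by fun_prop)).inv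
    · exact (measurable_snd.snd (measurableSet_singleton b)).inter
        (measurableSet_le measurable_snd.fst measurable_fst.fst)
  have h2 := (measurable_integral_condObs (P := P) h1).comp measurable_timeCov
  have h3 : Measurable fun p : Obs k => if p.2.1 = b then h p.1 p.2.2 else 0 :=
    Measurable.ite (measurableSet_status b) (hh.comp measurable_timeCov) measurable_const
  convert h3.sub h2 using 1
  ext p
  rw [show p = (p.1, p.2.1, p.2.2) from rfl, martInt_eq_fibreMart hh]
  simp only [fibreMart, hazInt, Pi.sub_apply, Function.comp]
  rfl

/-! ### Mean residual values -/

/-- The function `R_b[v](x, z) = v(x, b, z) - E[v(X, δ, Z) | X ≥ x, Z = z]`, where `b = true` for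
failures and `b = false` for censored observations. -/
noncomputable def residual (P : Measure (Obs k)) [IsFiniteMeasure P] (b : Bool) (v : Obs k → ℝ)
    (x : ℝ) (z : Vec k) : ℝ :=
  v (x, b, z) - (∫ q in {q : ℝ × Bool | x ≤ q.1}, v (q.1, q.2, z) ∂(condObs P z)) /
      atRisk (condObs P z) x

lemma R1_eq_residual [IsFiniteMeasure P] (v : Obs k → ℝ) : R1 P v = residual P true v := rfl

lemma measurable_residual [IsFiniteMeasure P] {b : Bool} {v : Obs k → ℝ} (hv : Measurable v) :
    Measurable fun q : ℝ × Vec k => residual P b v q.1 q.2 := by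
  have h1 : Measurable fun p : (ℝ × Vec k) × (ℝ × Bool) =>
      {p : (ℝ × Vec k) × (ℝ × Bool) | p.1.1 ≤ p.2.1}.indicator
        (fun p => v (p.2.1, p.2.2, p.1.2)) p :=
    (hv.comp (by fun_prop)).indicator (measurableSet_le measurable_fst.fst measurable_snd.fst)
  have h2 := measurable_integral_condObs (P := P) h1
  have h3 : Measurable fun q : ℝ × Vec k => v (q.1, b, q.2) := hv.comp (by fun_prop)
  convert h3.sub (h2.div measurable_atRisk_condObs) using 1
  ext x
  simp only [residual, Pi.sub_apply, Pi.div_apply]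
  rw [← integral_indicator (measurableSet_le_fst _)]
  rfl

lemma residual_congr [IsFiniteMeasure P] {b : Bool} {v v' : Obs k → ℝ} (hv : v =ᵐ[P] v') :
    (fun q : ℝ × Vec k => residual P b v q.1 q.2) =ᵐ[subLaw P b]
      fun q => residual P b v' q.1 q.2 := by
  have h1 : ∀ᵐ q ∂(subLaw P b), v (q.1, b, q.2) = v' (q.1, b, q.2) := by
    obtain ⟨N, hN, hNm, hN0⟩ := exists_measurable_superset_of_null (ae_iff.1 hv)
    have h1 : ∀ᵐ p ∂P, p ∈ Nᶜ := by
      rw [ae_iff]; simpa using hN0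
    have hm : Measurable fun q : ℝ × Vec k => ((q.1, b, q.2) : Obs k) := by fun_prop
    have h2 : ∀ᵐ q ∂(subLaw P b), ((q.1, b, q.2) : Obs k) ∈ Nᶜ := by
      refine ae_subLaw_of_ae (hm hNm.compl) ?_
      filter_upwards [h1] with p hp hb
      rw [← hb]
      exact hp
    filter_upwards [h2] with q hq
    by_contra hc
    exact hq (hN hc)
  filter_upwards [h1, ae_cov_subLaw (b := b) (ae_fibre_of_ae hv)] with q hq1 hq2
  simp only [residual, hq1]
  congr 2
  exact integral_congr_ae (ae_restrict_of_ae hq2)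

end Disintegration

/-! ### The martingale transform and its adjoint -/

section Martingale

variable {k : ℕ} {P : Measure (Obs k)} [IsFiniteMeasure P]

/-- The truncation of `h` to the points where `|h| ≤ n` and the at-risk probability is at least
`1 / (n + 1)`; its stochastic integrals are bounded. -/
noncomputable def truncRisk (P : Measure (Obs k)) [IsFiniteMeasure P] (n : ℕ) (h : ℝ → Vec k → ℝ)
    (u : ℝ) (z : Vec k) : ℝ :=
  {q : ℝ × Vec k | |h q.1 q.2| ≤ n ∧ ((n : ℝ) + 1)⁻¹ ≤ atRisk (condObs P q.2) q.1}.indicator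
    (fun q => h q.1 q.2) (u, z)

lemma measurable_truncRisk {h : ℝ → Vec k → ℝ} (hh : Measurable fun q : ℝ × Vec k => h q.1 q.2)
    (n : ℕ) : Measurable fun q : ℝ × Vec k => truncRisk P n h q.1 q.2 :=
  hh.indicator ((measurableSet_le hh.abs measurable_const).inter
    (measurableSet_le measurable_const measurable_atRisk_condObs))

lemma abs_truncRisk_le (n : ℕ) (h : ℝ → Vec k → ℝ) (u : ℝ) (z : Vec k) :
    |truncRisk P n h u z| ≤ |h u z| := by
  by_cases hq : (u, z) ∈ {q : ℝ × Vec k |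
    |h q.1 q.2| ≤ n ∧ ((n : ℝ) + 1)⁻¹ ≤ atRisk (condObs P q.2) q.1}
  · rw [truncRisk, indicator_of_mem hq]
  · rw [truncRisk, indicator_of_notMem hq, abs_zero]
    exact abs_nonneg _

lemma truncRisk_mul_self (n : ℕ) (h : ℝ → Vec k → ℝ) (u : ℝ) (z : Vec k) :
    truncRisk P n h u z * h u z = truncRisk P n h u z ^ 2 := by
  by_cases hq : (u, z) ∈ {q : ℝ × Vec k |
    |h q.1 q.2| ≤ n ∧ ((n : ℝ) + 1)⁻¹ ≤ atRisk (condObs P q.2) q.1}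
  · rw [truncRisk, indicator_of_mem hq, sq]
  · rw [truncRisk, indicator_of_notMem hq]
    simp

lemma eventually_truncRisk_eq (h : ℝ → Vec k → ℝ) (u : ℝ) (z : Vec k)
    (hu : 0 < atRisk (condObs P z) u) : ∀ᶠ n in atTop, truncRisk P n h u z = h u z := by
  obtain ⟨n₁, hn₁⟩ := exists_nat_ge (|h u z|)
  obtain ⟨n₂, hn₂⟩ := exists_nat_gt ((atRisk (condObs P z) u)⁻¹)
  filter_upwards [eventually_ge_atTop n₁, eventually_ge_atTop n₂] with n h1 h2
  refine indicator_of_mem (s := {q : ℝ × Vec k |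
    |h q.1 q.2| ≤ n ∧ ((n : ℝ) + 1)⁻¹ ≤ atRisk (condObs P q.2) q.1}) ⟨?_, ?_⟩ _
  · exact hn₁.trans (by exact_mod_cast h1)
  · refine inv_le_of_inv_le₀ hu ?_
    have : (n₂ : ℝ) ≤ n := by exact_mod_cast h2
    linarith

/-- A bounded function that vanishes where the at-risk probability is small. -/
def IsTame (P : Measure (Obs k)) [IsFiniteMeasure P] (h : ℝ → Vec k → ℝ) : Prop :=
  Measurable (fun q : ℝ × Vec k => h q.1 q.2) ∧ ∃ c, 0 ≤ c ∧
    ∀ u z, |h u z| ≤ c ∧ |h u z * (atRisk (condObs P z) u)⁻¹| ≤ c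

lemma isTame_truncRisk {h : ℝ → Vec k → ℝ} (hh : Measurable fun q : ℝ × Vec k => h q.1 q.2)
    (n : ℕ) : IsTame P (truncRisk P n h) := by
  refine ⟨measurable_truncRisk hh n, n * (n + 1), by positivity, fun u z => ?_⟩
  by_cases hq : (u, z) ∈ {q : ℝ × Vec k |
    |h q.1 q.2| ≤ n ∧ ((n : ℝ) + 1)⁻¹ ≤ atRisk (condObs P q.2) q.1}
  · rw [truncRisk, indicator_of_mem hq]
    obtain ⟨h1, h2⟩ := hq
    simp only at h1 h2
    have hn : (0 : ℝ) ≤ n := Nat.cast_nonneg n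
    refine ⟨by nlinarith, ?_⟩
    rw [abs_mul, abs_inv, abs_of_nonneg (atRisk_nonneg _)]
    exact mul_le_mul h1 (inv_le_of_inv_le₀ (by positivity) h2) (inv_nonneg.2 (atRisk_nonneg _)) hn
  · rw [truncRisk, indicator_of_notMem hq]
    simp only [abs_zero, zero_mul, and_self]
    positivity

lemma IsTame.abs_martInt_le {h : ℝ → Vec k → ℝ} (hh : IsTame P h) (b : Bool) :
    ∃ c, ∀ p, |martInt P b h p| ≤ c := by
  obtain ⟨hm, c, hc0, hc⟩ := hh
  refine ⟨c + c, fun p => ?_⟩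
  rw [show p = (p.1, p.2.1, p.2.2) from rfl, martInt_eq_fibreMart hm, fibreMart]
  refine (abs_sub _ _).trans (add_le_add ?_ ?_)
  · split_ifs
    · exact (hc _ _).1
    · simpa using hc0
  · rw [hazInt, ← Real.norm_eq_abs]
    refine (norm_integral_le_of_norm_le_const (C := c) (ae_of_all _ fun q => ?_)).trans ?_
    · by_cases hq : q ∈ {q : ℝ × Bool | q.2 = b ∧ q.1 ≤ p.1}
      · rw [indicator_of_mem hq, Real.norm_eq_abs]; exact (hc _ _).2
      · rw [indicator_of_notMem hq]; simpa using hc0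
    · simp

lemma IsTame.memLp_martInt {h : ℝ → Vec k → ℝ} (hh : IsTame P h) (b : Bool) (r : ℝ≥0∞) :
    MemLp (martInt P b h) r P := by
  obtain ⟨c, hc⟩ := hh.abs_martInt_le b
  exact MemLp.of_bound (measurable_martInt hh.1).aestronglyMeasurable c (ae_of_all _ hc)

lemma IsTame.memLp {h : ℝ → Vec k → ℝ} (hh : IsTame P h) (b : Bool) (r : ℝ≥0∞) :
    MemLp (fun q : ℝ × Vec k => h q.1 q.2) r (subLaw P b) := by
  obtain ⟨hm, c, hc0, hc⟩ := hh
  exact MemLp.of_bound hm.aestronglyMeasurable c (ae_of_all _ fun q => (hc _ _).1)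

lemma IsTame.integrable_mul_residual {h : ℝ → Vec k → ℝ} (hh : IsTame P h) (b : Bool)
    {v : Obs k → ℝ} (hv : Measurable v) (hvi : Integrable v P) :
    Integrable (fun q : ℝ × Vec k => h q.1 q.2 * residual P b v q.1 q.2) (subLaw P b) := by
  obtain ⟨hm, c, hc0, hc⟩ := hh
  have hmeas : Measurable fun q : ℝ × Vec k => h q.1 q.2 * residual P b v q.1 q.2 :=
    hm.mul (measurable_residual hv)
  rw [integrable_subLaw_iff hmeas.aestronglyMeasurable]
  have hb1 : Integrable (fun z => ∫ q, ‖v (q.1, q.2, z)‖ ∂(condObs P z)) (covLaw P) :=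
    integrable_integral_fibre hvi.norm
  have hb2 : Integrable (fun p : Obs k => ∫ q, ‖v (q.1, q.2, p.2.2)‖ ∂(condObs P p.2.2)) P :=
    hb1.comp_measurable (f := fun p : Obs k => p.2.2) (by fun_prop)
  have hae : ∀ᵐ p ∂P, Integrable (fun q : ℝ × Bool => v (q.1, q.2, p.2.2)) (condObs P p.2.2) :=
    ae_of_ae_map (f := fun p : Obs k => p.2.2) (by fun_prop) (integrable_fibre hvi)
  refine Integrable.mono' ((hvi.norm.const_mul c).add (hb2.const_mul c))
    ((hmeas.comp measurable_timeCov).indicator (measurableSet_status b)).aestronglyMeasurable ?_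
  filter_upwards [hae] with p hp
  by_cases hpb : p.2.1 = b
  · rw [indicator_of_mem (by exact hpb)]
    have e : h p.1 p.2.2 * residual P b v p.1 p.2.2 = h p.1 p.2.2 * v p -
        h p.1 p.2.2 * (atRisk (condObs P p.2.2) p.1)⁻¹ *
          ∫ q in {q : ℝ × Bool | p.1 ≤ q.1}, v (q.1, q.2, p.2.2) ∂(condObs P p.2.2) := by
      rw [residual, ← hpb, div_eq_mul_inv]
      ring
    rw [e]
    refine (norm_sub_le _ _).trans (add_le_add ?_ ?_)
    · rw [norm_mul]
      exact mul_le_mul_of_nonneg_right (hc _ _).1 (norm_nonneg _)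
    · rw [norm_mul]
      refine mul_le_mul (hc _ _).2 ?_ (norm_nonneg _) hc0
      exact (norm_integral_le_integral_norm _).trans
        (setIntegral_le_integral hp.norm (ae_of_all _ fun _ => norm_nonneg _))
  · rw [indicator_of_notMem (by exact hpb), norm_zero]
    exact add_nonneg (mul_nonneg hc0 (norm_nonneg _))
      (mul_nonneg hc0 (integral_nonneg fun _ => norm_nonneg _))

/-- For tame `h`, the adjoint of the martingale transform is `v ↦ residual v`. -/
lemma IsTame.integral_martInt_mul {h : ℝ → Vec k → ℝ} (hh : IsTame P h) (b : Bool)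
    {v : Obs k → ℝ} (hv : Measurable v) (hvi : Integrable v P) :
    ∫ p, martInt P b h p * v p ∂P =
      ∫ q, h q.1 q.2 * residual P b v q.1 q.2 ∂(subLaw P b) := by
  have hR := hh.integrable_mul_residual b hv hvi
  have hmv : Integrable (fun p => martInt P b h p * v p) P :=
    hvi.bdd_mul (c := (hh.abs_martInt_le b).choose) (measurable_martInt hh.1).aestronglyMeasurable
      (ae_of_all _ (hh.abs_martInt_le b).choose_spec)
  rw [integral_obs hmv, integral_subLaw hR.1, integral_obs ((integrable_subLaw_iff hR.1).1 hR)]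
  refine integral_congr_ae ?_
  obtain ⟨hm, c, hc0, hc⟩ := hh
  filter_upwards [integrable_fibre hvi] with z hz
  set G := condObs P z with hG
  have hz' : Measurable fun q : ℝ × Bool => v (q.1, q.2, z) := hv.comp (by fun_prop)
  have hzm : Measurable fun q : ℝ × Bool => h q.1 z :=
    hm.comp (f := fun q : ℝ × Bool => (q.1, z)) (by fun_prop)
  have hF := integral_mul_hazInt (G := G) (b := b) (h := fun u => h u z)
    (v := fun q => v (q.1, q.2, z)) (by
      refine (hz.comp_fst G).mul_bdd (c := c) ?_ (ae_of_all _ fun p => ?_)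
      · have hk : Measurable fun p : (ℝ × Bool) × (ℝ × Bool) =>
            {p : (ℝ × Bool) × (ℝ × Bool) | p.2.2 = b ∧ p.2.1 ≤ p.1.1}.indicator
              (fun p => h p.2.1 z * (atRisk G p.2.1)⁻¹) p :=
          ((hzm.comp measurable_snd).mul (measurable_atRisk.comp measurable_snd.fst).inv).indicator
            ((measurable_snd.snd (measurableSet_singleton b)).inter
              (measurableSet_le measurable_snd.fst measurable_fst.fst))
        exact hk.aestronglyMeasurable
      · by_cases hq : p.2 ∈ {q : ℝ × Bool | q.2 = b ∧ q.1 ≤ p.1.1}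
        · rw [indicator_of_mem hq]; exact (hc _ _).2
        · rw [indicator_of_notMem hq]; simpa using hc0)
  have h1 : Integrable ({q : ℝ × Bool | q.2 = b}.indicator
      fun q => h q.1 z * v (q.1, q.2, z)) G :=
    (hz.bdd_mul (c := c) hzm.aestronglyMeasurable (ae_of_all _ fun q => (hc _ _).1)).indicator
      (measurableSet_snd_eq b)
  calc ∫ q, martInt P b h (q.1, q.2, z) * v (q.1, q.2, z) ∂G
      = ∫ q, ({q : ℝ × Bool | q.2 = b}.indicator (fun q => h q.1 z * v (q.1, q.2, z)) q -
          v (q.1, q.2, z) * hazInt G b (fun u => h u z) q.1) ∂G := by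
        refine integral_congr_ae (ae_of_all _ fun q => ?_)
        simp only
        rw [martInt_eq_fibreMart hm, fibreMart]
        by_cases hb : q.2 = b
        · simp [hb]; ring
        · simp [hb]; ring
    _ = _ := by
        rw [integral_sub h1 hF.1, hF.2.2, ← integral_sub h1 hF.2.1]
        refine integral_congr_ae (ae_of_all _ fun q => ?_)
        by_cases hb : q.2 = b
        · simp [hb, residual, hG]; ring
        · simp [hb]

lemma integrableOn_fibre {b : Bool} {h : ℝ → Vec k → ℝ}
    (hh : Measurable fun q : ℝ × Vec k => h q.1 q.2)
    (hi : Integrable (fun q : ℝ × Vec k => h q.1 q.2) (subLaw P b)) :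
    ∀ᵐ z ∂(covLaw P), IntegrableOn (fun q : ℝ × Bool => h q.1 z) {q | q.2 = b} (condObs P z) := by
  filter_upwards [integrable_fibre ((integrable_subLaw_iff hh.aestronglyMeasurable).1 hi)] with z hz
  rw [← integrable_indicator_iff (measurableSet_snd_eq b)]
  exact hz

/-- If failure times have no atoms, the residual inverts the martingale transform for failures
and annihilates the martingale transform for censoring. -/
lemma residual_martInt (hat : ∀ᵐ z ∂(covLaw P), NullSingletonClass (condTime P true z)) {b : Bool}
    {h : ℝ → Vec k → ℝ} (hh : Measurable fun q : ℝ × Vec k => h q.1 q.2)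
    (hi : Integrable (fun q : ℝ × Vec k => h q.1 q.2) (subLaw P b)) :
    (fun q : ℝ × Vec k => residual P true (martInt P b h) q.1 q.2) =ᵐ[subLaw P true]
      fun q => if b = true then h q.1 q.2 else 0 := by
  refine ae_of_ae_condTime (pr := fun q => residual P true (martInt P b h) q.1 q.2 =
    if b = true then h q.1 q.2 else 0) ?_ ?_
  · refine measurableSet_eq_fun (measurable_residual (measurable_martInt hh)) ?_
    split_ifs
    · exact hh
    · exact measurable_const
  filter_upwards [hat, integrableOn_fibre hh hi] with z hz hzi
  have hpos : ∀ᵐ u ∂(condTime P true z), 0 < atRisk (condObs P z) u := by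
    rw [condTime, ae_map_iff measurable_fst.aemeasurable
      (measurableSet_lt measurable_const measurable_atRisk)]
    exact ae_restrict_of_ae atRisk_pos_ae
  have : IsFiniteMeasure (condTime P b z) := by unfold condTime; infer_instance
  filter_upwards [hpos, ae_measure_singleton_eq_zero (G₁ := condTime P true z)
    (G₂ := condTime P b z)] with u hu hu0
  rw [condTime, Measure.map_apply measurable_fst (measurableSet_singleton u),
    Measure.restrict_apply (measurable_fst (measurableSet_singleton u))] at hu0
  have hlt : (∫ q in {q : ℝ × Bool | q.2 = b ∧ q.1 < u},
      h q.1 z * (atRisk (condObs P z) q.1)⁻¹ ∂(condObs P z)) =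
      hazInt (condObs P z) b (h · z) u := by
    rw [hazInt, integral_indicator (measurableSet_snd_fst b u)]
    refine setIntegral_congr_set ?_
    have hnot : ∀ᵐ q ∂(condObs P z), ¬ (q.1 = u ∧ q.2 = b) := by
      rw [ae_iff]
      refine measure_mono_null (fun q hq => ?_) hu0
      simpa using hq
    filter_upwards [hnot] with q hq
    refine propext ⟨fun h => ⟨h.1, h.2.le⟩, fun h => ⟨h.1, lt_of_le_of_ne h.2 fun he => ?_⟩⟩
    exact hq ⟨he, h.1⟩
  rw [residual]
  simp only [martInt_eq_fibreMart hh, Prod.mk.eta]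
  rw [(setIntegral_fibreMart hzi hu).2, hlt, fibreMart]
  field_simp
  cases b <;> simp

/-- Functions of the covariate have residual zero. -/
lemma residual_cov {b : Bool} {c : Vec k → ℝ} (hc : Measurable c) :
    (fun q : ℝ × Vec k => residual P b (fun p => c p.2.2) q.1 q.2) =ᵐ[subLaw P b] 0 := by
  refine ae_of_ae_condTime (pr := fun q => residual P b (fun p => c p.2.2) q.1 q.2 =
    (0 : ℝ × Vec k → ℝ) q) ?_ (ae_of_all _ fun z => ?_)
  · exact measurableSet_eq_fun (measurable_residual (hc.comp (by fun_prop))) measurable_zero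
  have hpos : ∀ᵐ u ∂(condTime P b z), 0 < atRisk (condObs P z) u := by
    rw [condTime, ae_map_iff measurable_fst.aemeasurable
      (measurableSet_lt measurable_const measurable_atRisk)]
    exact ae_restrict_of_ae atRisk_pos_ae
  filter_upwards [hpos] with u hu
  rw [residual]
  simp only
  rw [setIntegral_const, smul_eq_mul]
  change c z - atRisk (condObs P z) u * c z / atRisk (condObs P z) u = 0
  field_simp
  ring

end Martingale

/-! ### The martingale transform as an isometry of `L₂` -/

section Isometry

variable {k : ℕ} {P : Measure (Obs k)} [IsFiniteMeasure P]

/-- The martingale transform is isometric on tame functions. -/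
lemma IsTame.eLpNorm_martInt (hat : ∀ᵐ z ∂(covLaw P), NullSingletonClass (condTime P true z))
    {h : ℝ → Vec k → ℝ} (hh : IsTame P h) :
    eLpNorm (martInt P true h) 2 P =
      eLpNorm (fun q : ℝ × Vec k => h q.1 q.2) 2 (subLaw P true) := by
  have h1 := hh.memLp_martInt true 2
  have h2 := hh.memLp true 2
  have key : ∫ p, martInt P true h p ^ 2 ∂P = ∫ q, h q.1 q.2 ^ 2 ∂(subLaw P true) := by
    simp only [sq]
    rw [hh.integral_martInt_mul true (measurable_martInt hh.1)
      ((hh.memLp_martInt true 1).integrable le_rfl)]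
    refine integral_congr_ae ?_
    filter_upwards [residual_martInt hat hh.1 ((hh.memLp true 1).integrable le_rfl)] with q hq
    rw [hq, if_pos rfl]
  rw [← norm_sq_eq_integral h1, ← norm_sq_eq_integral h2, Lp.norm_toLp, Lp.norm_toLp] at key
  exact (ENNReal.toReal_eq_toReal_iff' h1.2.ne h2.2.ne).1
    ((pow_left_inj₀ ENNReal.toReal_nonneg ENNReal.toReal_nonneg two_ne_zero).1 key)

lemma atRisk_pos_subLaw (b : Bool) : ∀ᵐ q ∂(subLaw P b), 0 < atRisk (condObs P q.2) q.1 :=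
  ae_subLaw_of_ae (measurableSet_lt measurable_const measurable_atRisk_condObs)
    ((ae_of_ae_fibre (measurableSet_lt measurable_const
      (measurable_atRisk_condObs.comp measurable_timeCov))
      (ae_of_all _ fun z => atRisk_pos_ae (G := condObs P z))).mono fun _ hp _ => hp)

lemma atRisk_pos_obs : ∀ᵐ p ∂P, 0 < atRisk (condObs P p.2.2) p.1 :=
  ae_of_ae_fibre (measurableSet_lt measurable_const
      (measurable_atRisk_condObs.comp measurable_timeCov))
      (ae_of_all _ fun z => atRisk_pos_ae (G := condObs P z))

lemma abs_integral_mul_le {X : Type*} [MeasurableSpace X] {μ : Measure X} {f g : X → ℝ}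
    (hf : MemLp f 2 μ) (hg : MemLp g 2 μ) :
    |∫ x, f x * g x ∂μ| ≤ (eLpNorm f 2 μ).toReal * (eLpNorm g 2 μ).toReal := by
  have := abs_real_inner_le_norm (hf.toLp f) (hg.toLp g)
  rw [integral_inner_eq, Lp.norm_toLp, Lp.norm_toLp] at this
  convert this using 2
  refine integral_congr_ae ?_
  filter_upwards [hf.coeFn_toLp, hg.coeFn_toLp] with x h1 h2
  rw [h1, h2]

/-- By duality the residual map is a contraction from `L₂(P)` to `L₂(Q)`. -/
lemma memLp_residual (hat : ∀ᵐ z ∂(covLaw P), NullSingletonClass (condTime P true z))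
    {v : Obs k → ℝ} (hv : Measurable v) (hv2 : MemLp v 2 P) :
    MemLp (fun q : ℝ × Vec k => residual P true v q.1 q.2) 2 (subLaw P true) := by
  set R := residual P true v with hR
  have hRm : Measurable fun q : ℝ × Vec k => R q.1 q.2 := measurable_residual hv
  refine ⟨hRm.aestronglyMeasurable, ?_⟩
  have hn : ∀ n, eLpNorm (fun q : ℝ × Vec k => truncRisk P n R q.1 q.2) 2 (subLaw P true) ≤
      eLpNorm v 2 P := by
    intro n
    have ht := isTame_truncRisk (P := P) hRm n
    have h2 := ht.memLp true 2
    have e1 : ∫ q, truncRisk P n R q.1 q.2 ^ 2 ∂(subLaw P true) =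
        ∫ p, martInt P true (truncRisk P n R) p * v p ∂P := by
      rw [ht.integral_martInt_mul true hv (hv2.integrable (by norm_num))]
      refine integral_congr_ae (ae_of_all _ fun q => ?_)
      exact (truncRisk_mul_self n R q.1 q.2).symm
    have e2 := abs_integral_mul_le (ht.memLp_martInt true 2) hv2
    rw [← e1, ht.eLpNorm_martInt hat, ← norm_sq_eq_integral h2, Lp.norm_toLp,
      abs_of_nonneg (by positivity), sq] at e2
    set a := (eLpNorm (fun q : ℝ × Vec k => truncRisk P n R q.1 q.2) 2 (subLaw P true)) with ha
    have hle : a.toReal ≤ (eLpNorm v 2 P).toReal := by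
      rcases (ENNReal.toReal_nonneg (a := a)).eq_or_lt with h0 | h0
      · rw [← h0]; exact ENNReal.toReal_nonneg
      · exact le_of_mul_le_mul_left e2 h0
    exact (ENNReal.toReal_le_toReal h2.2.ne hv2.2.ne).1 hle
  refine lt_of_le_of_lt ?_ hv2.2
  refine (Lp.eLpNorm_lim_le_liminf_eLpNorm
    (fun n => ((isTame_truncRisk (P := P) hRm n).memLp true 2).1) _ ?_).trans
    ((liminf_le_liminf (Eventually.of_forall hn)).trans (by simp))
  filter_upwards [atRisk_pos_subLaw true] with q hq
  exact tendsto_nhds_of_eventually_eq (eventually_truncRisk_eq R q.1 q.2 hq)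

lemma ae_integrable_hazard {b : Bool} {h : ℝ → Vec k → ℝ}
    (hh : Measurable fun q : ℝ × Vec k => h q.1 q.2)
    (hi : Integrable (fun q : ℝ × Vec k => h q.1 q.2) (subLaw P b)) :
    ∀ᵐ p ∂P, Integrable ({q : ℝ × Bool | q.2 = b ∧ q.1 ≤ p.1}.indicator
      fun q => h q.1 p.2.2 * (atRisk (condObs P p.2.2) q.1)⁻¹) (condObs P p.2.2) := by
  have h1 : ∀ᵐ p ∂P, IntegrableOn (fun q : ℝ × Bool => h q.1 p.2.2) {q | q.2 = b}
      (condObs P p.2.2) :=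
    ae_of_ae_map (f := fun p : Obs k => p.2.2) (by fun_prop) (integrableOn_fibre hh hi)
  filter_upwards [h1, atRisk_pos_obs] with p hp hpos
  rw [integrable_indicator_iff (measurableSet_snd_fst b p.1)]
  exact (setIntegral_fibreMart (h := fun u => h u p.2.2) hp hpos).1

lemma martInt_sub {b : Bool} {h h' : ℝ → Vec k → ℝ}
    (hh : Measurable fun q : ℝ × Vec k => h q.1 q.2)
    (hi : Integrable (fun q : ℝ × Vec k => h q.1 q.2) (subLaw P b))
    (hh' : Measurable fun q : ℝ × Vec k => h' q.1 q.2)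
    (hi' : Integrable (fun q : ℝ × Vec k => h' q.1 q.2) (subLaw P b)) :
    martInt P b (fun u z => h u z - h' u z) =ᵐ[P] fun p => martInt P b h p - martInt P b h' p := by
  filter_upwards [ae_integrable_hazard hh hi, ae_integrable_hazard hh' hi'] with p h1 h2
  rw [show p = (p.1, p.2.1, p.2.2) from rfl, martInt_eq_fibreMart (hh.sub hh'),
    martInt_eq_fibreMart hh, martInt_eq_fibreMart hh']
  simp only [fibreMart, hazInt]
  have : ∫ q, {q : ℝ × Bool | q.2 = b ∧ q.1 ≤ p.1}.indicator
      (fun q => (h q.1 p.2.2 - h' q.1 p.2.2) * (atRisk (condObs P p.2.2) q.1)⁻¹) q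
        ∂(condObs P p.2.2) = ∫ q, {q : ℝ × Bool | q.2 = b ∧ q.1 ≤ p.1}.indicator
      (fun q => h q.1 p.2.2 * (atRisk (condObs P p.2.2) q.1)⁻¹) q ∂(condObs P p.2.2) -
      ∫ q, {q : ℝ × Bool | q.2 = b ∧ q.1 ≤ p.1}.indicator
      (fun q => h' q.1 p.2.2 * (atRisk (condObs P p.2.2) q.1)⁻¹) q ∂(condObs P p.2.2) := by
    rw [← integral_sub h1 h2]
    refine integral_congr_ae (ae_of_all _ fun q => ?_)
    by_cases hq : q ∈ {q : ℝ × Bool | q.2 = b ∧ q.1 ≤ p.1}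
    · simp only [indicator_of_mem hq, sub_mul]
    · simp only [indicator_of_notMem hq, sub_zero]
  rw [this]
  by_cases hb : p.2.1 = b
  · simp only [hb, if_true]; ring
  · simp only [hb, if_false]; ring

lemma tendsto_martInt_truncRisk {b : Bool} {h : ℝ → Vec k → ℝ}
    (hh : Measurable fun q : ℝ × Vec k => h q.1 q.2)
    (hi : Integrable (fun q : ℝ × Vec k => h q.1 q.2) (subLaw P b)) :
    ∀ᵐ p ∂P, Tendsto (fun n => martInt P b (truncRisk P n h) p) atTop (𝓝 (martInt P b h p)) := by
  filter_upwards [ae_integrable_hazard hh hi, atRisk_pos_obs] with p h1 hpos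
  rw [show p = (p.1, p.2.1, p.2.2) from rfl]
  simp only [martInt_eq_fibreMart hh, fun n => martInt_eq_fibreMart (P := P) (b := b)
    (measurable_truncRisk (P := P) hh n), fibreMart, hazInt]
  refine Tendsto.sub ?_ ?_
  · split_ifs
    · exact tendsto_nhds_of_eventually_eq (eventually_truncRisk_eq h _ _ hpos)
    · exact tendsto_const_nhds
  · refine tendsto_integral_of_dominated_convergence _ (fun n => ?_) h1.norm
      (fun n => ae_of_all _ fun q => ?_) ?_
    · refine Measurable.aestronglyMeasurable (Measurable.indicator ?_ (measurableSet_snd_fst b _))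
      exact ((measurable_truncRisk (P := P) hh n).comp
        (f := fun q : ℝ × Bool => (q.1, p.2.2)) (by fun_prop)).mul
        (measurable_atRisk.comp measurable_fst).inv
    · by_cases hq : q ∈ {q : ℝ × Bool | q.2 = b ∧ q.1 ≤ p.1}
      · simp only [indicator_of_mem hq, norm_mul]
        exact mul_le_mul_of_nonneg_right (abs_truncRisk_le n h _ _) (norm_nonneg _)
      · simp [indicator_of_notMem hq]
    · filter_upwards [atRisk_pos_ae (G := condObs P p.2.2)] with q hq
      by_cases hq' : q ∈ {q : ℝ × Bool | q.2 = b ∧ q.1 ≤ p.1}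
      · simp only [indicator_of_mem hq']
        exact (tendsto_nhds_of_eventually_eq (eventually_truncRisk_eq h _ _ hq)).mul_const _
      · simp [indicator_of_notMem hq']

/-- The martingale transform for failures maps `L₂(Q)` contractively to `L₂(P)`. -/
lemma eLpNorm_martInt_le (hat : ∀ᵐ z ∂(covLaw P), NullSingletonClass (condTime P true z))
    {h : ℝ → Vec k → ℝ} (hh : Measurable fun q : ℝ × Vec k => h q.1 q.2)
    (h2 : MemLp (fun q : ℝ × Vec k => h q.1 q.2) 2 (subLaw P true)) :
    eLpNorm (martInt P true h) 2 P ≤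
      eLpNorm (fun q : ℝ × Vec k => h q.1 q.2) 2 (subLaw P true) := by
  refine (Lp.eLpNorm_lim_le_liminf_eLpNorm
    (fun n => ((isTame_truncRisk (P := P) hh n).memLp_martInt true 2).1) _
    (tendsto_martInt_truncRisk hh (h2.integrable (by norm_num)))).trans
    ((liminf_le_liminf (Eventually.of_forall fun n => ?_)).trans (liminf_const _).le)
  rw [(isTame_truncRisk (P := P) hh n).eLpNorm_martInt hat]
  exact eLpNorm_mono fun q => abs_truncRisk_le n h q.1 q.2

/-- Stochastic integrals with respect to the failure martingale are square integrable. -/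
lemma memLp_martInt (hat : ∀ᵐ z ∂(covLaw P), NullSingletonClass (condTime P true z))
    {h : ℝ → Vec k → ℝ} (h2 : MemLp (fun q : ℝ × Vec k => h q.1 q.2) 2 (subLaw P true)) :
    MemLp (martInt P true h) 2 P := by
  have hm : Measurable fun q : ℝ × Vec k => (fun u z => h2.1.mk _ (u, z)) q.1 q.2 :=
    h2.1.stronglyMeasurable_mk.measurable
  have hc := martInt_congr (P := P) (b := true) (h := h) (h' := fun u z => h2.1.mk _ (u, z))
    h2.1.ae_eq_mk
  refine (memLp_congr_ae hc).2 ⟨(measurable_martInt hm).aestronglyMeasurable, ?_⟩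
  have h2' : MemLp (fun q : ℝ × Vec k => (fun u z => h2.1.mk _ (u, z)) q.1 q.2) 2 (subLaw P true) :=
    (memLp_congr_ae h2.1.ae_eq_mk).1 h2
  exact (eLpNorm_martInt_le hat hm h2').trans_lt h2'.2

lemma tendsto_eLpNorm_sub_truncRisk {b : Bool} {h : ℝ → Vec k → ℝ}
    (hh : Measurable fun q : ℝ × Vec k => h q.1 q.2)
    (h2 : MemLp (fun q : ℝ × Vec k => h q.1 q.2) 2 (subLaw P b)) :
    Tendsto (fun n => eLpNorm (fun q : ℝ × Vec k => h q.1 q.2 - truncRisk P n h q.1 q.2) 2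
      (subLaw P b)) atTop (𝓝 0) := by
  have h0 : Tendsto (fun n => ∫⁻ q, ‖h q.1 q.2 - truncRisk P n h q.1 q.2‖ₑ ^ 2 ∂(subLaw P b))
      atTop (𝓝 (∫⁻ q, 0 ∂(subLaw P b))) := by
    refine tendsto_lintegral_of_dominated_convergence' (fun q => ‖h q.1 q.2‖ₑ ^ 2)
      (fun n => ?_) (fun n => ae_of_all _ fun q => ?_) ?_ ?_
    · exact ((hh.sub (measurable_truncRisk hh n)).enorm.pow_const 2).aemeasurable
    · refine pow_le_pow_left₀ zero_le ?_ 2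
      by_cases hq : (q.1, q.2) ∈ {q : ℝ × Vec k |
        |h q.1 q.2| ≤ n ∧ ((n : ℝ) + 1)⁻¹ ≤ atRisk (condObs P q.2) q.1}
      · rw [truncRisk, indicator_of_mem hq]; simp
      · rw [truncRisk, indicator_of_notMem hq]; simp
    · exact ((memLp_two_iff_lintegral h2.1).1 h2).ne
    · filter_upwards [atRisk_pos_subLaw b] with q hq
      refine tendsto_nhds_of_eventually_eq ?_
      filter_upwards [eventually_truncRisk_eq h q.1 q.2 hq] with n hn
      simp [hn]
  simp only [lintegral_zero, ← sq_eLpNorm_two] at h0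
  have := (ENNReal.continuous_rpow_const (y := (1 / 2 : ℝ))).tendsto 0 |>.comp h0
  rw [ENNReal.zero_rpow_of_pos (by norm_num)] at this
  refine this.congr fun n => ?_
  simp only [Function.comp]
  rw [← ENNReal.rpow_natCast, ← ENNReal.rpow_mul]
  norm_num

lemma integral_martInt_mul_of_measurable
    (hat : ∀ᵐ z ∂(covLaw P), NullSingletonClass (condTime P true z)) {h : ℝ → Vec k → ℝ}
    (hh : Measurable fun q : ℝ × Vec k => h q.1 q.2)
    (h2 : MemLp (fun q : ℝ × Vec k => h q.1 q.2) 2 (subLaw P true))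
    {v : Obs k → ℝ} (hv : Measurable v) (hv2 : MemLp v 2 P) :
    ∫ p, martInt P true h p * v p ∂P =
      ∫ q, h q.1 q.2 * residual P true v q.1 q.2 ∂(subLaw P true) := by
  have hR := memLp_residual hat hv hv2
  have hi := h2.integrable (μ := subLaw P true) (by norm_num)
  have hM := memLp_martInt hat h2
  -- both sides are within `‖h - hₙ‖ ‖v‖` and `‖h - hₙ‖ ‖R v‖` of their values at the truncation
  have hbound : ∀ n, |∫ p, martInt P true h p * v p ∂P -
      ∫ q, h q.1 q.2 * residual P true v q.1 q.2 ∂(subLaw P true)| ≤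
      (eLpNorm (fun q : ℝ × Vec k => h q.1 q.2 - truncRisk P n h q.1 q.2) 2
        (subLaw P true)).toReal * ((eLpNorm v 2 P).toReal +
          (eLpNorm (fun q : ℝ × Vec k => residual P true v q.1 q.2) 2 (subLaw P true)).toReal) := by
    intro n
    have ht := isTame_truncRisk (P := P) hh n
    have ht2 := ht.memLp true 2
    have htM := ht.memLp_martInt true 2
    obtain ⟨g, hg⟩ : ∃ g : ℝ → Vec k → ℝ, g = fun u z => h u z - truncRisk P n h u z := ⟨_, rfl⟩
    have hgq : (fun q : ℝ × Vec k => h q.1 q.2 - truncRisk P n h q.1 q.2) =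
      fun q => g q.1 q.2 := by rw [hg]
    have hd2 : MemLp (fun q : ℝ × Vec k => g q.1 q.2) 2 (subLaw P true) := by
      rw [← hgq]; exact h2.sub ht2
    have hdm : Measurable fun q : ℝ × Vec k => g q.1 q.2 := by
      rw [← hgq]; exact hh.sub ht.1
    have e1 : ∫ p, martInt P true h p * v p ∂P - ∫ p, martInt P true (truncRisk P n h) p * v p ∂P =
        ∫ p, martInt P true g p * v p ∂P := by
      rw [← integral_sub (memLp_two_mul_integrable hM hv2) (memLp_two_mul_integrable htM hv2)]
      refine integral_congr_ae ?_
      filter_upwards [martInt_sub hh hi ht.1 (ht2.integrable (by norm_num))] with p hp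
      rw [hg, hp]; ring
    have e2 : ∫ q, h q.1 q.2 * residual P true v q.1 q.2 ∂(subLaw P true) -
        ∫ q, truncRisk P n h q.1 q.2 * residual P true v q.1 q.2 ∂(subLaw P true) =
        ∫ q, g q.1 q.2 * residual P true v q.1 q.2 ∂(subLaw P true) := by
      rw [← integral_sub (memLp_two_mul_integrable h2 hR) (memLp_two_mul_integrable ht2 hR)]
      refine integral_congr_ae (ae_of_all _ fun q => ?_)
      simp only [hg]
      ring
    have e3 := ht.integral_martInt_mul true hv (hv2.integrable (by norm_num))
    have b1 := abs_integral_mul_le (memLp_martInt hat hd2) hv2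
    have b2 := abs_integral_mul_le hd2 hR
    have b3 := ENNReal.toReal_mono hd2.2.ne (eLpNorm_martInt_le hat hdm hd2)
    have b4 := mul_le_mul_of_nonneg_right b3 (ENNReal.toReal_nonneg (a := eLpNorm v 2 P))
    have e4 : ∫ p, martInt P true h p * v p ∂P -
        ∫ q, h q.1 q.2 * residual P true v q.1 q.2 ∂(subLaw P true) =
        ∫ p, martInt P true g p * v p ∂P -
        ∫ q, g q.1 q.2 * residual P true v q.1 q.2 ∂(subLaw P true) := by
      rw [← e1, ← e2, e3]; ring
    rw [e4, hgq, mul_add]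
    exact (abs_sub _ _).trans (add_le_add (b1.trans b4) b2)
  have hlim := ((ENNReal.tendsto_toReal ENNReal.zero_ne_top).comp
    (tendsto_eLpNorm_sub_truncRisk hh h2)).mul_const ((eLpNorm v 2 P).toReal +
          (eLpNorm (fun q : ℝ × Vec k => residual P true v q.1 q.2) 2 (subLaw P true)).toReal)
  simp only [ENNReal.toReal_zero, zero_mul] at hlim
  have := ge_of_tendsto' hlim hbound
  exact sub_eq_zero.1 (abs_nonpos_iff.1 this)

/-- The adjoint of the martingale transform `L₂(Q) → L₂(P)` is the residual map. -/
lemma integral_martInt_mul (hat : ∀ᵐ z ∂(covLaw P), NullSingletonClass (condTime P true z))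
    {h : ℝ → Vec k → ℝ} (h2 : MemLp (fun q : ℝ × Vec k => h q.1 q.2) 2 (subLaw P true))
    {v : Obs k → ℝ} (hv : Measurable v) (hv2 : MemLp v 2 P) :
    ∫ p, martInt P true h p * v p ∂P =
      ∫ q, h q.1 q.2 * residual P true v q.1 q.2 ∂(subLaw P true) := by
  obtain ⟨g, hg⟩ : ∃ g : ℝ → Vec k → ℝ, g = fun u z => h2.1.mk _ (u, z) := ⟨_, rfl⟩
  have hm : Measurable fun q : ℝ × Vec k => g q.1 q.2 := by
    rw [hg]; exact h2.1.stronglyMeasurable_mk.measurable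
  have hhg : (fun q : ℝ × Vec k => h q.1 q.2) =ᵐ[subLaw P true] fun q => g q.1 q.2 := by
    rw [hg]; exact h2.1.ae_eq_mk
  have h2' := (memLp_congr_ae hhg).1 h2
  refine (integral_congr_ae ((martInt_congr hhg).mono fun p hp => ?_)).trans
    ((integral_martInt_mul_of_measurable hat hm h2' hv hv2).trans
      (integral_congr_ae (hhg.mono fun q hq => ?_)))
  · simp only [hp]
  · simp only at hq
    simp only [hq]

lemma residual_sub {b : Bool} {v w : Obs k → ℝ} (hv : Integrable v P) (hw : Integrable w P) :
    (fun q : ℝ × Vec k => residual P b (fun p => v p - w p) q.1 q.2) =ᵐ[subLaw P b]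
      fun q => residual P b v q.1 q.2 - residual P b w q.1 q.2 := by
  filter_upwards [ae_cov_subLaw (b := b) (integrable_fibre hv),
    ae_cov_subLaw (b := b) (integrable_fibre hw)] with q h1 h2
  simp only [residual]
  rw [integral_sub h1.integrableOn h2.integrableOn]
  ring

/-- Completeness of the martingale representation: an element of `L₂(P)` that is orthogonal to
the bounded stochastic integrals for censoring and to the functions of the covariate is the
martingale transform of its residual. -/
lemma ae_eq_martInt_residual (hat : ∀ᵐ z ∂(covLaw P), NullSingletonClass (condTime P true z))
    {v : Obs k → ℝ} (hv : Measurable v) (hv2 : MemLp v 2 P)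
    (hcens : ∀ h : ℝ → Vec k → ℝ, IsTame P h → ∫ p, martInt P false h p * v p ∂P = 0)
    (hcov : ∀ A : Set (Vec k), MeasurableSet A →
      ∫ p, A.indicator (fun _ => (1 : ℝ)) p.2.2 * v p ∂P = 0) :
    v =ᵐ[P] martInt P true (residual P true v) := by
  have hR := memLp_residual hat hv hv2
  have hRm : Measurable fun q : ℝ × Vec k => residual P true v q.1 q.2 := measurable_residual hv
  have hM := memLp_martInt hat hR
  have hMm := measurable_martInt (P := P) (b := true) hRm
  set w : Obs k → ℝ := fun p => v p - martInt P true (residual P true v) p with hw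
  have hwm : Measurable w := hv.sub hMm
  have hw2 : MemLp w 2 P := hv2.sub hM
  have hwi : Integrable w P := hw2.integrable (by norm_num)
  have hT : (fun q : ℝ × Vec k => residual P true w q.1 q.2) =ᵐ[subLaw P true] 0 := by
    filter_upwards [residual_sub (P := P) (b := true) (v := v)
      (w := martInt P true (residual P true v)) (hv2.integrable (by norm_num))
      (hM.integrable (by norm_num)),
      residual_martInt hat hRm (hR.integrable (by norm_num))] with q h1 h2
    rw [h1, h2]
    simp
  have hF : (fun q : ℝ × Vec k => residual P false w q.1 q.2) =ᵐ[subLaw P false] 0 := by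
    have hRw : Measurable fun q : ℝ × Vec k => residual P false w q.1 q.2 :=
      measurable_residual hwm
    have hn : ∀ n, (fun q : ℝ × Vec k => truncRisk P n (residual P false w) q.1 q.2)
        =ᵐ[subLaw P false] 0 := by
      intro n
      have ht := isTame_truncRisk (P := P) hRw n
      have e1 : ∫ q, truncRisk P n (residual P false w) q.1 q.2 ^ 2 ∂(subLaw P false) = 0 := by
        have e2 := ht.integral_martInt_mul false hwm hwi
        have e3 : ∫ p, martInt P false (truncRisk P n (residual P false w)) p * w p ∂P = 0 := by
          have e4 := integral_martInt_mul hat hR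
            (measurable_martInt (P := P) (b := false) ht.1) (ht.memLp_martInt false 2)
          have e5 : ∫ q, residual P true v q.1 q.2 * residual P true (martInt P false
              (truncRisk P n (residual P false w))) q.1 q.2 ∂(subLaw P true) = 0 := by
            refine integral_eq_zero_of_ae ?_
            filter_upwards [residual_martInt hat ht.1
              ((ht.memLp false 1).integrable le_rfl)] with q hq
            simp [hq]
          rw [e5] at e4
          have e6 := hcens _ ht
          simp only [hw, mul_sub]
          rw [integral_sub (memLp_two_mul_integrable (ht.memLp_martInt false 2) hv2)
            (memLp_two_mul_integrable (ht.memLp_martInt false 2) hM), e6, zero_sub, neg_eq_zero,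
            ← e4]
          exact integral_congr_ae (ae_of_all _ fun p => mul_comm _ _)
        rw [e3] at e2
        rw [e2]
        exact integral_congr_ae (ae_of_all _ fun q =>
          (truncRisk_mul_self n (residual P false w) q.1 q.2).symm)
      rw [integral_eq_zero_iff_of_nonneg (fun q => sq_nonneg _)
        (ht.memLp false 2).integrable_sq] at e1
      filter_upwards [e1] with q hq
      simpa using hq
    filter_upwards [ae_all_iff.2 hn, atRisk_pos_subLaw false] with q h1 h2
    obtain ⟨n, hn⟩ := (eventually_truncRisk_eq (residual P false w) q.1 q.2 h2).exists
    rw [← hn]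
    exact h1 n
  have hzero : (fun z => ∫ q, w (q.1, q.2, z) ∂(condObs P z)) =ᵐ[covLaw P] 0 := by
    refine ae_eq_zero_of_forall_setIntegral_eq_of_sigmaFinite
      (fun A _ _ => (integrable_integral_fibre hwi).integrableOn) fun A hA _ => ?_
    have hAm : Measurable fun p : Obs k => A.indicator (fun _ => (1 : ℝ)) p.2.2 :=
      (measurable_const.indicator hA).comp (by fun_prop)
    have hA2 : MemLp (fun p : Obs k => A.indicator (fun _ => (1 : ℝ)) p.2.2) 2 P := by
      refine MemLp.of_bound hAm.aestronglyMeasurable 1 (ae_of_all _ fun p => ?_)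
      by_cases hp : p.2.2 ∈ A <;> simp [hp]
    have e1 : ∫ p, A.indicator (fun _ => (1 : ℝ)) p.2.2 * w p ∂P = 0 := by
      have e4 := integral_martInt_mul hat hR hAm hA2
      have e5 : ∫ q, residual P true v q.1 q.2 * residual P true
          (fun p => A.indicator (fun _ => (1 : ℝ)) p.2.2) q.1 q.2 ∂(subLaw P true) = 0 := by
        refine integral_eq_zero_of_ae ?_
        filter_upwards [residual_cov (P := P) (b := true)
          (measurable_const.indicator hA : Measurable (A.indicator fun _ => (1 : ℝ)))] with q hq
        simp [hq]
      rw [e5] at e4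
      simp only [hw, mul_sub]
      rw [integral_sub (memLp_two_mul_integrable hA2 hv2) (memLp_two_mul_integrable hA2 hM),
        hcov A hA, zero_sub, neg_eq_zero, ← e4]
      exact integral_congr_ae (ae_of_all _ fun p => mul_comm _ _)
    rw [integral_obs (memLp_two_mul_integrable hA2 hw2)] at e1
    rw [← integral_indicator hA, ← e1]
    refine integral_congr_ae (ae_of_all _ fun z => ?_)
    by_cases hz : z ∈ A <;> simp [hz]
  have hfin : ∀ᵐ p ∂P, w p = 0 := by
    refine ae_of_ae_fibre (hwm (measurableSet_singleton 0)) ?_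
    have hsq : ∀ᵐ z ∂(covLaw P), Integrable (fun q : ℝ × Bool => w (q.1, q.2, z) ^ 2)
      (condObs P z) := integrable_fibre hw2.integrable_sq
    filter_upwards [hzero, hsq, ae_fibre_of_ae (ae_of_ae_subLaw hT),
      ae_fibre_of_ae (ae_of_ae_subLaw hF)] with z h0 h2 h3 h4
    have hz : Measurable fun q : ℝ × Bool => w (q.1, q.2, z) := hwm.comp (by fun_prop)
    refine ae_eq_zero_of_eq_meanResidual (G := condObs P z) (v := fun q => w (q.1, q.2, z))
      ((memLp_two_iff_integrable_sq hz.aestronglyMeasurable).2 h2) h0 ?_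
    filter_upwards [h3, h4, atRisk_pos_ae (G := condObs P z)] with q h5 h6 h7
    have hres : residual P q.2 w q.1 z = 0 := by
      rcases hq : q.2 with _ | _
      · exact h6 hq
      · exact h5 hq
    rw [residual, sub_eq_zero, eq_div_iff h7.ne'] at hres
    exact hres
  filter_upwards [hfin] with p hp
  exact sub_eq_zero.1 hp

end Isometry

/-! ### Absolutely continuous laws on the transformed time scale -/

section TimeChange

variable {Γ : ℝ → ℝ} {τ : ℝ≥0∞}

lemma measurableSet_timeIco (τ : ℝ≥0∞) : MeasurableSet (timeIco τ) :=
  (measurableSet_le measurable_const measurable_id).inter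
    (measurableSet_lt ENNReal.measurable_ofReal measurable_const)

lemma measurableSet_timeIoc (a : ℝ) (τ : ℝ≥0∞) : MeasurableSet (timeIoc a τ) :=
  (measurableSet_lt measurable_const measurable_id).inter
    (measurableSet_le ENNReal.measurable_ofReal measurable_const)

lemma IsTransformation.zero_mem (h : IsTransformation Γ τ) : (0 : ℝ) ∈ timeIco τ := by
  obtain ⟨t, ht, -⟩ := h.unbounded 0
  exact timeIco_mono le_rfl ht.1 ht

lemma IsTransformation.nonneg (h : IsTransformation Γ τ) {t : ℝ} (ht : t ∈ timeIco τ) :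
    0 ≤ Γ t := by
  have := h.monotoneOn h.zero_mem ht ht.1
  rwa [h.zero] at this

lemma IsTransformation.genInv_eq (h : IsTransformation Γ τ) {x : ℝ} (hx : 0 < x) :
    Γ (genInv Γ τ x) = x := by
  obtain ⟨hm, hle⟩ := genInv_mem h (x := x)
  refine le_antisymm ?_ hle
  by_contra! hlt
  -- by the intermediate value theorem `x` is attained before `genInv x`
  have hsub : Icc 0 (genInv Γ τ x) ⊆ timeIco τ := fun s hs => timeIco_mono hs.1 hs.2 hm
  have hivt := intermediate_value_Icc hm.1 (h.continuousOn.mono hsub)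
  rw [h.zero] at hivt
  obtain ⟨t, ht, htx⟩ := hivt ⟨hx.le, hlt.le⟩
  have h1 : genInv Γ τ x ≤ t := (genInv_le_iff h (hsub ht)).2 htx.ge
  have h2 : t = genInv Γ τ x := le_antisymm ht.2 h1
  rw [h2] at htx
  exact hlt.ne' htx

lemma ae_stieltjes_mem (h : IsTransformation Γ τ) :
    ∀ᵐ u ∂(stieltjes Γ τ), u ∈ timeIco τ ∧ 0 < u := by
  have := stieltjes_compl h
  rw [← mem_ae_iff] at this
  filter_upwards [this] with u hu
  exact ⟨hu.1, lt_of_le_of_ne hu.1.1 (Ne.symm hu.2)⟩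

lemma nullSingletonClass_stieltjes (h : IsTransformation Γ τ) :
    NullSingletonClass (stieltjes Γ τ) := by
  refine ⟨fun u => ?_⟩
  rw [stieltjes, Measure.map_apply (genInv_measurable h) (measurableSet_singleton u),
    Measure.restrict_apply (genInv_measurable h (measurableSet_singleton u))]
  refine measure_mono_null (t := {Γ u}) (fun x hx => ?_) (by simp)
  obtain ⟨h1, h2⟩ := hx
  have h1' : genInv Γ τ x = u := h1
  rw [mem_singleton_iff, ← h1', h.genInv_eq h2]

instance : SFinite (stieltjes Γ τ) := by
  unfold stieltjes; infer_instance

lemma aemeasurable_transformation (h : IsTransformation Γ τ) :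
    AEMeasurable Γ (stieltjes Γ τ) := by
  have h1 : (stieltjes Γ τ).restrict (timeIco τ) = stieltjes Γ τ :=
    Measure.restrict_eq_self_of_ae_mem ((ae_stieltjes_mem h).mono fun u hu => hu.1)
  rw [← h1]
  exact aemeasurable_restrict_of_monotoneOn (measurableSet_timeIco τ) h.monotoneOn

lemma hasDerivAt_cumulative {a : ℝ → ℝ} (ha : ContinuousOn a (Ici 0)) {x : ℝ} (hx : 0 < x) :
    HasDerivAt (fun x => ∫ y in (0 : ℝ)..x, a y) (a x) x := by
  have h1 : IntervalIntegrable a volume 0 x := by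
    refine ContinuousOn.intervalIntegrable (ha.mono ?_)
    rw [uIcc_of_le hx.le]; exact fun y hy => hy.1
  refine intervalIntegral.integral_hasDerivAt_right h1 ?_ (ha.continuousAt (Ici_mem_nhds hx))
  exact ContinuousOn.stronglyMeasurableAtFilter isOpen_Ioi
    (ha.mono Ioi_subset_Ici_self) x hx

lemma continuousWithinAt_cumulative {a : ℝ → ℝ} (ha : ContinuousOn a (Ici 0)) {x : ℝ}
    (hx : 0 ≤ x) : ContinuousWithinAt (fun x => ∫ y in (0 : ℝ)..x, a y) (Ici x) x := by
  have h1 : ContinuousOn (fun x => ∫ y in (0 : ℝ)..x, a y) (uIcc 0 (x + 1)) := by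
    refine intervalIntegral.continuousOn_primitive_interval ?_
    rw [uIcc_of_le (by linarith)]
    exact (ha.mono fun y hy => hy.1).integrableOn_Icc
  rw [uIcc_of_le (by linarith)] at h1
  refine (h1 x ⟨hx, by linarith⟩).mono_of_mem_nhdsWithin ?_
  refine mem_of_superset (Icc_mem_nhdsGE (by linarith : x < x + 1)) ?_
  exact Icc_subset_Icc_left hx

/-- The density `a e^{-A}` with hazard rate `a` has survival function `e^{-A}`. -/
lemma setLIntegral_hazard_density {a : ℝ → ℝ} (ha : ContinuousOn a (Ici 0))
    (hpos : ∀ x, 0 ≤ x → 0 < a x)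
    (hlim : Tendsto (fun x => ∫ y in (0 : ℝ)..x, a y) atTop atTop) {x : ℝ} (hx : 0 ≤ x) :
    ∫⁻ y in Ioi x, ENNReal.ofReal (a y * Real.exp (-∫ y in (0 : ℝ)..y, a y)) =
      ENNReal.ofReal (Real.exp (-∫ y in (0 : ℝ)..x, a y)) := by
  set A : ℝ → ℝ := fun x => ∫ y in (0 : ℝ)..x, a y with hA
  have hd : ∀ y ∈ Ioi x, HasDerivAt (fun y => -Real.exp (-A y)) (a y * Real.exp (-A y)) y := by
    intro y hy
    have := (hasDerivAt_cumulative ha (hx.trans_lt hy)).neg.exp.neg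
    refine this.congr_deriv ?_
    simp only [hA, Pi.neg_apply]
    ring
  have hc : ContinuousWithinAt (fun y => -Real.exp (-A y)) (Ici x) x :=
    (Real.continuous_exp.continuousAt.comp_continuousWithinAt
      (continuousWithinAt_cumulative ha hx).neg).neg
  have hn : ∀ y ∈ Ioi x, 0 ≤ a y * Real.exp (-A y) := fun y hy =>
    mul_nonneg (hpos y (hx.trans (le_of_lt hy))).le (Real.exp_pos _).le
  have ht : Tendsto (fun y => -Real.exp (-A y)) atTop (𝓝 0) := by
    have := (Real.tendsto_exp_atBot.comp (tendsto_neg_atTop_atBot.comp hlim)).neg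
    simpa using this
  have h1 := integral_Ioi_of_hasDerivAt_of_nonneg hc hd hn ht
  have h2 := integrableOn_Ioi_deriv_of_nonneg hc hd hn ht
  rw [← ofReal_integral_eq_lintegral_ofReal h2
    ((ae_restrict_iff' measurableSet_Ioi).2 (ae_of_all _ hn)), h1, zero_sub, neg_neg]

open Classical in
lemma measure_ext_of_survival {F F' : Measure ℝ} [IsProbabilityMeasure F] [IsProbabilityMeasure F']
    (h : IsTransformation Γ τ) {S : ℝ → ℝ≥0∞} (hF : ∀ t ∈ timeIco τ, F (Ioi t) = S t)
    (hF' : ∀ t ∈ timeIco τ, F' (Ioi t) = S t) (hS0 : S 0 = 1)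
    (hS : ∀ ε, 0 < ε → ∃ t ∈ timeIco τ, S t ≤ ε) : F = F' := by
  have key : ∀ (M : Measure ℝ) [IsProbabilityMeasure M], (∀ t ∈ timeIco τ, M (Ioi t) = S t) →
      ∀ x, M (Iic x) = if x < 0 then 0 else if x ∈ timeIco τ then 1 - S x else 1 := by
    intro M _ hM x
    have hc : ∀ x, M (Iic x) = 1 - M (Ioi x) := by
      intro x
      rw [← prob_compl_eq_one_sub measurableSet_Ioi, compl_Ioi]
    split_ifs with h1 h2
    · have : M (Iic 0) = 0 := by rw [hc, hM 0 h.zero_mem, hS0, tsub_self]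
      exact measure_mono_null (Iic_subset_Iic.2 h1.le) this
    · rw [hc, hM x h2]
    · have : M (Ioi x) = 0 := by
        by_contra hne
        obtain ⟨t, ht, hSt⟩ := hS _ (ENNReal.half_pos hne)
        have hxt : t ≤ x := by
          by_contra! hlt
          exact h2 (timeIco_mono (not_lt.1 h1) hlt.le ht)
        have := (measure_mono (μ := M) (Ioi_subset_Ioi hxt)).trans ((hM t ht).le.trans hSt)
        exact absurd this (not_le.2 (ENNReal.half_lt_self hne (measure_ne_top _ _)))
      rw [hc, this, tsub_zero]
  refine Measure.ext_of_Iic _ _ fun x => ?_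
  rw [key F hF, key F' hF']

/-- A law with cumulative hazard `A(Γ(t))`, `A = ∫ a`, has density `a(Γ) e^{-A(Γ)}` with respect
to `dΓ`. -/
lemma eq_stieltjes_withDensity (h : IsTransformation Γ τ) {a : ℝ → ℝ} (ham : Measurable a)
    (ha : ContinuousOn a (Ici 0)) (hpos : ∀ x, 0 ≤ x → 0 < a x)
    (hlim : Tendsto (fun x => ∫ y in (0 : ℝ)..x, a y) atTop atTop)
    {F : Measure ℝ} [IsProbabilityMeasure F] (hF : ∀ t ∈ timeIco τ,
      F (Ioi t) = ENNReal.ofReal (Real.exp (-∫ y in (0 : ℝ)..Γ t, a y))) :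
    F = (stieltjes Γ τ).withDensity
      fun u => ENNReal.ofReal (a (Γ u) * Real.exp (-∫ y in (0 : ℝ)..Γ u, a y)) := by
  set A : ℝ → ℝ := fun x => ∫ y in (0 : ℝ)..x, a y with hA
  have hgm := genInv_measurable h
  have hAm : AEMeasurable A (volume.restrict (Ioi 0)) := by
    refine ContinuousOn.aemeasurable (fun x hx => ?_) measurableSet_Ioi
    exact (hasDerivAt_cumulative ha hx).continuousAt.continuousWithinAt
  have hdm : AEMeasurable (fun x => ENNReal.ofReal (a x * Real.exp (-A x)))
      (volume.restrict (Ioi 0)) :=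
    (ham.aemeasurable.mul hAm.neg.exp).ennreal_ofReal
  -- the law of the image of the density `a e^{-A}` under the generalized inverse
  have hval : ∀ B, MeasurableSet B → (stieltjes Γ τ).withDensity
      (fun u => ENNReal.ofReal (a (Γ u) * Real.exp (-A (Γ u)))) B =
      ∫⁻ x in genInv Γ τ ⁻¹' B ∩ Ioi 0, ENNReal.ofReal (a x * Real.exp (-A x)) := by
    intro B hB
    have hcongr : (fun x => ENNReal.ofReal (a (Γ (genInv Γ τ x)) *
        Real.exp (-A (Γ (genInv Γ τ x))))) =ᵐ[volume.restrict (Ioi 0)]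
        fun x => ENNReal.ofReal (a x * Real.exp (-A x)) := by
      filter_upwards [ae_restrict_mem measurableSet_Ioi] with x hx
      rw [h.genInv_eq hx]
    have hm : AEMeasurable (fun u => ENNReal.ofReal (a (Γ u) * Real.exp (-A (Γ u))))
        (stieltjes Γ τ) := by
      have hΓ := aemeasurable_transformation h
      have h1 : AEMeasurable (fun u => a (Γ u)) (stieltjes Γ τ) := ham.comp_aemeasurable hΓ
      have h2 : AEMeasurable (fun u => A (Γ u)) (stieltjes Γ τ) := by
        have hcont : ContinuousOn A (Ici 0) := by
          intro x hx
          rcases (mem_Ici.1 hx).eq_or_lt with rfl | hx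
          · exact continuousWithinAt_cumulative ha le_rfl
          · exact (hasDerivAt_cumulative ha hx).continuousAt.continuousWithinAt
        have hcm : Measurable ((Ici 0).indicator A) :=
          (hcont.measurable_piecewise continuousOn_const measurableSet_Ici)
        refine (hcm.comp_aemeasurable hΓ).congr ?_
        filter_upwards [ae_stieltjes_mem h] with u hu
        exact indicator_of_mem (h.nonneg hu.1) A
      exact (h1.mul h2.neg.exp).ennreal_ofReal
    rw [withDensity_apply _ hB, ← lintegral_indicator hB, stieltjes,
      lintegral_map' (by rw [stieltjes] at hm; exact hm.indicator hB) hgm.aemeasurable,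
      ← Measure.restrict_restrict (hgm hB), ← lintegral_indicator (hgm hB)]
    refine lintegral_congr_ae ?_
    filter_upwards [hcongr] with x hx
    by_cases hxB : genInv Γ τ x ∈ B
    · rw [indicator_of_mem hxB, indicator_of_mem (by exact hxB), hx]
    · rw [indicator_of_notMem hxB, indicator_of_notMem (by exact hxB)]
  have hIoi : ∀ t ∈ timeIco τ, (stieltjes Γ τ).withDensity
      (fun u => ENNReal.ofReal (a (Γ u) * Real.exp (-A (Γ u)))) (Ioi t) =
      ENNReal.ofReal (Real.exp (-A (Γ t))) := by
    intro t ht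
    rw [hval _ measurableSet_Ioi, ← setLIntegral_hazard_density ha hpos hlim (h.nonneg ht)]
    have : genInv Γ τ ⁻¹' Ioi t ∩ Ioi 0 = Ioi (Γ t) := by
      ext x
      simp only [mem_inter_iff, mem_preimage, mem_Ioi]
      rw [← not_le, genInv_le_iff h ht, not_le]
      exact ⟨fun hx => hx.1, fun hx => ⟨hx, (h.nonneg ht).trans_lt hx⟩⟩
    rw [this]
  have hprob : IsProbabilityMeasure ((stieltjes Γ τ).withDensity
      (fun u => ENNReal.ofReal (a (Γ u) * Real.exp (-A (Γ u))))) := by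
    refine ⟨?_⟩
    rw [hval _ MeasurableSet.univ, preimage_univ, univ_inter,
      setLIntegral_hazard_density ha hpos hlim le_rfl]
    simp
  refine measure_ext_of_survival h hF hIoi (by simp [h.zero]) fun ε hε => ?_
  have hl : Tendsto (fun x => ENNReal.ofReal (Real.exp (-A x))) atTop (𝓝 0) := by
    have := ENNReal.tendsto_ofReal
      (Real.tendsto_exp_atBot.comp (tendsto_neg_atTop_atBot.comp hlim))
    simpa using this
  obtain ⟨x, hx⟩ := ((hl.eventually (gt_mem_nhds hε)).and (eventually_ge_atTop 0)).exists
  obtain ⟨t, ht, hxt⟩ := h.unbounded x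
  refine ⟨t, ht, le_trans (ENNReal.ofReal_le_ofReal (Real.exp_le_exp.2 (neg_le_neg ?_))) hx.1.le⟩
  have hint : ∀ y, 0 ≤ y → IntervalIntegrable a volume 0 y := fun y hy => by
    refine ContinuousOn.intervalIntegrable (ha.mono ?_)
    rw [uIcc_of_le hy]; exact fun y hy => hy.1
  simp only [hA]
  rw [← intervalIntegral.integral_add_adjacent_intervals (hint x hx.2)
    ((hint x hx.2).symm.trans (hint _ (hx.2.trans hxt)))]
  have := intervalIntegral.integral_nonneg (μ := volume) hxt
    fun y hy => (hpos y (hx.2.trans hy.1)).le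
  linarith

end TimeChange

/-! ### The hazard of the observed failures under independent censoring -/

section Censoring

/-- The observation `(X, δ)` as a function of the failure and censoring times. -/
noncomputable def observe (x : ℝ≥0 × ℝ≥0∞) : ℝ × Bool :=
  (withdrawal Prod.fst Prod.snd x, failed Prod.fst Prod.snd x)

lemma le_withdrawal_iff (u : ℝ) (x : ℝ≥0 × ℝ≥0∞) :
    u ≤ (observe x).1 ↔ u ≤ (x.1 : ℝ) ∧ ENNReal.ofReal u ≤ x.2 := by
  have hne : min (x.1 : ℝ≥0∞) x.2 ≠ ∞ := ((min_le_left _ _).trans_lt ENNReal.coe_lt_top).ne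
  change u ≤ (min (x.1 : ℝ≥0∞) x.2).toReal ↔ _
  rw [← ENNReal.ofReal_le_iff_le_toReal hne, le_min_iff,
    ENNReal.ofReal_le_iff_le_toReal ENNReal.coe_ne_top, ENNReal.coe_toReal]

lemma withdrawal_eq_iff (x : ℝ≥0 × ℝ≥0∞) : (observe x).1 = x.1 ↔ (x.1 : ℝ≥0∞) ≤ x.2 := by
  change (min (x.1 : ℝ≥0∞) x.2).toReal = x.1 ↔ _
  constructor
  · intro h
    by_contra! hlt
    rw [min_eq_right hlt.le] at h
    have h2 : x.2 ≠ ∞ := (hlt.trans ENNReal.coe_lt_top).ne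
    have := (ENNReal.toReal_lt_toReal h2 ENNReal.coe_ne_top).2 hlt
    rw [h, ENNReal.coe_toReal] at this
    exact lt_irrefl _ this
  · intro h
    rw [min_eq_left h, ENNReal.coe_toReal]

lemma failed_iff (x : ℝ≥0 × ℝ≥0∞) : (observe x).2 = true ↔ (x.1 : ℝ≥0∞) ≤ x.2 := by
  rw [← withdrawal_eq_iff]
  simp [observe, failed]

lemma measurable_observe : Measurable observe := by
  have h1 : Measurable fun x : ℝ≥0 × ℝ≥0∞ => (observe x).1 :=
    (measurable_fst.coe_nnreal_ennreal.min measurable_snd).ennreal_toReal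
  refine h1.prodMk (measurable_to_bool ?_)
  have : (fun x : ℝ≥0 × ℝ≥0∞ => failed Prod.fst Prod.snd x) ⁻¹' {true} =
      {x | (x.1 : ℝ≥0∞) ≤ x.2} := by
    ext x
    exact failed_iff x
  rw [this]
  exact measurableSet_le measurable_fst.coe_nnreal_ennreal measurable_snd

/-- If the failure time has hazard `a` with respect to an atomless `Λ`, then so do the observed
failures under independent censoring. -/
lemma failures_withDensity {F : Measure ℝ≥0} {H : Measure ℝ≥0∞} [IsProbabilityMeasure F]
    [IsProbabilityMeasure H] {Λ : Measure ℝ} [SFinite Λ] {a S : ℝ → ℝ≥0∞}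
    (hF : F.map (fun t : ℝ≥0 => (t : ℝ)) = Λ.withDensity fun u => a u * S u)
    (ha : AEMeasurable (fun u => a u * S u) Λ)
    (hS : ∀ᵐ u ∂Λ, F {t | u ≤ (t : ℝ)} = S u) :
    (((F.prod H).map observe).restrict {q | q.2 = true}).map Prod.fst =
      Λ.withDensity fun u => a u * (F.prod H).map observe {q | u ≤ q.1} := by
  have hHm : Measurable fun u : ℝ => H {t' | ENNReal.ofReal u ≤ t'} :=
    Antitone.measurable fun u v huv =>
      measure_mono fun t' ht' => (ENNReal.ofReal_le_ofReal huv).trans ht'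
  ext B hB
  rw [Measure.map_apply measurable_fst hB, Measure.restrict_apply (measurable_fst hB),
    Measure.map_apply measurable_observe ((measurable_fst hB).inter (measurableSet_snd_eq true))]
  have hpre : observe ⁻¹' (Prod.fst ⁻¹' B ∩ {q | q.2 = true}) =
      {x : ℝ≥0 × ℝ≥0∞ | (x.1 : ℝ) ∈ B ∧ (x.1 : ℝ≥0∞) ≤ x.2} := by
    ext x
    simp only [mem_preimage, mem_inter_iff, mem_ofPred_eq, failed_iff]
    refine and_congr_left fun h => ?_
    rw [(withdrawal_eq_iff x).2 h]
  have hmeas : MeasurableSet {x : ℝ≥0 × ℝ≥0∞ | (x.1 : ℝ) ∈ B ∧ (x.1 : ℝ≥0∞) ≤ x.2} :=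
    (measurable_fst.coe_nnreal_real hB).inter
      (measurableSet_le measurable_fst.coe_nnreal_ennreal measurable_snd)
  rw [hpre, Measure.prod_apply hmeas, withDensity_apply _ hB]
  have e1 : ∀ t : ℝ≥0, H (Prod.mk t ⁻¹' {x : ℝ≥0 × ℝ≥0∞ | (x.1 : ℝ) ∈ B ∧ (x.1 : ℝ≥0∞) ≤ x.2}) =
      B.indicator (fun u => H {t' | ENNReal.ofReal u ≤ t'}) (t : ℝ) := by
    intro t
    by_cases ht : (t : ℝ) ∈ B
    · rw [indicator_of_mem ht]
      simp [ht, preimage]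
    · rw [indicator_of_notMem ht]
      simp [ht, preimage]
  simp_rw [e1]
  rw [← lintegral_map (f := B.indicator fun u => H {t' | ENNReal.ofReal u ≤ t'})
    (hHm.indicator hB) measurable_coe_nnreal_real, hF, lintegral_indicator hB,
    restrict_withDensity hB, lintegral_withDensity_eq_lintegral_mul₀
      (ha.mono_measure Measure.restrict_le_self) hHm.aemeasurable]
  refine lintegral_congr_ae (ae_restrict_of_ae ?_)
  filter_upwards [hS] with u hu
  rw [Pi.mul_apply, ← hu, mul_assoc, Measure.map_apply measurable_observe (measurableSet_le_fst u)]
  congr 1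
  rw [← Measure.prod_prod]
  congr 1
  ext x
  simp only [mem_prod, mem_ofPred_eq, mem_preimage]
  rw [le_withdrawal_iff]

variable {Ω : Type*} [MeasurableSpace Ω] {Pr : Measure Ω} {k d : ℕ}
  {T : Ω → ℝ≥0} {T' : Ω → ℝ≥0∞} {Z : Ω → Vec k}

lemma measurable_observation (hT : Measurable T) (hT' : Measurable T') (hZ : Measurable Z) :
    Measurable fun ω => ((withdrawal T T' ω, failed T T' ω, Z ω) : Obs k) := by
  have h := measurable_observe.comp (hT.prodMk hT')
  exact h.fst.prodMk (h.snd.prodMk hZ)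

lemma covLaw_obsLaw (hT : Measurable T) (hT' : Measurable T') (hZ : Measurable Z) :
    covLaw (obsLaw Pr T T' Z) = Pr.map Z := by
  rw [covLaw, obsLaw, Measure.map_map (by fun_prop) (measurable_observation hT hT' hZ)]
  rfl

variable [IsProbabilityMeasure Pr]

lemma condObs_obsLaw (hT : Measurable T) (hT' : Measurable T') (hZ : Measurable Z) :
    ∀ᵐ z ∂(Pr.map Z), condObs (obsLaw Pr T T' Z) z =
      (condDistrib (fun ω => (T ω, T' ω)) Z Pr z).map observe := by
  have hm := measurable_observation hT hT' hZ
  have h1 := condDistrib_map (X := fun p : Obs k => p.2.2) (Y := fun p : Obs k => (p.1, p.2.1))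
    (ν := Pr) (f := fun ω => ((withdrawal T T' ω, failed T T' ω, Z ω) : Obs k))
    (by fun_prop) (by fun_prop) hm.aemeasurable
  have h2 : ⇑(condDistrib (observe ∘ fun ω => (T ω, T' ω)) Z Pr) =ᵐ[Pr.map Z] _ :=
    condDistrib_comp (μ := Pr) (Y := fun ω => (T ω, T' ω)) Z
    (hT.prodMk hT').aemeasurable measurable_observe
  filter_upwards [h1, h2] with z hz1 hz2
  rw [Kernel.map_apply _ measurable_observe] at hz2
  exact hz1.trans hz2

/-- In the transformation model the observed failures have conditional hazard
`α(Γ(u), θ, z) dΓ(u)`. -/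
lemma condTime_eq_withDensity (hT : Measurable T) (hT' : Measurable T') (hZ : Measurable Z)
    {Θ : Set (Vec d)} {α : ℝ → Vec d → Vec k → ℝ} {θ : Vec d} (hθ : θ ∈ Θ) {Γ : ℝ → ℝ}
    (hcore : CoreConditions Θ α (Pr.map Z)) (hmodel : IsTransformationModel Pr T T' Z α θ Γ)
    (hΓ : IsTransformation Γ (tauF Pr T)) :
    ∀ᵐ z ∂(covLaw (obsLaw Pr T T' Z)), condTime (obsLaw Pr T T' Z) true z =
      (stieltjes Γ (tauF Pr T)).withDensity fun u => ENNReal.ofReal (α (Γ u) θ z) *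
        condObs (obsLaw Pr T T' Z) z {q | u ≤ q.1} := by
  rw [covLaw_obsLaw hT hT' hZ]
  filter_upwards [condObs_obsLaw hT hT' hZ, hmodel.condIndep, hmodel.survival, hcore.pos,
    hcore.proper, hcore.smooth] with z hobs hind hsurv hpos hprop hsm
  have ham : Measurable fun x => α x θ z := (hcore.measurable θ hθ).comp measurable_prodMk_right
  have hac : ContinuousOn (fun x => α x θ z) (Ici 0) := by
    have h1 : ContinuousOn (fun x => Real.exp (Real.log (α x θ z))) (Ici 0) := by
      refine Real.continuous_exp.comp_continuousOn ?_
      exact hsm.continuousOn.comp (f := fun x : ℝ => (x, θ)) (by fun_prop) fun x hx => ⟨hx, hθ⟩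
    exact h1.congr fun x hx => (Real.exp_log (hpos θ hθ x hx)).symm
  set F := condDistrib T Z Pr z with hF
  set H := condDistrib T' Z Pr z with hH
  have hFp : IsProbabilityMeasure (F.map fun t : ℝ≥0 => (t : ℝ)) :=
    Measure.isProbabilityMeasure_map (by fun_prop)
  have hF1 : F.map (fun t : ℝ≥0 => (t : ℝ)) = _ := eq_stieltjes_withDensity hΓ ham hac
    (hpos θ hθ) (hprop θ hθ) fun t ht => by
      rw [Measure.map_apply measurable_coe_nnreal_real measurableSet_Ioi]
      exact hsurv t ht
  have hna := nullSingletonClass_stieltjes hΓ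
  have hcongr : (fun u => ENNReal.ofReal (α (Γ u) θ z *
      Real.exp (-∫ y in (0 : ℝ)..Γ u, α y θ z))) =ᵐ[stieltjes Γ (tauF Pr T)]
      fun u => ENNReal.ofReal (α (Γ u) θ z) *
        ENNReal.ofReal (Real.exp (-∫ y in (0 : ℝ)..Γ u, α y θ z)) := by
    filter_upwards [ae_stieltjes_mem hΓ] with u hu
    rw [ENNReal.ofReal_mul (hpos θ hθ _ (hΓ.nonneg hu.1)).le]
  rw [withDensity_congr_ae hcongr] at hF1
  have hIci : ∀ u ∈ timeIco (tauF Pr T), F {t : ℝ≥0 | u ≤ (t : ℝ)} =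
      ENNReal.ofReal (Real.exp (-∫ y in (0 : ℝ)..Γ u, α y θ z)) := by
    intro u hu
    have h1 : F {t : ℝ≥0 | (t : ℝ) = u} = 0 := by
      have h2 : F.map (fun t : ℝ≥0 => (t : ℝ)) {u} = 0 := by
        rw [hF1]
        exact withDensity_absolutelyContinuous _ _ (measure_singleton u)
      rwa [Measure.map_apply measurable_coe_nnreal_real (measurableSet_singleton u)] at h2
    have h3 : F {t : ℝ≥0 | u ≤ (t : ℝ)} = F {t : ℝ≥0 | u < (t : ℝ)} := by
      refine measure_congr ?_
      have h4 : ∀ᵐ t : ℝ≥0 ∂F, (t : ℝ) ≠ u := by rw [ae_iff]; simpa using h1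
      filter_upwards [h4] with t ht
      exact propext ⟨fun h => lt_of_le_of_ne h ht.symm, fun h => le_of_lt h⟩
    rw [h3, hsurv u hu]
    rfl
  have hmeas : AEMeasurable (fun u => ENNReal.ofReal (α (Γ u) θ z) *
      ENNReal.ofReal (Real.exp (-∫ y in (0 : ℝ)..Γ u, α y θ z))) (stieltjes Γ (tauF Pr T)) := by
    refine ((ham.comp_aemeasurable (aemeasurable_transformation hΓ)).ennreal_ofReal).mul ?_
    have hanti : Measurable fun u : ℝ => F {t : ℝ≥0 | u ≤ (t : ℝ)} :=
      Antitone.measurable fun u v huv => measure_mono fun t ht => huv.trans ht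
    refine hanti.aemeasurable.congr ?_
    filter_upwards [ae_stieltjes_mem hΓ] with u hu using hIci u hu.1
  have key := failures_withDensity (F := F) (H := H) hF1 hmeas
    ((ae_stieltjes_mem hΓ).mono fun u hu => hIci u hu.1)
  rw [condTime, hobs, hind]
  exact key

end Censoring

/-! ### The joint law of the observed failures and the covariate -/

section Density

/-- The conditional law given the first coordinate, for a density with respect to a product
measure. -/
lemma withDensity_section_eq_condKernel {E : Type*} [MeasurableSpace E] [StandardBorelSpace E]
    [Nonempty E] {Λ : Measure ℝ} [SFinite Λ] {μ : Measure E} [IsFiniteMeasure μ]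
    {w : ℝ × E → ℝ≥0∞} (hw : Measurable w) {Q : Measure (ℝ × E)} [IsFiniteMeasure Q]
    (hQ : Q = (Λ.prod μ).withDensity w) :
    Q.fst = Λ.withDensity (fun u => ∫⁻ z, w (u, z) ∂μ) ∧
      (∀ᵐ u ∂Λ, ∫⁻ z, w (u, z) ∂μ < ∞) ∧
      ∀ᵐ u ∂Q.fst, μ.withDensity (fun z => w (u, z)) =
        (∫⁻ z, w (u, z) ∂μ) • Q.condKernel u := by
  obtain ⟨σ, hσ⟩ : ∃ σ : ℝ → ℝ≥0∞, σ = fun u => ∫⁻ z, w (u, z) ∂μ := ⟨_, rfl⟩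
  have hσm : Measurable σ := by rw [hσ]; exact hw.lintegral_prod_right'
  have hσ' : ∀ u, ∫⁻ z, w (u, z) ∂μ = σ u := fun u => by rw [hσ]
  simp only [hσ']
  have hsec : ∀ u, Measurable fun z => w (u, z) := fun u => hw.comp measurable_prodMk_left
  have hQS : ∀ S, MeasurableSet S → Q S = ∫⁻ u, ∫⁻ z in Prod.mk u ⁻¹' S, w (u, z) ∂μ ∂Λ := by
    intro S hS
    rw [hQ, withDensity_apply _ hS, ← lintegral_indicator hS,
      lintegral_prod _ (hw.indicator hS).aemeasurable]
    refine lintegral_congr fun u => ?_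
    rw [← lintegral_indicator (measurable_prodMk_left hS)]
    rfl
  have hfst : Q.fst = Λ.withDensity σ := by
    ext S hS
    rw [Measure.fst_apply hS, hQS _ (measurable_fst hS), withDensity_apply _ hS,
      ← lintegral_indicator hS]
    refine lintegral_congr fun u => ?_
    by_cases hu : u ∈ S
    · have : Prod.mk u ⁻¹' (Prod.fst ⁻¹' S) = (univ : Set E) := by ext z; simp [hu]
      rw [this, setLIntegral_univ, indicator_of_mem hu, hσ]
    · have : Prod.mk u ⁻¹' (Prod.fst ⁻¹' S) = (∅ : Set E) := by ext z; simp [hu]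
      rw [this, Measure.restrict_empty, lintegral_zero_measure, indicator_of_notMem hu]
  have hfin : ∀ᵐ u ∂Λ, σ u < ∞ := by
    refine ae_lt_top hσm ?_
    have : Λ.withDensity σ univ ≠ ∞ := by
      rw [← hfst]; exact measure_ne_top _ _
    rwa [withDensity_apply _ MeasurableSet.univ, setLIntegral_univ] at this
  refine ⟨hfst, hfin, ?_⟩
  obtain ⟨f, hf⟩ : ∃ f : ℝ → E → ℝ≥0∞, f = fun u z => w (u, z) * (σ u)⁻¹ := ⟨_, rfl⟩
  have hfm : Measurable (Function.uncurry f) := by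
    rw [hf]
    exact hw.mul (hσm.inv.comp measurable_fst)
  let κ : Kernel ℝ E := Kernel.withDensity (Kernel.const ℝ μ) f
  have hκ : ∀ u, κ u = μ.withDensity (f u) := fun u => by
    rw [Kernel.withDensity_apply _ hfm, Kernel.const_apply]
  have hκS : ∀ u S, MeasurableSet S → κ u S = (∫⁻ z in S, w (u, z) ∂μ) * (σ u)⁻¹ := by
    intro u S hS
    rw [hκ, withDensity_apply _ hS, hf, lintegral_mul_const _ (hsec u)]
  have hκf : IsFiniteKernel κ := by
    refine ⟨1, ENNReal.one_lt_top, fun u => ?_⟩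
    rw [hκS u univ MeasurableSet.univ, setLIntegral_univ, hσ']
    exact ENNReal.div_self_le_one
  have hmul : ∀ u S, MeasurableSet S → σ u < ∞ → σ u * κ u S = ∫⁻ z in S, w (u, z) ∂μ := by
    intro u S hS hu
    rw [hκS u S hS]
    by_cases h0 : σ u = 0
    · rw [h0, zero_mul]
      refine (le_antisymm ?_ zero_le).symm
      rw [← h0, ← hσ' u]
      exact lintegral_mono' Measure.restrict_le_self le_rfl
    · rw [mul_comm, mul_assoc, ENNReal.inv_mul_cancel h0 hu.ne, mul_one]
  have hcomp : Q = Q.fst ⊗ₘ κ := by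
    ext S hS
    rw [Measure.compProd_apply hS, hfst, hQS S hS, lintegral_withDensity_eq_lintegral_mul _ hσm
      (Kernel.measurable_kernel_prodMk_left hS)]
    refine lintegral_congr_ae ?_
    filter_upwards [hfin] with u hu
    rw [Pi.mul_apply, hmul u _ (measurable_prodMk_left hS) hu]
  have h1 := eq_condKernel_of_measure_eq_compProd κ hcomp
  have h2 : ∀ᵐ u ∂Q.fst, σ u < ∞ := by
    rw [hfst]; exact (withDensity_absolutelyContinuous _ _).ae_le hfin
  filter_upwards [h1, h2] with u hu1 hu2
  rw [← hu1]
  ext S hS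
  rw [Measure.smul_apply, smul_eq_mul, hmul u S hS hu2, withDensity_apply _ hS]

/-- A positive continuous function on `[0, b]` for almost every `z` has a positive lower bound
there, measurable in `z`. -/
lemma exists_measurable_lower_bound {E : Type*} [MeasurableSpace E] {μ : Measure E}
    {a : ℝ × E → ℝ} (ha : Measurable a) (b : ℝ) (hb : 0 ≤ b)
    (hc : ∀ᵐ z ∂μ, ContinuousOn (fun x => a (x, z)) (Ici 0) ∧ ∀ x, 0 ≤ x → 0 < a (x, z)) :
    ∃ m : E → ℝ≥0∞, Measurable m ∧
      ∀ᵐ z ∂μ, 0 < m z ∧ ∀ x ∈ Icc 0 b, m z ≤ ENNReal.ofReal (a (x, z)) := by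
  refine ⟨fun z => ⨅ q : ℚ, ENNReal.ofReal (a (projIcc 0 b hb (q : ℝ), z)), ?_, ?_⟩
  · exact Measurable.iInf fun q => (ha.comp measurable_prodMk_left).ennreal_ofReal
  filter_upwards [hc] with z hz
  have hcont : Continuous fun x : ℝ => ENNReal.ofReal (a (projIcc 0 b hb x, z)) := by
    refine ENNReal.continuous_ofReal.comp ?_
    have h1 : Continuous fun x : Icc (0 : ℝ) b => a (x, z) :=
      continuousOn_iff_continuous_domRestrict.1 (hz.1.mono fun x hx => hx.1)
    exact h1.comp continuous_projIcc
  constructor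
  · obtain ⟨x₀, hx₀, hmin⟩ := isCompact_Icc.exists_isMinOn (nonempty_Icc.2 hb)
      (hz.1.mono fun x hx => hx.1)
    refine (ENNReal.ofReal_pos.2 (hz.2 x₀ hx₀.1)).trans_le (le_iInf fun q => ?_)
    exact ENNReal.ofReal_le_ofReal (hmin (projIcc 0 b hb (q : ℝ)).2)
  · intro x hx
    have h1 : ∀ y : ℝ, (⨅ q : ℚ, ENNReal.ofReal (a (projIcc 0 b hb (q : ℝ), z))) ≤
        ENNReal.ofReal (a (projIcc 0 b hb y, z)) := by
      intro y
      refine Rat.isDenseEmbedding_coe_real.dense.induction_on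
        (p := fun y : ℝ => (⨅ q : ℚ, ENNReal.ofReal (a (projIcc 0 b hb (q : ℝ), z))) ≤
          ENNReal.ofReal (a (projIcc 0 b hb y, z))) y ?_ ?_
      · exact isClosed_le continuous_const hcont
      · exact fun q => iInf_le _ q
    have h2 := h1 x
    rwa [projIcc_of_mem hb hx] at h2

/-- `ℓ'` is a limit of measurable difference quotients. -/
lemma aemeasurable_ellPrime {d k : ℕ} {Θ : Set (Vec d)} {α : ℝ → Vec d → Vec k → ℝ} {θ : Vec d}
    (hθ : θ ∈ Θ) {Γ : ℝ → ℝ} {μ : Measure (Vec k)} [SFinite μ] {Λ : Measure ℝ} [SFinite Λ]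
    (hcore : CoreConditions Θ α μ) (hΓ : AEMeasurable Γ Λ) (hΓ0 : ∀ᵐ u ∂Λ, 0 ≤ Γ u) :
    AEMeasurable (fun q : ℝ × Vec k => ellPrime α θ Γ q.1 q.2) (Λ.prod μ) := by
  have ham := hcore.measurable θ hθ
  obtain ⟨F, hF⟩ : ∃ F : ℕ → ℝ × Vec k → ℝ, F = fun (n : ℕ) (q : ℝ × Vec k) =>
      slope (fun x => Real.log (α x θ q.2)) (hΓ.mk Γ q.1) (hΓ.mk Γ q.1 + 1 / ((n : ℝ) + 1)) :=
    ⟨_, rfl⟩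
  have hFm : ∀ n, Measurable (F n) := by
    intro n
    have h0 : Measurable fun q : ℝ × Vec k => hΓ.mk Γ q.1 := hΓ.measurable_mk.comp measurable_fst
    have h1 : ∀ c : ℝ, Measurable fun q : ℝ × Vec k => Real.log (α (hΓ.mk Γ q.1 + c) θ q.2) :=
      fun c => Real.measurable_log.comp
        (ham.comp (f := fun q : ℝ × Vec k => (hΓ.mk Γ q.1 + c, q.2))
          ((h0.add_const c).prodMk measurable_snd))
    have h2 := h1 0
    simp only [add_zero] at h2
    simp only [hF, slope_def_field]
    exact ((h1 _).sub h2).div ((h0.add_const _).sub h0)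
  refine aemeasurable_of_tendsto_metrizable_ae atTop (fun n => (hFm n).aemeasurable) ?_
  have hfst : ∀ᵐ q ∂(Λ.prod μ), Γ q.1 = hΓ.mk Γ q.1 ∧ 0 ≤ Γ q.1 :=
    Measure.quasiMeasurePreserving_fst.ae (hΓ.ae_eq_mk.and hΓ0)
  have hsnd : ∀ᵐ q ∂(Λ.prod μ), ContDiffOn ℝ 1 (fun p : ℝ × Vec d => Real.log (α p.1 p.2 q.2))
      (Ici 0 ×ˢ Θ) := Measure.quasiMeasurePreserving_snd.ae hcore.smooth
  filter_upwards [hfst, hsnd] with q hq1 hq2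
  have hd : DifferentiableOn ℝ (fun x => Real.log (α x θ q.2)) (Ici 0) := by
    have := hq2.differentiableOn one_ne_zero
    exact this.comp (f := fun x : ℝ => (x, θ)) (by fun_prop) fun x hx => ⟨hx, hθ⟩
  have h1 := hasDerivWithinAt_iff_tendsto_slope.1 (hd (Γ q.1) hq1.2).hasDerivWithinAt
  have h2 : Tendsto (fun n : ℕ => Γ q.1 + 1 / ((n : ℝ) + 1)) atTop
      (𝓝[Ici 0 \ {Γ q.1}] (Γ q.1)) := by
    refine tendsto_nhdsWithin_iff.2 ⟨?_, Eventually.of_forall fun n => ?_⟩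
    · simpa using tendsto_one_div_add_atTop_nhds_zero_nat.const_add (Γ q.1)
    · have : 0 < 1 / ((n : ℝ) + 1) := by positivity
      exact ⟨by simp only [mem_Ici]; linarith [hq1.2], by simp only [mem_singleton_iff]; linarith⟩
  have h3 := h1.comp h2
  simp only [hF, ← hq1.1]
  exact h3

end Density

/-! ### The observed failures in the transformation model -/

section Facts

variable {d k : ℕ}

/-- The law of the covariate on the event `X ≥ u` of being at risk at `u`. -/
noncomputable def riskCov (P : Measure (Obs k)) (u : ℝ) : Measure (Vec k) :=
  (P.restrict {p | u ≤ p.1}).map fun p => p.2.2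

lemma fst_subLaw (P : Measure (Obs k)) : (subLaw P true).fst = EN P := by
  rw [Measure.fst, subLaw, EN, Measure.map_map measurable_fst (by fun_prop)]
  rfl

instance (P : Measure (Obs k)) [IsFiniteMeasure P] : IsFiniteMeasure (EN P) := by
  unfold EN; infer_instance

/-- What the projection argument uses of the transformation model, with `Λ = dΓ`: the observed
failures have intensity `s[1] dΛ`, and the conditional law of `Z` given a failure at `u` is
the law of `Z` on `X ≥ u`, reweighted by the hazard rate. -/
structure CoreFacts (P : Measure (Obs k)) [IsFiniteMeasure P] (α : ℝ → Vec d → Vec k → ℝ)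
    (θ : Vec d) (Γ : ℝ → ℝ) (Λ : Measure ℝ) : Prop where
  nullSingleton : NullSingletonClass Λ
  aemeasurable_s_one : AEMeasurable (s P α θ Γ fun _ _ => 1) Λ
  EN_eq : EN P = Λ.withDensity fun u => ENNReal.ofReal (s P α θ Γ (fun _ _ => 1) u)
  s_one_pos : ∀ t ∈ timeIco (tau0 P), ∀ᵐ u ∂(Λ.restrict (Ioc 0 t)),
    0 < s P α θ Γ (fun _ _ => 1) u
  C_lt_top : ∀ t ∈ timeIco (tau0 P), C P α θ Γ (Ioc 0 t) < ∞
  carrier : ∀ᵐ u ∂(EN P), 0 < u ∧ u ∈ timeIco (tau0 P)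
  risk : ∀ᵐ u ∂(EN P), 0 < s P α θ Γ (fun _ _ => 1) u ∧
    (∀ᵐ z ∂(riskCov P u), 0 < α (Γ u) θ z) ∧
    (riskCov P u).withDensity (fun z => ENNReal.ofReal (α (Γ u) θ z)) =
      ENNReal.ofReal (s P α θ Γ (fun _ _ => 1) u) • (subLaw P true).condKernel u
  measurable_rate : ∀ u, Measurable (α (Γ u) θ)
  aestronglyMeasurable_ell :
    AEStronglyMeasurable (fun q : ℝ × Vec k => ellPrime α θ Γ q.1 q.2) (subLaw P true)

variable {P : Measure (Obs k)}

/-- `s[f](u)` as an integral over the covariate at risk. -/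
lemma s_eq_integral_riskCov {α : ℝ → Vec d → Vec k → ℝ} {θ : Vec d} {Γ : ℝ → ℝ} {u : ℝ}
    (hα : Measurable (α (Γ u) θ)) {f : ℝ → Vec k → ℝ}
    (hf : AEStronglyMeasurable (f u) (riskCov P u)) :
    s P α θ Γ f u = ∫ z, f u z * α (Γ u) θ z ∂(riskCov P u) := by
  exact (integral_map (f := fun z => f u z * α (Γ u) θ z) (by fun_prop)
    (hf.mul hα.aestronglyMeasurable)).symm

variable [IsFiniteMeasure P]

lemma riskCov_eq (u : ℝ) :
    riskCov P u = (covLaw P).withDensity fun z => condObs P z {q | u ≤ q.1} := by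
  ext S hS
  have hm : MeasurableSet {p : Obs k | u ≤ p.1} := measurableSet_le measurable_const measurable_fst
  have hS' : MeasurableSet ((fun p : Obs k => p.2.2) ⁻¹' S) :=
    (by fun_prop : Measurable fun p : Obs k => p.2.2) hS
  rw [riskCov, Measure.map_apply (by fun_prop) hS, Measure.restrict_apply hS',
    withDensity_apply _ hS, ← lintegral_indicator_one (hS'.inter hm),
    lintegral_obs P (measurable_one.indicator (hS'.inter hm)), ← lintegral_indicator hS]
  refine lintegral_congr fun z => ?_
  by_cases hz : z ∈ S
  · rw [indicator_of_mem hz, ← lintegral_indicator_one (measurableSet_le_fst u)]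
    refine lintegral_congr fun q => ?_
    simp [indicator, hz]
  · rw [indicator_of_notMem hz]
    simp [hz]

lemma measurable_condObs_le :
    Measurable fun x : ℝ × Vec k => condObs P x.2 {q | x.1 ≤ q.1} := by
  convert (measurable_atRisk_condObs (P := P)).ennreal_ofReal using 2 with x
  rw [atRisk, ofReal_measureReal]

lemma subLaw_eq_withDensity {Λ : Measure ℝ} [SFinite Λ] {w : ℝ × Vec k → ℝ≥0∞}
    (hw : Measurable w) (h : ∀ᵐ z ∂(covLaw P), condTime P true z =
      Λ.withDensity fun u => w (u, z)) :
    subLaw P true = (Λ.prod (covLaw P)).withDensity w := by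
  ext S hS
  rw [subLaw, Measure.map_apply measurable_timeCov hS,
    Measure.restrict_apply (measurable_timeCov hS), withDensity_apply _ hS,
    ← lintegral_indicator_one ((measurable_timeCov hS).inter (measurableSet_status true)),
    lintegral_obs P (measurable_one.indicator
      ((measurable_timeCov hS).inter (measurableSet_status true))),
    ← lintegral_indicator hS, lintegral_prod_symm _ (hw.indicator hS).aemeasurable]
  refine lintegral_congr_ae ?_
  filter_upwards [h] with z hz
  have hSz : MeasurableSet {u | (u, z) ∈ S} := measurable_prodMk_right hS
  have h1 : ∫⁻ u, (S.indicator w) (u, z) ∂Λ = condTime P true z {u | (u, z) ∈ S} := by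
    rw [hz, withDensity_apply _ hSz, ← lintegral_indicator hSz]
    rfl
  rw [h1, condTime, Measure.map_apply measurable_fst hSz,
    Measure.restrict_apply (measurable_fst hSz), ← lintegral_indicator_one
      ((measurable_fst hSz).inter (measurableSet_snd_eq true))]
  rfl

lemma coreFacts_of_condTime {Θ : Set (Vec d)} {α : ℝ → Vec d → Vec k → ℝ} {θ : Vec d}
    (hθ : θ ∈ Θ) {Γ : ℝ → ℝ} {τ : ℝ≥0∞} (hcore : CoreConditions Θ α (covLaw P))
    (hΓ : IsTransformation Γ τ) (hτ : tau0 P ≤ τ)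
    (hcond : ∀ᵐ z ∂(covLaw P), condTime P true z = (stieltjes Γ τ).withDensity fun u =>
      ENNReal.ofReal (α (Γ u) θ z) * condObs P z {q | u ≤ q.1}) :
    CoreFacts P α θ Γ (stieltjes Γ τ) := by
  obtain ⟨Λ, hΛ⟩ : ∃ Λ, Λ = stieltjes Γ τ := ⟨_, rfl⟩
  have hsf : SFinite Λ := by rw [hΛ]; infer_instance
  have hna : NullSingletonClass Λ := by rw [hΛ]; exact nullSingletonClass_stieltjes hΓ
  have hmem : ∀ᵐ u ∂Λ, u ∈ timeIco τ ∧ 0 < u := by rw [hΛ]; exact ae_stieltjes_mem hΓ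
  have hΓm : AEMeasurable Γ Λ := by rw [hΛ]; exact aemeasurable_transformation hΓ
  rw [← hΛ] at hcond ⊢
  have ham := hcore.measurable θ hθ
  have hrate : ∀ x, Measurable (α x θ) := fun x =>
    ham.comp (f := fun z : Vec k => (x, z)) (by fun_prop)
  -- the joint density of the observed failures, with a measurable version of `Γ`
  obtain ⟨w, hw⟩ : ∃ w : ℝ × Vec k → ℝ≥0∞, w = fun q =>
      ENNReal.ofReal (α (hΓm.mk Γ q.1) θ q.2) * condObs P q.2 {r | q.1 ≤ r.1} := ⟨_, rfl⟩
  have hwm : Measurable w := by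
    rw [hw]
    refine Measurable.mul (Measurable.ennreal_ofReal ?_) measurable_condObs_le
    exact ham.comp (f := fun q : ℝ × Vec k => (hΓm.mk Γ q.1, q.2))
      ((hΓm.measurable_mk.comp measurable_fst).prodMk measurable_snd)
  have hQ : subLaw P true = (Λ.prod (covLaw P)).withDensity w := by
    refine subLaw_eq_withDensity hwm ?_
    filter_upwards [hcond] with z hz
    rw [hz]
    refine withDensity_congr_ae ?_
    filter_upwards [hΓm.ae_eq_mk] with u hu
    rw [hw, hu]
  obtain ⟨hfst, hfin, hker⟩ := withDensity_section_eq_condKernel hwm hQ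
  rw [fst_subLaw] at hfst hker
  have hpos : ∀ x, 0 ≤ x → ∀ᵐ z ∂(covLaw P), 0 < α x θ z := fun x hx => by
    filter_upwards [hcore.pos] with z hz using hz θ hθ x hx
  have hrisk_ac : ∀ u, riskCov P u ≪ covLaw P := fun u => by
    rw [riskCov_eq]; exact withDensity_absolutelyContinuous _ _
  have hM : ∀ u, Γ u = hΓm.mk Γ u →
      (riskCov P u).withDensity (fun z => ENNReal.ofReal (α (Γ u) θ z)) =
        (covLaw P).withDensity fun z => w (u, z) := by
    intro u hu
    rw [riskCov_eq, ← withDensity_mul _ ((Kernel.measurable_coe _ (measurableSet_le_fst u)))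
      (hrate _).ennreal_ofReal]
    congr 1
    ext z
    rw [Pi.mul_apply, hw, mul_comm, hu]
  have hs1 : ∀ u, u ∈ timeIco τ → Γ u = hΓm.mk Γ u →
      s P α θ Γ (fun _ _ => 1) u = (∫⁻ z, w (u, z) ∂(covLaw P)).toReal := by
    intro u hu hu'
    rw [s_eq_integral_riskCov (hrate _) aestronglyMeasurable_const]
    simp only [one_mul]
    rw [integral_eq_lintegral_of_nonneg_ae _ (hrate _).aestronglyMeasurable]
    · congr 1
      have := congrArg (fun m => m univ) (hM u hu')
      simpa using this
    · filter_upwards [(hrisk_ac u).ae_le (hpos _ (hΓ.nonneg hu))] with z hz using hz.le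
  have hs1' : ∀ᵐ u ∂Λ, ENNReal.ofReal (s P α θ Γ (fun _ _ => 1) u) =
      ∫⁻ z, w (u, z) ∂(covLaw P) := by
    filter_upwards [hmem, hΓm.ae_eq_mk, hfin] with u h1 h2 h3
    rw [hs1 u h1.1 h2, ENNReal.ofReal_toReal h3.ne]
  have hσm : Measurable fun u => ∫⁻ z, w (u, z) ∂(covLaw P) := hwm.lintegral_prod_right'
  have hEN : EN P = Λ.withDensity fun u => ENNReal.ofReal (s P α θ Γ (fun _ _ => 1) u) := by
    rw [hfst]
    exact withDensity_congr_ae (hs1'.mono fun u hu => hu.symm)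
  have hENΛ : EN P ≪ Λ := by rw [hEN]; exact withDensity_absolutelyContinuous _ _
  have hs1m : AEMeasurable (s P α θ Γ fun _ _ => 1) Λ := by
    refine hσm.ennreal_toReal.aemeasurable.congr ?_
    filter_upwards [hmem, hΓm.ae_eq_mk] with u h1 h2 using (hs1 u h1.1 h2).symm
  have hs1pos : ∀ᵐ u ∂(EN P), 0 < s P α θ Γ (fun _ _ => 1) u := by
    rw [hEN, ae_withDensity_iff' hs1m.ennreal_ofReal]
    filter_upwards with u hu
    exact ENNReal.ofReal_pos.1 (pos_iff_ne_zero.2 hu)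
  -- a lower bound for `s[1]` on `(0, t]`
  have hlow : ∀ t ∈ timeIco (tau0 P), ∃ c : ℝ≥0∞, 0 < c ∧ c ≠ ∞ ∧ ∀ᵐ u ∂(Λ.restrict (Ioc 0 t)),
      c ≤ ENNReal.ofReal (s P α θ Γ (fun _ _ => 1) u) := by
    intro t ht
    have htτ : t ∈ timeIco τ := ⟨ht.1, ht.2.trans_le hτ⟩
    obtain ⟨m, hm, hmz⟩ := exists_measurable_lower_bound (μ := covLaw P) ham (Γ t)
      (hΓ.nonneg htτ) (by
        filter_upwards [hcore.pos, hcore.smooth] with z hz hz2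
        refine ⟨?_, hz θ hθ⟩
        have h1 : ContinuousOn (fun x => Real.exp (Real.log (α x θ z))) (Ici 0) := by
          refine Real.continuous_exp.comp_continuousOn ?_
          exact hz2.continuousOn.comp (f := fun x : ℝ => (x, θ)) (by fun_prop)
            fun x hx => ⟨hx, hθ⟩
        exact h1.congr fun x hx => (Real.exp_log (hz θ hθ x hx)).symm)
    have hpt : P {p | t ≤ p.1} ≠ 0 := by
      obtain ⟨t', ht', htt'⟩ := lt_sSup_iff.1 ht.2
      refine (lt_of_lt_of_le ht' (measure_mono fun p hp => ?_)).ne'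
      exact ((ENNReal.ofReal_lt_ofReal_iff').1 (htt'.trans_le hp)).1.le
    have hc0 : ∫⁻ z, m z ∂(riskCov P t) ≠ 0 := by
      rw [Ne, lintegral_eq_zero_iff hm]
      intro h0
      have h1 : ∀ᵐ z ∂(riskCov P t), 0 < m z :=
        (hrisk_ac t).ae_le (hmz.mono fun z hz => hz.1)
      have h2 : ∀ᵐ z ∂(riskCov P t), False := by
        filter_upwards [h0, h1] with z hz1 hz2
        exact hz2.ne' hz1
      have h3 : riskCov P t = 0 := by simpa using h2
      have h4 : riskCov P t univ = 0 := by rw [h3]; rfl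
      rw [riskCov, Measure.map_apply (by fun_prop) MeasurableSet.univ, preimage_univ,
        Measure.restrict_apply_univ] at h4
      exact hpt h4
    refine ⟨min (∫⁻ z, m z ∂(riskCov P t)) 1, lt_min (pos_iff_ne_zero.2 hc0) one_pos,
      ((min_le_right _ _).trans_lt ENNReal.one_lt_top).ne, ?_⟩
    filter_upwards [ae_restrict_mem measurableSet_Ioc, ae_restrict_of_ae hmem,
      ae_restrict_of_ae hΓm.ae_eq_mk, ae_restrict_of_ae hs1'] with u hut h1 h2 h3
    rw [h3]
    refine (min_le_left _ _).trans ?_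
    have h4 := congrArg (fun m => m univ) (hM u h2)
    simp only [withDensity_apply _ MeasurableSet.univ, setLIntegral_univ] at h4
    rw [← h4]
    have h5 : riskCov P t ≤ riskCov P u := by
      refine Measure.map_mono (Measure.restrict_mono (fun p hp => hut.2.trans hp) le_rfl)
        (by fun_prop)
    refine (lintegral_mono' h5 le_rfl).trans (lintegral_mono_ae ?_)
    filter_upwards [(hrisk_ac u).ae_le hmz] with z hz
    exact hz.2 _ ⟨hΓ.nonneg h1.1, hΓ.monotoneOn h1.1 htτ hut.2⟩
  refine ⟨hna, hs1m, hEN, ?_, ?_, ?_, ?_, fun u => hrate _, ?_⟩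
  · intro t ht
    obtain ⟨c, hc0, -, hc⟩ := hlow t ht
    filter_upwards [hc] with u hu
    exact ENNReal.ofReal_pos.1 (hc0.trans_le hu)
  · intro t ht
    obtain ⟨c, hc0, hct, hc⟩ := hlow t ht
    have hc' : ∀ᵐ u ∂((EN P).restrict (Ioc 0 t)),
        c ≤ ENNReal.ofReal (s P α θ Γ (fun _ _ => 1) u) := by
      exact (hENΛ.restrict _).ae_le hc
    rw [C, withDensity_apply _ measurableSet_Ioc]
    have h1 : ∫⁻ u in Ioc 0 t, ENNReal.ofReal ((s P α θ Γ (fun _ _ => 1) u ^ 2)⁻¹) ∂(EN P) ≤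
        ∫⁻ u in Ioc 0 t, (c ^ 2)⁻¹ ∂(EN P) := by
      refine lintegral_mono_ae ?_
      filter_upwards [hc'] with u hu
      have hp := ENNReal.ofReal_pos.1 (hc0.trans_le hu)
      rw [ENNReal.ofReal_inv_of_pos (by positivity), ENNReal.inv_le_inv,
        ENNReal.ofReal_pow hp.le]
      gcongr
    refine h1.trans_lt ?_
    rw [setLIntegral_const]
    exact ENNReal.mul_lt_top (ENNReal.inv_lt_top.2 (pos_iff_ne_zero.2 (pow_ne_zero 2 hc0.ne')))
      (measure_lt_top _ _)
  · have h1 : ∀ᵐ u ∂(EN P), u ≠ (tau0 P).toReal :=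
      hENΛ.ae_le (measure_eq_zero_iff_ae_notMem.1 (measure_singleton _))
    filter_upwards [hENΛ.ae_le hmem, hs1pos, h1] with u hu hup hu'
    refine ⟨hu.2, hu.1.1, lt_of_le_of_ne ?_ fun h => ?_⟩
    · refine le_sSup ?_
      have h2 : P {p | u ≤ p.1} ≠ 0 := by
        intro h0
        rw [s, Measure.restrict_eq_zero.2 h0, integral_zero_measure] at hup
        exact lt_irrefl _ hup
      exact (pos_iff_ne_zero.2 h2).trans_le
        (measure_mono fun p hp => ENNReal.ofReal_le_ofReal hp)
    · rw [← h, ENNReal.toReal_ofReal hu.1.1] at hu'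
      exact hu' rfl
  · filter_upwards [hs1pos, hENΛ.ae_le hmem, hENΛ.ae_le hΓm.ae_eq_mk, hENΛ.ae_le hs1', hker]
      with u h1 h2 h3 h4 h5
    refine ⟨h1, (hrisk_ac u).ae_le (hpos _ (hΓ.nonneg h2.1)), ?_⟩
    rw [h4, hM u h3, h5]
  · have := aemeasurable_ellPrime hθ hcore hΓm (hmem.mono fun u hu => hΓ.nonneg hu.1)
    rw [hQ]
    exact (this.mono_ac (withDensity_absolutelyContinuous _ _)).aestronglyMeasurable

variable {Ω : Type*} [MeasurableSpace Ω] {Pr : Measure Ω} {T : Ω → ℝ≥0} {T' : Ω → ℝ≥0∞}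
  {Z : Ω → Vec k}

lemma tau0_obsLaw_le (hT : Measurable T) (hT' : Measurable T') (hZ : Measurable Z) :
    tau0 (obsLaw Pr T T' Z) ≤ tauF Pr T := by
  refine sSup_le_sSup fun t ht => ?_
  refine lt_of_lt_of_le (mem_ofPred_eq ▸ ht) ?_
  rw [obsLaw, Measure.map_apply (measurable_observation hT hT' hZ)
    (measurableSet_le measurable_const measurable_fst.ennreal_ofReal)]
  refine measure_mono fun ω hω => ?_
  have h1 : t ≤ ENNReal.ofReal (withdrawal T T' ω) := hω
  refine h1.trans (ENNReal.ofReal_toReal_le.trans (min_le_left _ _))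

lemma coreFacts_obsLaw [IsProbabilityMeasure Pr] (hT : Measurable T) (hT' : Measurable T')
    (hZ : Measurable Z) {Θ : Set (Vec d)} {α : ℝ → Vec d → Vec k → ℝ} {θ : Vec d} (hθ : θ ∈ Θ)
    {Γ : ℝ → ℝ} (hcore : CoreConditions Θ α (Pr.map Z))
    (hmodel : IsTransformationModel Pr T T' Z α θ Γ) (hΓ : IsTransformation Γ (tauF Pr T)) :
    CoreFacts (obsLaw Pr T T' Z) α θ Γ (stieltjes Γ (tauF Pr T)) :=
  coreFacts_of_condTime hθ (by rwa [covLaw_obsLaw hT hT' hZ]) hΓ (tau0_obsLaw_le hT hT' hZ)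
    (condTime_eq_withDensity hT hT' hZ hθ hcore hmodel hΓ)

lemma nullSingletonClass_condTime [IsProbabilityMeasure Pr] (hT : Measurable T)
    (hT' : Measurable T') (hZ : Measurable Z) {Θ : Set (Vec d)} {α : ℝ → Vec d → Vec k → ℝ}
    {θ : Vec d} (hθ : θ ∈ Θ) {Γ : ℝ → ℝ} (hcore : CoreConditions Θ α (Pr.map Z))
    (hmodel : IsTransformationModel Pr T T' Z α θ Γ) (hΓ : IsTransformation Γ (tauF Pr T)) :
    ∀ᵐ z ∂(covLaw (obsLaw Pr T T' Z)),
      NullSingletonClass (condTime (obsLaw Pr T T' Z) true z) := by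
  have hna := nullSingletonClass_stieltjes hΓ
  filter_upwards [condTime_eq_withDensity hT hT' hZ hθ hcore hmodel hΓ] with z hz
  refine ⟨fun u => ?_⟩
  rw [hz]
  exact withDensity_absolutelyContinuous _ _ (measure_singleton u)

end Facts

/-! ### Weighted embeddings of functions of time -/

section Weights

variable {X E : Type*} [MeasurableSpace X] [MeasurableSpace E]

lemma sq_integral_mul_le {μ : Measure E} {f g : E → ℝ} (hf : MemLp f 2 μ) (hg : MemLp g 2 μ) :
    (∫ z, f z * g z ∂μ) ^ 2 ≤ (∫ z, f z ^ 2 ∂μ) * ∫ z, g z ^ 2 ∂μ := by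
  have h := real_inner_mul_inner_self_le (hf.toLp f) (hg.toLp g)
  have e1 : ⟪hf.toLp f, hg.toLp g⟫_ℝ = ∫ z, f z * g z ∂μ := by
    rw [integral_inner_eq]
    refine integral_congr_ae ?_
    filter_upwards [hf.coeFn_toLp, hg.coeFn_toLp] with z h1 h2
    rw [h1, h2]
  rw [real_inner_self_eq_norm_sq, real_inner_self_eq_norm_sq, norm_sq_eq_integral,
    norm_sq_eq_integral, e1] at h
  rwa [sq]

/-- `m` is a weight with squared fibre norms `v`: then `φ ↦ m(u, z) φ(u)` embeds `L₂(v dν)`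
isometrically into `L₂(ν ⊗ η)`. -/
structure IsWeight (ν : Measure X) (η : Kernel X E) (m : X → E → ℝ) (v : X → ℝ) : Prop where
  aesm : AEStronglyMeasurable (fun q : X × E => m q.1 q.2) (ν ⊗ₘ η)
  memLp : ∀ᵐ u ∂ν, MemLp (m u) 2 (η u)
  norm_sq : ∀ᵐ u ∂ν, ∫ z, m u z ^ 2 ∂(η u) = v u

variable {ν : Measure X} {η : Kernel X E} {m : X → E → ℝ} {v : X → ℝ}

lemma IsWeight.nonneg (h : IsWeight ν η m v) : ∀ᵐ u ∂ν, 0 ≤ v u := by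
  filter_upwards [h.norm_sq] with u hu
  rw [← hu]
  exact integral_nonneg fun z => sq_nonneg _

lemma IsWeight.eq_zero (h : IsWeight ν η m v) :
    ∀ᵐ u ∂ν, v u = 0 → m u =ᵐ[η u] 0 := by
  filter_upwards [h.norm_sq, h.memLp] with u h1 h2 h0
  rw [h0, integral_eq_zero_iff_of_nonneg (fun z => sq_nonneg _) h2.integrable_sq] at h1
  filter_upwards [h1] with z hz using by simpa using hz

/-- Where the weight vanishes so does its pairing with `F`. -/
lemma IsWeight.mul_div_cancel (h : IsWeight ν η m v) (F : X × E → ℝ) :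
    ∀ᵐ u ∂ν, v u * ((∫ z, m u z * F (u, z) ∂(η u)) / v u) = ∫ z, m u z * F (u, z) ∂(η u) := by
  filter_upwards [h.eq_zero] with u hu
  by_cases h0 : v u = 0
  · rw [h0, zero_mul]
    refine (integral_eq_zero_of_ae ?_).symm
    filter_upwards [hu h0] with z hz
    rw [hz]
    simp
  · field_simp

variable [SFinite ν] [IsSFiniteKernel η]

lemma MemLp.ae_of_compProd {F : X × E → ℝ} (hF : MemLp F 2 (ν ⊗ₘ η)) :
    ∀ᵐ u ∂ν, MemLp (fun z => F (u, z)) 2 (η u) := by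
  have h1 := ((Measure.integrable_compProd_iff hF.integrable_sq.1).1 hF.integrable_sq).1
  have h2 : ∀ᵐ u ∂ν, AEStronglyMeasurable (fun z => F (u, z)) (η u) :=
    AEStronglyMeasurable.ae_of_compProd (f := fun u z => F (u, z)) hF.1
  filter_upwards [h1, h2] with u hu1 hu2
  exact (memLp_two_iff_integrable_sq hu2).2 hu1

lemma aestronglyMeasurable_integral_fibre {F : X × E → ℝ}
    (hF : AEStronglyMeasurable F (ν ⊗ₘ η)) :
    AEStronglyMeasurable (fun u => ∫ z, F (u, z) ∂(η u)) ν := by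
  have := AEStronglyMeasurable.integral_kernel_compProd
    (κ := Kernel.const Unit ν) (η := Kernel.prodMkLeft Unit η) (a := ()) hF
  simpa using this

lemma IsWeight.aemeasurable (h : IsWeight ν η m v) : AEMeasurable v ν :=
  (aestronglyMeasurable_integral_fibre (h.aesm.pow 2)).aemeasurable.congr h.norm_sq

/-- A property of almost every time with respect to `v dν` holds wherever the weight does not
vanish. -/
lemma IsWeight.ae_of_ae (h : IsWeight ν η m v) {pr : X → Prop}
    (hpr : ∀ᵐ u ∂(ν.withDensity fun u => ENNReal.ofReal (v u)), pr u) :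
    ∀ᵐ q ∂(ν ⊗ₘ η), m q.1 q.2 ≠ 0 → pr q.1 := by
  obtain ⟨N, hN, hNm, hN0⟩ := exists_measurable_superset_of_null (ae_iff.1 hpr)
  have h1 : ∀ᵐ u ∂(ν.withDensity fun u => ENNReal.ofReal (v u)), u ∉ N :=
    measure_eq_zero_iff_ae_notMem.1 hN0
  rw [ae_withDensity_iff' h.aemeasurable.ennreal_ofReal] at h1
  have hmk := h.aesm.ae_eq_mk
  have hset : MeasurableSet {q : X × E | q.1 ∈ N → h.aesm.mk _ q = 0} := by
    have := (hNm.preimage (measurable_fst (α := X) (β := E))).compl.union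
      (h.aesm.stronglyMeasurable_mk.measurable (measurableSet_singleton 0))
    convert this using 1
    ext q
    simp [imp_iff_not_or]
  have h2 : ∀ᵐ q ∂(ν ⊗ₘ η), q.1 ∈ N → h.aesm.mk _ q = 0 := by
    refine Measure.ae_compProd_of_ae_ae hset ?_
    filter_upwards [h1, h.nonneg, h.eq_zero, Measure.ae_ae_of_ae_compProd hmk]
      with u hu1 hu2 hu3 hu4
    by_cases hu : u ∈ N
    · have h0 : v u = 0 := by
        by_contra hne
        exact hu1 (ENNReal.ofReal_pos.2 (lt_of_le_of_ne hu2 (Ne.symm hne))).ne' hu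
      filter_upwards [hu3 h0, hu4] with z hz1 hz2 _
      rw [← hz2]
      exact hz1
    · exact ae_of_all _ fun z hz => absurd hz hu
  filter_upwards [h2, hmk] with q hq1 hq2 hne
  by_contra hnp
  exact hne (hq2.trans (hq1 (hN hnp)))

lemma IsWeight.congr_ae (h : IsWeight ν η m v) {φ φ' : X → ℝ}
    (hφ : φ =ᵐ[ν.withDensity fun u => ENNReal.ofReal (v u)] φ') :
    (fun q : X × E => m q.1 q.2 * φ q.1) =ᵐ[ν ⊗ₘ η] fun q => m q.1 q.2 * φ' q.1 := by
  filter_upwards [h.ae_of_ae hφ] with q hq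
  by_cases h0 : m q.1 q.2 = 0
  · rw [h0, zero_mul, zero_mul]
  · rw [hq h0]

lemma IsWeight.integrable_iff (h : IsWeight ν η m v) {f : X → ℝ} :
    Integrable f (ν.withDensity fun u => ENNReal.ofReal (v u)) ↔
      Integrable (fun u => v u * f u) ν := by
  rw [integrable_withDensity_iff_integrable_smul₀' h.aemeasurable.ennreal_ofReal
    (ae_of_all _ fun u => ENNReal.ofReal_lt_top)]
  refine integrable_congr ?_
  filter_upwards [h.nonneg] with u hu
  rw [ENNReal.toReal_ofReal hu, smul_eq_mul]

lemma IsWeight.integral_eq (h : IsWeight ν η m v) (f : X → ℝ) :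
    ∫ u, f u ∂(ν.withDensity fun u => ENNReal.ofReal (v u)) = ∫ u, v u * f u ∂ν := by
  rw [integral_withDensity_eq_integral_toReal_smul₀ h.aemeasurable.ennreal_ofReal
    (ae_of_all _ fun u => ENNReal.ofReal_lt_top)]
  refine integral_congr_ae ?_
  filter_upwards [h.nonneg] with u hu
  rw [ENNReal.toReal_ofReal hu, smul_eq_mul]

lemma IsWeight.memLp_mul (h : IsWeight ν η m v) {φ : X → ℝ}
    (hφ : MemLp φ 2 (ν.withDensity fun u => ENNReal.ofReal (v u))) :
    MemLp (fun q : X × E => m q.1 q.2 * φ q.1) 2 (ν ⊗ₘ η) := by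
  have hm : AEStronglyMeasurable (fun q : X × E => m q.1 q.2 * φ q.1) (ν ⊗ₘ η) := by
    have h1 : AEStronglyMeasurable (fun q : X × E => m q.1 q.2 * hφ.1.mk φ q.1) (ν ⊗ₘ η) :=
      h.aesm.mul (hφ.1.stronglyMeasurable_mk.comp_measurable measurable_fst).aestronglyMeasurable
    exact h1.congr (h.congr_ae hφ.1.ae_eq_mk.symm)
  rw [memLp_two_iff_integrable_sq hm, Measure.integrable_compProd_iff
    (f := fun q : X × E => (m q.1 q.2 * φ q.1) ^ 2) (hm.pow 2)]
  constructor
  · filter_upwards [h.memLp] with u hu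
    simp only [mul_pow]
    exact hu.integrable_sq.mul_const _
  · refine (h.integrable_iff.1 hφ.integrable_sq).congr ?_
    filter_upwards [h.norm_sq] with u hu
    simp only [mul_pow, norm_mul, norm_pow, Real.norm_eq_abs, sq_abs]
    rw [integral_mul_const, hu]

lemma integral_mul_weight {φ : X → ℝ} {F : X × E → ℝ} (hF : MemLp F 2 (ν ⊗ₘ η))
    (hφ : MemLp (fun q : X × E => m q.1 q.2 * φ q.1) 2 (ν ⊗ₘ η)) :
    ∫ q, F q * (m q.1 q.2 * φ q.1) ∂(ν ⊗ₘ η) = ∫ u, (∫ z, m u z * F (u, z) ∂(η u)) * φ u ∂ν := by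
  rw [Measure.integral_compProd (memLp_two_mul_integrable hF hφ)]
  refine integral_congr_ae (ae_of_all _ fun u => ?_)
  simp only
  rw [← integral_mul_const]
  refine integral_congr_ae (ae_of_all _ fun z => ?_)
  simp only
  ring

/-- The embedding `φ ↦ m(u, z) φ(u)`. -/
noncomputable def weightOp (h : IsWeight ν η m v) :
    Lp ℝ 2 (ν.withDensity fun u => ENNReal.ofReal (v u)) →L[ℝ] Lp ℝ 2 (ν ⊗ₘ η) :=
  LinearMap.mkContinuous
    { toFun := fun φ => (h.memLp_mul (Lp.memLp φ)).toLp _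
      map_add' := by
        intro φ ψ
        refine Lp.ext ?_
        refine (MemLp.coeFn_toLp _).trans (EventuallyEq.trans ?_ (Lp.coeFn_add _ _).symm)
        filter_upwards [h.congr_ae (Lp.coeFn_add φ ψ), (h.memLp_mul (Lp.memLp φ)).coeFn_toLp,
          (h.memLp_mul (Lp.memLp ψ)).coeFn_toLp] with q h1 h2 h3
        rw [Pi.add_apply, h1, h2, h3, Pi.add_apply, mul_add]
      map_smul' := by
        intro c φ
        refine Lp.ext ?_
        refine (MemLp.coeFn_toLp _).trans (EventuallyEq.trans ?_ (Lp.coeFn_smul _ _).symm)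
        filter_upwards [h.congr_ae (Lp.coeFn_smul c φ), (h.memLp_mul (Lp.memLp φ)).coeFn_toLp]
          with q h1 h2
        rw [Pi.smul_apply, RingHom.id_apply, h1, h2, Pi.smul_apply, smul_eq_mul, smul_eq_mul]
        ring }
    1
    (by
      intro φ
      rw [LinearMap.coe_mk, AddHom.coe_mk, one_mul, ← sq_le_sq₀ (norm_nonneg _) (norm_nonneg _),
        norm_sq_eq_integral, ← real_inner_self_eq_norm_sq, integral_inner_eq, h.integral_eq]
      refine le_of_eq ?_
      have := integral_mul_weight (h.memLp_mul (Lp.memLp φ)) (h.memLp_mul (Lp.memLp φ))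
      simp only [← sq] at this
      rw [this]
      refine integral_congr_ae ?_
      filter_upwards [h.norm_sq] with u hu
      simp only [← mul_assoc, ← sq]
      rw [integral_mul_const, hu]
      ring)

lemma weightOp_coeFn (h : IsWeight ν η m v)
    (φ : Lp ℝ 2 (ν.withDensity fun u => ENNReal.ofReal (v u))) :
    weightOp h φ =ᵐ[ν ⊗ₘ η] fun q => m q.1 q.2 * φ q.1 :=
  (h.memLp_mul (Lp.memLp φ)).coeFn_toLp

lemma inner_weightOp (h : IsWeight ν η m v) (F : Lp ℝ 2 (ν ⊗ₘ η))
    (φ : Lp ℝ 2 (ν.withDensity fun u => ENNReal.ofReal (v u))) :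
    ⟪F, weightOp h φ⟫_ℝ = ∫ u, (∫ z, m u z * F (u, z) ∂(η u)) * φ u ∂ν := by
  rw [integral_inner_eq, ← integral_mul_weight (Lp.memLp F) (h.memLp_mul (Lp.memLp φ))]
  refine integral_congr_ae ?_
  filter_upwards [weightOp_coeFn h φ] with q hq
  rw [hq]

lemma inner_weightOp_weightOp (h : IsWeight ν η m v)
    {m' : X → E → ℝ} {v' : X → ℝ} (h' : IsWeight ν η m' v')
    (φ : Lp ℝ 2 (ν.withDensity fun u => ENNReal.ofReal (v u)))
    (φ' : Lp ℝ 2 (ν.withDensity fun u => ENNReal.ofReal (v' u))) :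
    ⟪weightOp h φ, weightOp h' φ'⟫_ℝ =
      ∫ u, (∫ z, m u z * m' u z ∂(η u)) * (φ u * φ' u) ∂ν := by
  rw [inner_weightOp]
  refine integral_congr_ae ?_
  filter_upwards [Measure.ae_ae_of_ae_compProd (weightOp_coeFn h φ)] with u hu
  have : ∫ z, m' u z * weightOp h φ (u, z) ∂(η u) = (∫ z, m u z * m' u z ∂(η u)) * φ u := by
    rw [← integral_mul_const]
    refine integral_congr_ae ?_
    filter_upwards [hu] with z hz
    rw [hz]
    ring
  rw [this, mul_assoc]

lemma inner_weightOp_self (h : IsWeight ν η m v)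
    (φ φ' : Lp ℝ 2 (ν.withDensity fun u => ENNReal.ofReal (v u))) :
    ⟪weightOp h φ, weightOp h φ'⟫_ℝ = ⟪φ, φ'⟫_ℝ := by
  rw [inner_weightOp_weightOp, integral_inner_eq, h.integral_eq]
  refine integral_congr_ae ?_
  filter_upwards [h.norm_sq] with u hu
  simp only [← sq]
  rw [hu]

lemma inner_weightOp_of_orthogonal (h : IsWeight ν η m v)
    {m' : X → E → ℝ} {v' : X → ℝ} (h' : IsWeight ν η m' v')
    (ho : ∀ᵐ u ∂ν, ∫ z, m u z * m' u z ∂(η u) = 0)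
    (φ : Lp ℝ 2 (ν.withDensity fun u => ENNReal.ofReal (v u)))
    (φ' : Lp ℝ 2 (ν.withDensity fun u => ENNReal.ofReal (v' u))) :
    ⟪weightOp h φ, weightOp h' φ'⟫_ℝ = 0 := by
  rw [inner_weightOp_weightOp]
  refine integral_eq_zero_of_ae ?_
  filter_upwards [ho] with u hu
  rw [hu, zero_mul]
  rfl

lemma IsWeight.memLp_adjoint (h : IsWeight ν η m v) {F : X × E → ℝ} (hF : MemLp F 2 (ν ⊗ₘ η)) :
    MemLp (fun u => (∫ z, m u z * F (u, z) ∂(η u)) / v u) 2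
      (ν.withDensity fun u => ENNReal.ofReal (v u)) := by
  have hm : AEStronglyMeasurable (fun u => (∫ z, m u z * F (u, z) ∂(η u)) / v u) ν :=
    ((aestronglyMeasurable_integral_fibre (h.aesm.mul hF.1)).aemeasurable.div
      h.aemeasurable).aestronglyMeasurable
  rw [memLp_two_iff_integrable_sq (hm.mono_ac (withDensity_absolutelyContinuous _ _)),
    h.integrable_iff]
  have hF2 := ((Measure.integrable_compProd_iff hF.integrable_sq.1).1 hF.integrable_sq).2
  refine hF2.mono' (h.aemeasurable.aestronglyMeasurable.mul (hm.pow 2)) ?_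
  filter_upwards [h.norm_sq, h.memLp, h.nonneg, MemLp.ae_of_compProd hF] with u h1 h2 h3 h4
  have hcs := sq_integral_mul_le h2 h4
  rw [h1] at hcs
  simp only [norm_pow, Real.norm_eq_abs, sq_abs]
  rw [abs_of_nonneg (mul_nonneg h3 (sq_nonneg _)), div_pow]
  rcases h3.eq_or_lt with h0 | hpos
  · rw [← h0, zero_mul]
    exact integral_nonneg fun z => sq_nonneg _
  · rw [mul_div_assoc', div_le_iff₀ (by positivity)]
    nlinarith

lemma adjoint_weightOp_coeFn (h : IsWeight ν η m v) (F : Lp ℝ 2 (ν ⊗ₘ η)) :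
    ContinuousLinearMap.adjoint (weightOp h) F =ᵐ[ν.withDensity fun u => ENNReal.ofReal (v u)]
      fun u => (∫ z, m u z * F (u, z) ∂(η u)) / v u := by
  have key :
      ContinuousLinearMap.adjoint (weightOp h) F = (h.memLp_adjoint (Lp.memLp F)).toLp _ := by
    refine ext_inner_right ℝ fun φ => ?_
    rw [ContinuousLinearMap.adjoint_inner_left, inner_weightOp, integral_inner_eq]
    have h1 : ∫ u, (h.memLp_adjoint (Lp.memLp F)).toLp _ u * φ u
        ∂(ν.withDensity fun u => ENNReal.ofReal (v u)) =
        ∫ u, ((∫ z, m u z * F (u, z) ∂(η u)) / v u) * φ u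
          ∂(ν.withDensity fun u => ENNReal.ofReal (v u)) := by
      refine integral_congr_ae ?_
      filter_upwards [(h.memLp_adjoint (Lp.memLp F)).coeFn_toLp] with u hu
      rw [hu]
    rw [h1, h.integral_eq]
    refine integral_congr_ae ?_
    filter_upwards [h.mul_div_cancel F] with u hu
    rw [← mul_assoc, hu]
  rw [key]
  exact MemLp.coeFn_toLp _

end Weights

/-! ### The functionals as conditional moments -/

section Moments

variable {d k : ℕ} {P : Measure (Obs k)} {α : ℝ → Vec d → Vec k → ℝ} {θ : Vec d} {Γ : ℝ → ℝ}

lemma C_absolutelyContinuous : C P α θ Γ ≪ EN P := withDensity_absolutelyContinuous _ _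

lemma B_absolutelyContinuous : B P α θ Γ ≪ EN P := withDensity_absolutelyContinuous _ _

variable [IsFiniteMeasure P] {Λ : Measure ℝ}

/-- The conditional law of the covariate given a failure at time `u`. -/
noncomputable abbrev failCov (P : Measure (Obs k)) [IsFiniteMeasure P] : Kernel ℝ (Vec k) :=
  (subLaw P true).condKernel

lemma compProd_failCov : EN P ⊗ₘ failCov P = subLaw P true := by
  rw [← fst_subLaw]
  exact (subLaw P true).disintegrate _

instance : SFinite (C P α θ Γ) := by unfold C; infer_instance

instance : SFinite (B P α θ Γ) := by unfold B; infer_instance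

namespace CoreFacts

variable (hc : CoreFacts P α θ Γ Λ)
include hc

lemma EN_absolutelyContinuous : EN P ≪ Λ := by
  rw [hc.EN_eq]; exact withDensity_absolutelyContinuous _ _

lemma nullSingletonClass_C : NullSingletonClass (C P α θ Γ) := by
  have := hc.nullSingleton
  exact ⟨fun u => C_absolutelyContinuous (hc.EN_absolutelyContinuous (measure_singleton u))⟩

lemma nullSingletonClass_B : NullSingletonClass (B P α θ Γ) := by
  have := hc.nullSingleton
  exact ⟨fun u => B_absolutelyContinuous (hc.EN_absolutelyContinuous (measure_singleton u))⟩

lemma aestronglyMeasurable_riskCov :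
    ∀ᵐ u ∂(EN P), ∀ g : Vec k → ℝ, AEStronglyMeasurable g (failCov P u) →
      AEStronglyMeasurable g (riskCov P u) := by
  filter_upwards [hc.risk] with u hu g hg
  have h1 : AEStronglyMeasurable g
      ((riskCov P u).withDensity fun z => ENNReal.ofReal (α (Γ u) θ z)) := by
    rw [hu.2.2]; exact hg.smul_measure _
  refine h1.mono_ac (withDensity_absolutelyContinuous'
    (hc.measurable_rate _).ennreal_ofReal.aemeasurable ?_)
  filter_upwards [hu.2.1] with z hz using (ENNReal.ofReal_pos.2 hz).ne'

/-- `e[f](u)` is the conditional mean of `f(u, Z)` given a failure at `u`. -/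
lemma ae_s_eq : ∀ᵐ u ∂(EN P), ∀ f : ℝ → Vec k → ℝ, AEStronglyMeasurable (f u) (failCov P u) →
    s P α θ Γ f u = s P α θ Γ (fun _ _ => 1) u * ∫ z, f u z ∂(failCov P u) := by
  filter_upwards [hc.risk, hc.aestronglyMeasurable_riskCov] with u hu hm f hf
  have h1 : ∫ z, f u z ∂((riskCov P u).withDensity fun z => ENNReal.ofReal (α (Γ u) θ z)) =
      ∫ z, f u z * α (Γ u) θ z ∂(riskCov P u) := by
    rw [integral_withDensity_eq_integral_toReal_smul₀
      (hc.measurable_rate _).ennreal_ofReal.aemeasurable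
      (ae_of_all _ fun z => ENNReal.ofReal_lt_top)]
    refine integral_congr_ae ?_
    filter_upwards [hu.2.1] with z hz
    rw [ENNReal.toReal_ofReal hz.le, smul_eq_mul, mul_comm]
  rw [s_eq_integral_riskCov (hc.measurable_rate _) (hm _ hf), ← h1, hu.2.2, integral_smul_measure,
    ENNReal.toReal_ofReal hu.1.le, smul_eq_mul]

lemma ae_e_eq : ∀ᵐ u ∂(EN P), ∀ f : ℝ → Vec k → ℝ, AEStronglyMeasurable (f u) (failCov P u) →
    e P α θ Γ f u = ∫ z, f u z ∂(failCov P u) := by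
  filter_upwards [hc.ae_s_eq, hc.risk] with u hu hu' f hf
  rw [e, hu f hf, mul_div_assoc, mul_div_cancel₀ _ hu'.1.ne']

lemma ae_aesm_ell : ∀ᵐ u ∂(EN P), AEStronglyMeasurable (ellPrime α θ Γ u) (failCov P u) := by
  have h := hc.aestronglyMeasurable_ell
  rw [← compProd_failCov] at h
  exact AEStronglyMeasurable.ae_of_compProd (f := fun u z => ellPrime α θ Γ u z) h

lemma ae_memLp_ell (hI : IntegrabilityCondition P α θ Γ) :
    ∀ᵐ u ∂(EN P), MemLp (ellPrime α θ Γ u) 2 (failCov P u) := by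
  filter_upwards [hc.risk, hc.ae_aesm_ell, hI.var_finite, hc.aestronglyMeasurable_riskCov]
    with u hu h1 h2 h3
  rw [memLp_two_iff_integrable_sq h1]
  have h4 : Integrable (fun z => ellPrime α θ Γ u z ^ 2 * α (Γ u) θ z) (riskCov P u) := by
    refine (integrable_map_measure (f := fun p : Obs k => p.2.2) ?_ (by fun_prop)).2 h2
    exact ((h3 _ h1).pow 2).mul (hc.measurable_rate _).aestronglyMeasurable
  have h5 : Integrable (fun z => ellPrime α θ Γ u z ^ 2)
      ((riskCov P u).withDensity fun z => ENNReal.ofReal (α (Γ u) θ z)) := by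
    rw [integrable_withDensity_iff_integrable_smul₀'
      (hc.measurable_rate _).ennreal_ofReal.aemeasurable
      (ae_of_all _ fun z => ENNReal.ofReal_lt_top)]
    refine h4.congr ?_
    filter_upwards [hu.2.1] with z hz
    rw [ENNReal.toReal_ofReal hz.le, smul_eq_mul, mul_comm]
  rw [hu.2.2] at h5
  exact (integrable_smul_measure (ENNReal.ofReal_pos.2 hu.1).ne' ENNReal.ofReal_ne_top).1 h5

/-- `cov[f, ℓ']` is a conditional covariance. -/
lemma ae_cov_eq (hI : IntegrabilityCondition P α θ Γ) : ∀ᵐ u ∂(EN P), ∀ f : ℝ → Vec k → ℝ,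
    MemLp (f u) 2 (failCov P u) → cov P α θ Γ f (ellPrime α θ Γ) u =
      ∫ z, (ellPrime α θ Γ u z - e P α θ Γ (ellPrime α θ Γ) u) * f u z ∂(failCov P u) := by
  filter_upwards [hc.ae_e_eq, hc.ae_memLp_ell hI] with u he hl f hf
  have h1 : Integrable (fun z => f u z * ellPrime α θ Γ u z) (failCov P u) :=
    memLp_two_mul_integrable hf hl
  rw [cov, he (fun t z => f t z * ellPrime α θ Γ t z) h1.1, he f hf.1, mul_comm (∫ z, f u z ∂_),
    ← integral_const_mul, ← integral_sub h1 ((hf.integrable (by norm_num)).const_mul _)]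
  refine integral_congr_ae (ae_of_all _ fun z => ?_)
  simp only
  ring

lemma isWeight_one : IsWeight (EN P) (failCov P)
    (fun u _ => (s P α θ Γ (fun _ _ => 1) u)⁻¹) fun u => (s P α θ Γ (fun _ _ => 1) u ^ 2)⁻¹ := by
  have hm : AEMeasurable (s P α θ Γ fun _ _ => 1) (EN P) :=
    hc.aemeasurable_s_one.mono_ac hc.EN_absolutelyContinuous
  refine ⟨?_, ae_of_all _ fun u => memLp_const _, ae_of_all _ fun u => ?_⟩
  · rw [compProd_failCov]
    rw [← fst_subLaw] at hm
    exact (hm.inv.comp_measurable measurable_fst).aestronglyMeasurable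
  · rw [integral_const, probReal_univ, one_smul, inv_pow]

lemma isWeight_ell (hI : IntegrabilityCondition P α θ Γ) : IsWeight (EN P) (failCov P)
    (fun u z => ellPrime α θ Γ u z - e P α θ Γ (ellPrime α θ Γ) u) (varEll P α θ Γ) := by
  have hl := hc.aestronglyMeasurable_ell
  rw [← compProd_failCov] at hl
  refine ⟨hl.sub ?_, ?_, ?_⟩
  · have h1 : AEStronglyMeasurable (e P α θ Γ (ellPrime α θ Γ)) (EN P) := by
      refine (aestronglyMeasurable_integral_fibre hl).congr ?_
      filter_upwards [hc.ae_e_eq, hc.ae_aesm_ell] with u h1 h2 using (h1 _ h2).symm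
    rw [compProd_failCov]
    rw [← fst_subLaw] at h1
    exact h1.comp_measurable measurable_fst
  · filter_upwards [hc.ae_memLp_ell hI] with u hu using hu.sub (memLp_const _)
  · filter_upwards [hc.ae_memLp_ell hI, hc.ae_cov_eq hI, hc.ae_e_eq] with u hu h1 h2
    rw [varEll, h1 _ hu]
    have hi : Integrable (fun z => (ellPrime α θ Γ u z - e P α θ Γ (ellPrime α θ Γ) u) *
        ellPrime α θ Γ u z) (failCov P u) :=
      memLp_two_mul_integrable (hu.sub (memLp_const _)) hu
    have hi' : Integrable (ellPrime α θ Γ u) (failCov P u) := hu.integrable (by norm_num)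
    have h0 : ∫ z, (ellPrime α θ Γ u z - e P α θ Γ (ellPrime α θ Γ) u) *
        e P α θ Γ (ellPrime α θ Γ) u ∂(failCov P u) = 0 := by
      rw [integral_mul_const, integral_sub hi' (integrable_const _), h2 _ hu.1, integral_const,
        probReal_univ, one_smul, sub_self, zero_mul]
    rw [← sub_zero (∫ z, (_ * ellPrime α θ Γ u z) ∂_), ← h0,
      ← integral_sub (g := fun z => (ellPrime α θ Γ u z - e P α θ Γ (ellPrime α θ Γ) u) *
        e P α θ Γ (ellPrime α θ Γ) u) hi ((hi'.sub (integrable_const _)).mul_const _)]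
    refine integral_congr_ae (ae_of_all _ fun z => ?_)
    simp only
    ring

lemma weights_orthogonal (hI : IntegrabilityCondition P α θ Γ) : ∀ᵐ u ∂(EN P),
    ∫ z, (s P α θ Γ (fun _ _ => 1) u)⁻¹ *
      (ellPrime α θ Γ u z - e P α θ Γ (ellPrime α θ Γ) u) ∂(failCov P u) = 0 := by
  filter_upwards [hc.ae_memLp_ell hI, hc.ae_e_eq] with u hu h2
  rw [integral_const_mul, integral_sub (hu.integrable (by norm_num)) (integrable_const _),
    h2 _ hu.1, integral_const, probReal_univ, one_smul, sub_self, mul_zero]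

lemma C_eq_withDensity : C P α θ Γ =
    Λ.withDensity fun u => ENNReal.ofReal (s P α θ Γ (fun _ _ => 1) u)⁻¹ := by
  have hm : AEMeasurable (fun u => ENNReal.ofReal (s P α θ Γ (fun _ _ => 1) u ^ 2)⁻¹) Λ :=
    (hc.aemeasurable_s_one.pow_const 2).inv.ennreal_ofReal
  rw [C]
  conv_lhs => rw [hc.EN_eq]
  rw [← withDensity_mul₀ hc.aemeasurable_s_one.ennreal_ofReal hm]
  congr 1
  ext u
  rw [Pi.mul_apply]
  rcases le_or_gt (s P α θ Γ (fun _ _ => 1) u) 0 with h | h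
  · rw [ENNReal.ofReal_of_nonpos h, ENNReal.ofReal_of_nonpos (inv_nonpos.2 h), zero_mul]
  · rw [← ENNReal.ofReal_mul h.le]
    congr 1
    field_simp

lemma integrableOn_C_iff {t : ℝ} (ht : t ∈ timeIco (tau0 P)) {y : ℝ → ℝ} :
    IntegrableOn y (Ioc 0 t) (C P α θ Γ) ↔
      IntegrableOn (fun u => (s P α θ Γ (fun _ _ => 1) u)⁻¹ * y u) (Ioc 0 t) Λ := by
  have hm : AEMeasurable (fun u => ENNReal.ofReal (s P α θ Γ (fun _ _ => 1) u)⁻¹)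
      (Λ.restrict (Ioc 0 t)) :=
    hc.aemeasurable_s_one.inv.ennreal_ofReal.mono_measure Measure.restrict_le_self
  rw [IntegrableOn, hc.C_eq_withDensity, restrict_withDensity measurableSet_Ioc,
    integrable_withDensity_iff_integrable_smul₀' hm (ae_of_all _ fun u => ENNReal.ofReal_lt_top)]
  refine integrable_congr ?_
  filter_upwards [hc.s_one_pos t ht] with u hu
  rw [ENNReal.toReal_ofReal (inv_pos.2 hu).le, smul_eq_mul]

lemma setIntegral_C {t : ℝ} (ht : t ∈ timeIco (tau0 P)) (y : ℝ → ℝ) :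
    ∫ u in Ioc 0 t, y u ∂(C P α θ Γ) =
      ∫ u in Ioc 0 t, (s P α θ Γ (fun _ _ => 1) u)⁻¹ * y u ∂Λ := by
  have hm : AEMeasurable (fun u => ENNReal.ofReal (s P α θ Γ (fun _ _ => 1) u)⁻¹)
      (Λ.restrict (Ioc 0 t)) :=
    hc.aemeasurable_s_one.inv.ennreal_ofReal.mono_measure Measure.restrict_le_self
  rw [hc.C_eq_withDensity, restrict_withDensity measurableSet_Ioc,
    integral_withDensity_eq_integral_toReal_smul₀ hm (ae_of_all _ fun u => ENNReal.ofReal_lt_top)]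
  refine integral_congr_ae ?_
  filter_upwards [hc.s_one_pos t ht] with u hu
  rw [ENNReal.toReal_ofReal (inv_pos.2 hu).le, smul_eq_mul]

end CoreFacts

end Moments

/-! ### The Fredholm equation as a normal equation -/

section Fredholm

variable {d k : ℕ}

open Classical in
/-- The Volterra kernel `1(0 < u ≤ t < τ₀) 𝒫(u, t)`; its integral operator `V` from `L₂(C)` to
`L₂(B)` is Hilbert–Schmidt with squared norm `κ(τ₀)`, and `K` is the kernel of `V V*`. -/
noncomputable def volterra (P : Measure (Obs k)) (α : ℝ → Vec d → Vec k → ℝ) (θ : Vec d)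
    (Γ : ℝ → ℝ) (t u : ℝ) : ℝ :=
  if 0 < u ∧ u ≤ t ∧ t ∈ timeIco (tau0 P) then prodInt P α θ Γ u t else 0

variable {P : Measure (Obs k)} {α : ℝ → Vec d → Vec k → ℝ} {θ : Vec d} {Γ : ℝ → ℝ}

lemma integral_volterra {t : ℝ} (ht : t ∈ timeIco (tau0 P)) (h : ℝ → ℝ) :
    ∫ u, volterra P α θ Γ t u * h u ∂(C P α θ Γ) =
      ∫ u in Ioc 0 t, prodInt P α θ Γ u t * h u ∂(C P α θ Γ) := by
  rw [← integral_indicator measurableSet_Ioc]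
  refine integral_congr_ae (ae_of_all _ fun u => ?_)
  by_cases hu : u ∈ Ioc 0 t
  · simp [volterra, hu.1, hu.2, ht]
  · rw [indicator_of_notMem hu]
    have : ¬ (0 < u ∧ u ≤ t ∧ t ∈ timeIco (tau0 P)) := fun h => hu ⟨h.1, h.2.1⟩
    simp [volterra, this]

lemma integral_volterra_mul_volterra {t t' : ℝ} (ht : t ∈ timeIco (tau0 P))
    (ht' : t' ∈ timeIco (tau0 P)) :
    ∫ u, volterra P α θ Γ t u * volterra P α θ Γ t' u ∂(C P α θ Γ) = K P α θ Γ t t' := by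
  rw [K, ← integral_indicator measurableSet_Ioc]
  refine integral_congr_ae (ae_of_all _ fun u => ?_)
  by_cases hu : u ∈ Ioc 0 (min t t')
  · have h1 := le_min_iff.1 hu.2
    simp [volterra, hu.1, h1.1, h1.2, ht, ht']
  · rw [indicator_of_notMem hu]
    have : ¬ (0 < u ∧ u ≤ t) ∨ ¬ (0 < u ∧ u ≤ t') := by
      by_contra! h
      exact hu ⟨h.1.1, le_min h.1.2 h.2.2⟩
    rcases this with h | h
    · have : ¬ (0 < u ∧ u ≤ t ∧ t ∈ timeIco (tau0 P)) := fun h' => h ⟨h'.1, h'.2.1⟩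
      simp [volterra, this]
    · have : ¬ (0 < u ∧ u ≤ t' ∧ t' ∈ timeIco (tau0 P)) := fun h' => h ⟨h'.1, h'.2.1⟩
      simp [volterra, this]

variable [IsFiniteMeasure P] {Λ : Measure ℝ}

namespace CoreFacts

variable (hc : CoreFacts P α θ Γ Λ) (hI : IntegrabilityCondition P α θ Γ)
include hc

lemma ae_B_mem : ∀ᵐ t ∂(B P α θ Γ), 0 < t ∧ t ∈ timeIco (tau0 P) :=
  B_absolutelyContinuous.ae_le hc.carrier

lemma ae_C_mem : ∀ᵐ t ∂(C P α θ Γ), 0 < t ∧ t ∈ timeIco (tau0 P) :=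
  C_absolutelyContinuous.ae_le hc.carrier

lemma restrict_timeIoc_EN : (EN P).restrict (timeIoc 0 (tau0 P)) = EN P :=
  Measure.restrict_eq_self_of_ae_mem (hc.carrier.mono fun _ hu => ⟨hu.1, hu.2.2.le⟩)

lemma restrict_timeIoc_B : (B P α θ Γ).restrict (timeIoc 0 (tau0 P)) = B P α θ Γ :=
  Measure.restrict_eq_self_of_ae_mem (hc.ae_B_mem.mono fun _ hu => ⟨hu.1, hu.2.2.le⟩)

lemma integral_volterra_swap {u : ℝ} (hu : 0 < u) (h : ℝ → ℝ) :
    ∫ v, volterra P α θ Γ v u * h v ∂(B P α θ Γ) =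
      ∫ v in timeIoc u (tau0 P), prodInt P α θ Γ u v * h v ∂(B P α θ Γ) := by
  have := hc.nullSingletonClass_B
  rw [← integral_indicator (measurableSet_timeIoc _ _)]
  refine integral_congr_ae ?_
  have hne : ∀ᵐ v ∂(B P α θ Γ), v ≠ u := measure_eq_zero_iff_ae_notMem.1 (measure_singleton u)
  filter_upwards [hc.ae_B_mem, hne] with v hv hvu
  by_cases huv : u < v
  · rw [indicator_of_mem (by exact ⟨huv, hv.2.2.le⟩)]
    simp [volterra, hu, huv.le, hv.2]
  · rw [indicator_of_notMem (fun h' => huv h'.1)]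
    have h1 : ¬ (0 < u ∧ u ≤ v ∧ v ∈ timeIco (tau0 P)) := fun h' =>
      huv (lt_of_le_of_ne h'.2.1 (Ne.symm hvu))
    simp [volterra, h1]

lemma aestronglyMeasurable_s_ell :
    AEStronglyMeasurable (s P α θ Γ (ellPrime α θ Γ)) (C P α θ Γ) := by
  have hl := hc.aestronglyMeasurable_ell
  rw [← compProd_failCov] at hl
  have h1 : AEStronglyMeasurable (s P α θ Γ (ellPrime α θ Γ)) (EN P) := by
    have hm : AEMeasurable (s P α θ Γ fun _ _ => 1) (EN P) :=
      hc.aemeasurable_s_one.mono_ac hc.EN_absolutelyContinuous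
    refine (hm.aestronglyMeasurable.mul (aestronglyMeasurable_integral_fibre hl)).congr ?_
    filter_upwards [hc.ae_s_eq, hc.ae_aesm_ell] with u h1 h2 using (h1 _ h2).symm
  exact h1.mono_ac C_absolutelyContinuous

include hI

lemma memLp_volterra : MemLp (fun p : ℝ × ℝ => volterra P α θ Γ p.1 p.2) 2
    ((B P α θ Γ).prod (C P α θ Γ)) := by
  have hS := hc.aestronglyMeasurable_s_ell
  obtain ⟨L, hL⟩ : ∃ L : ℝ → ℝ, L = fun r => ∫ v in Ioc 0 r, hS.mk _ v ∂(C P α θ Γ) := ⟨_, rfl⟩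
  have hLm : Measurable L := by
    have h1 : StronglyMeasurable fun p : ℝ × ℝ =>
        {p : ℝ × ℝ | 0 < p.2 ∧ p.2 ≤ p.1}.indicator (fun p => hS.mk _ p.2) p :=
      (hS.stronglyMeasurable_mk.comp_measurable measurable_snd).indicator
        ((measurableSet_lt measurable_const measurable_snd).inter
          (measurableSet_le measurable_snd measurable_fst))
    have h2 := h1.integral_prod_right' (ν := C P α θ Γ)
    convert h2.measurable using 1
    rw [hL]
    ext r
    rw [← integral_indicator measurableSet_Ioc]
    rfl
  have hL' : ∀ r, L r = ∫ v in Ioc 0 r, s P α θ Γ (ellPrime α θ Γ) v ∂(C P α θ Γ) := fun r => by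
    rw [hL]
    exact integral_congr_ae (ae_restrict_of_ae hS.ae_eq_mk.symm)
  have heq : (fun p : ℝ × ℝ => volterra P α θ Γ p.1 p.2) =
      {p : ℝ × ℝ | 0 < p.2 ∧ p.2 ≤ p.1 ∧ p.1 ∈ timeIco (tau0 P)}.indicator
        fun p => Real.exp (-L p.1) * Real.exp (L p.2) := by
    ext ⟨t, u⟩
    by_cases h : 0 < u ∧ u ≤ t ∧ t ∈ timeIco (tau0 P)
    · rw [indicator_of_mem (by exact h)]
      simp only [volterra, if_pos h]
      rw [prodInt, exp_neg_setIntegral_Ioc (hI.exponent t h.2.2) h.1.le h.2.1, hL', hL']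
    · rw [indicator_of_notMem (by exact h)]
      simp only [volterra, if_neg h]
  have hm : Measurable fun p : ℝ × ℝ => volterra P α θ Γ p.1 p.2 := by
    rw [heq]
    refine Measurable.indicator ?_ ?_
    · exact ((hLm.comp measurable_fst).neg.exp).mul (hLm.comp measurable_snd).exp
    · exact (measurableSet_lt measurable_const measurable_snd).inter
        ((measurableSet_le measurable_snd measurable_fst).inter
          (measurable_fst (measurableSet_timeIco _)))
  rw [memLp_two_iff_lintegral hm.aestronglyMeasurable,
    lintegral_prod _ (hm.enorm.pow_const 2).aemeasurable]
  refine lt_of_le_of_lt ?_ hI.kappa_lt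
  rw [kappa, ← lintegral_indicator (measurableSet_timeIoc _ _)]
  refine lintegral_mono fun t => ?_
  by_cases ht : 0 < t ∧ t ∈ timeIco (tau0 P)
  · rw [indicator_of_mem (by exact ⟨ht.1, ht.2.2.le⟩), ← lintegral_indicator measurableSet_Ioc]
    refine lintegral_mono fun u => ?_
    by_cases hu : u ∈ Ioc 0 t
    · rw [indicator_of_mem hu]
      simp only [volterra, if_pos (show 0 < u ∧ u ≤ t ∧ t ∈ timeIco (tau0 P) from
        ⟨hu.1, hu.2, ht.2⟩)]
      rw [prodInt, Real.enorm_eq_ofReal (Real.exp_pos _).le,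
        ENNReal.ofReal_pow (Real.exp_pos _).le]
    · have : ¬ (0 < u ∧ u ≤ t ∧ t ∈ timeIco (tau0 P)) := fun h => hu ⟨h.1, h.2.1⟩
      simp [volterra, this]
  · have : ∀ u, volterra P α θ Γ t u = 0 := fun u => by
      rw [volterra, if_neg]
      exact fun h => ht ⟨h.1.trans_le h.2.1, h.2.2⟩
    simp [this]

/-- The Volterra operator `V`. -/
noncomputable def volterraOp : Lp ℝ 2 (C P α θ Γ) →L[ℝ] Lp ℝ 2 (B P α θ Γ) :=
  hsOp (volterra P α θ Γ) (hc.memLp_volterra hI)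

/-- The embedding `φ ↦ (ℓ' - e[ℓ']) φ` of `L₂(B)` into `L₂(Q)`. -/
noncomputable def embEll : Lp ℝ 2 (B P α θ Γ) →L[ℝ] Lp ℝ 2 (EN P ⊗ₘ failCov P) :=
  weightOp (hc.isWeight_ell hI)

end CoreFacts

/-- The embedding `h ↦ h / s[1]` of `L₂(C)` into `L₂(Q)`. -/
noncomputable def CoreFacts.embOne (hc : CoreFacts P α θ Γ Λ) :
    Lp ℝ 2 (C P α θ Γ) →L[ℝ] Lp ℝ 2 (EN P ⊗ₘ failCov P) :=
  weightOp hc.isWeight_one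

namespace CoreFacts

open ContinuousLinearMap (adjoint)

variable (hc : CoreFacts P α θ Γ Λ) (hI : IntegrabilityCondition P α θ Γ)

lemma embOne_coeFn (h : Lp ℝ 2 (C P α θ Γ)) : hc.embOne h =ᵐ[EN P ⊗ₘ failCov P]
    fun q => (s P α θ Γ (fun _ _ => 1) q.1)⁻¹ * h q.1 :=
  weightOp_coeFn hc.isWeight_one h

lemma embEll_coeFn (φ : Lp ℝ 2 (B P α θ Γ)) : hc.embEll hI φ =ᵐ[EN P ⊗ₘ failCov P]
    fun q => (ellPrime α θ Γ q.1 q.2 - e P α θ Γ (ellPrime α θ Γ) q.1) * φ q.1 :=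
  weightOp_coeFn (hc.isWeight_ell hI) φ

lemma volterraOp_coeFn (h : Lp ℝ 2 (C P α θ Γ)) : hc.volterraOp hI h =ᵐ[B P α θ Γ]
    fun t => ∫ u in Ioc 0 t, prodInt P α θ Γ u t * h u ∂(C P α θ Γ) := by
  filter_upwards [hsOp_coeFn (volterra P α θ Γ) (hc.memLp_volterra hI) h, hc.ae_B_mem] with t h1 h2
  exact h1.trans (integral_volterra h2.2 _)

lemma adjoint_volterraOp_coeFn (φ : Lp ℝ 2 (B P α θ Γ)) :
    adjoint (hc.volterraOp hI) φ =ᵐ[C P α θ Γ]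
      fun u => ∫ v, volterra P α θ Γ v u * φ v ∂(B P α θ Γ) := by
  rw [volterraOp, hsOp_adjoint]
  exact hsOp_coeFn _ _ φ

/-- `J₁* f = s[f]`. -/
lemma adjoint_embOne_coeFn {f : ℝ → Vec k → ℝ} {F : Lp ℝ 2 (EN P ⊗ₘ failCov P)}
    (hF : F =ᵐ[EN P ⊗ₘ failCov P] fun q => f q.1 q.2) :
    adjoint hc.embOne F =ᵐ[C P α θ Γ] s P α θ Γ f := by
  have h1 : ∀ᵐ u ∂(EN P), (∫ z, (s P α θ Γ (fun _ _ => 1) u)⁻¹ * F (u, z) ∂(failCov P u)) /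
      (s P α θ Γ (fun _ _ => 1) u ^ 2)⁻¹ = s P α θ Γ f u := by
    filter_upwards [hc.ae_s_eq, hc.risk, Measure.ae_ae_of_ae_compProd hF,
      MemLp.ae_of_compProd (Lp.memLp F)] with u h1 h2 h3 h4
    have h5 : (fun z => F (u, z)) =ᵐ[failCov P u] f u := h3
    rw [h1 f (h4.1.congr h5), integral_const_mul, integral_congr_ae h5]
    have := h2.1.ne'
    field_simp
  filter_upwards [adjoint_weightOp_coeFn hc.isWeight_one F, C_absolutelyContinuous.ae_le h1]
    with u hu1 hu2
  exact hu1.trans hu2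

include hc hI

lemma ae_pairing_ell {f : ℝ → Vec k → ℝ} {F : Lp ℝ 2 (EN P ⊗ₘ failCov P)}
    (hF : F =ᵐ[EN P ⊗ₘ failCov P] fun q => f q.1 q.2) : ∀ᵐ u ∂(EN P),
    ∫ z, (ellPrime α θ Γ u z - e P α θ Γ (ellPrime α θ Γ) u) * F (u, z) ∂(failCov P u) =
      cov P α θ Γ f (ellPrime α θ Γ) u := by
  filter_upwards [hc.ae_cov_eq hI, Measure.ae_ae_of_ae_compProd hF,
    MemLp.ae_of_compProd (Lp.memLp F)] with u h1 h3 h4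
  have h5 : (fun z => F (u, z)) =ᵐ[failCov P u] f u := h3
  rw [h1 f (h4.ae_eq h5)]
  refine integral_congr_ae ?_
  filter_upwards [h5] with z hz
  rw [hz]

/-- `J₂* f = cov[f, ℓ'] / var[ℓ']`. -/
lemma adjoint_embEll_coeFn {f : ℝ → Vec k → ℝ} {F : Lp ℝ 2 (EN P ⊗ₘ failCov P)}
    (hF : F =ᵐ[EN P ⊗ₘ failCov P] fun q => f q.1 q.2) :
    adjoint (hc.embEll hI) F =ᵐ[B P α θ Γ]
      fun u => cov P α θ Γ f (ellPrime α θ Γ) u / varEll P α θ Γ u := by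
  filter_upwards [adjoint_weightOp_coeFn (hc.isWeight_ell hI) F,
    B_absolutelyContinuous.ae_le (hc.ae_pairing_ell hI hF)] with u hu1 hu2
  rw [← hu2]
  exact hu1

lemma integral_B (f : ℝ → ℝ) :
    ∫ u, f u ∂(B P α θ Γ) = ∫ u, varEll P α θ Γ u * f u ∂(EN P) :=
  (hc.isWeight_ell hI).integral_eq f

/-- `cov[f, ℓ']` vanishes with `var[ℓ']`. -/
lemma ae_var_mul_div {f : ℝ → Vec k → ℝ} {F : Lp ℝ 2 (EN P ⊗ₘ failCov P)}
    (hF : F =ᵐ[EN P ⊗ₘ failCov P] fun q => f q.1 q.2) : ∀ᵐ u ∂(EN P),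
    varEll P α θ Γ u * (cov P α θ Γ f (ellPrime α θ Γ) u / varEll P α θ Γ u) =
      cov P α θ Γ f (ellPrime α θ Γ) u := by
  filter_upwards [(hc.isWeight_ell hI).mul_div_cancel F, hc.ae_pairing_ell hI hF] with u h1 h2
  rwa [h2] at h1

/-- `V V*` has kernel `K`. -/
lemma volterraOp_adjoint_coeFn (φ : Lp ℝ 2 (B P α θ Γ)) :
    hc.volterraOp hI (adjoint (hc.volterraOp hI) φ) =ᵐ[B P α θ Γ]
      fun t => ∫ u, K P α θ Γ t u * φ u ∂(B P α θ Γ) := by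
  have hk := hc.memLp_volterra hI
  have hsec : ∀ᵐ t ∂(B P α θ Γ), MemLp (volterra P α θ Γ t) 2 (C P α θ Γ) := by
    have h1 := hk.integrable_sq.prod_right_ae
    filter_upwards [h1, hk.1.prodMk_left] with t ht1 ht2
    exact (memLp_two_iff_integrable_sq ht2).2 ht1
  filter_upwards [hsOp_coeFn (volterra P α θ Γ) hk (adjoint (hc.volterraOp hI) φ), hc.ae_B_mem,
    hsec] with t h1 h2 h3
  have hint : Integrable (fun p : ℝ × ℝ => (volterra P α θ Γ t p.1 * φ p.2) *
      volterra P α θ Γ p.2 p.1) ((C P α θ Γ).prod (B P α θ Γ)) :=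
    memLp_two_mul_integrable (memLp_tensor h3 (Lp.memLp φ)) (memLp_kernel_swap hk)
  calc hc.volterraOp hI (adjoint (hc.volterraOp hI) φ) t
      = ∫ v, volterra P α θ Γ t v * adjoint (hc.volterraOp hI) φ v ∂(C P α θ Γ) := h1
    _ = ∫ v, ∫ u, (volterra P α θ Γ t v * φ u) * volterra P α θ Γ u v
          ∂(B P α θ Γ) ∂(C P α θ Γ) := by
        refine integral_congr_ae ?_
        filter_upwards [hc.adjoint_volterraOp_coeFn hI φ] with v hv
        rw [hv, ← integral_const_mul]
        refine integral_congr_ae (ae_of_all _ fun u => ?_)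
        simp only
        ring
    _ = ∫ u, ∫ v, (volterra P α θ Γ t v * φ u) * volterra P α θ Γ u v
          ∂(C P α θ Γ) ∂(B P α θ Γ) := integral_integral_swap hint
    _ = _ := by
        refine integral_congr_ae ?_
        filter_upwards [hc.ae_B_mem] with u hu
        rw [← integral_volterra_mul_volterra h2.2 hu.2, ← integral_mul_const]
        refine integral_congr_ae (ae_of_all _ fun v => ?_)
        simp only
        ring

/-- The Fredholm equation is `φ = V (J₁* f + V* (J₂* f - φ))`. -/
lemma isFredholmSol_iff {f : ℝ → Vec k → ℝ} {F : Lp ℝ 2 (EN P ⊗ₘ failCov P)}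
    (hF : F =ᵐ[EN P ⊗ₘ failCov P] fun q => f q.1 q.2) {φ : ℝ → ℝ}
    (hφ : MemLp φ 2 (B P α θ Γ)) : IsFredholmSol P α θ Γ f φ ↔
      hφ.toLp φ = hc.volterraOp hI (adjoint hc.embOne F +
        adjoint (hc.volterraOp hI) (adjoint (hc.embEll hI) F - hφ.toLp φ)) := by
  obtain ⟨V, hV⟩ : ∃ V, V = hc.volterraOp hI := ⟨_, rfl⟩
  have hrhs :
      V (adjoint hc.embOne F + adjoint V (adjoint (hc.embEll hI) F - hφ.toLp φ)) =ᵐ[B P α θ Γ]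
      fun t => -D P α θ Γ f t
        - (∫ u in timeIoc 0 (tau0 P), K P α θ Γ t u * φ u ∂(B P α θ Γ))
        + ∫ u in timeIoc 0 (tau0 P), K P α θ Γ t u * cov P α θ Γ f (ellPrime α θ Γ) u ∂(EN P) := by
    have e1 : V (adjoint hc.embOne F + adjoint V (adjoint (hc.embEll hI) F - hφ.toLp φ)) =
        V (adjoint hc.embOne F) - V (adjoint V (hφ.toLp φ)) +
          V (adjoint V (adjoint (hc.embEll hI) F)) := by
      simp only [map_add, map_sub]
      abel
    rw [e1, hV, hc.restrict_timeIoc_B, hc.restrict_timeIoc_EN]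
    filter_upwards [Lp.coeFn_add (V (adjoint hc.embOne F) - V (adjoint V (hφ.toLp φ)))
      (V (adjoint V (adjoint (hc.embEll hI) F))),
      Lp.coeFn_sub (V (adjoint hc.embOne F)) (V (adjoint V (hφ.toLp φ))),
      hc.volterraOp_coeFn hI (adjoint hc.embOne F),
      hc.volterraOp_adjoint_coeFn hI (hφ.toLp φ),
      hc.volterraOp_adjoint_coeFn hI (adjoint (hc.embEll hI) F)] with t h1 h2 h3 h4 h5
    rw [hV] at h1 h2
    rw [h1, Pi.add_apply, h2, Pi.sub_apply, h3, h4, h5]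
    congr 1
    · congr 1
      · rw [D, neg_neg]
        refine integral_congr_ae (ae_restrict_of_ae ?_)
        filter_upwards [hc.adjoint_embOne_coeFn hF] with u hu
        rw [hu, mul_comm]
      · refine integral_congr_ae ?_
        filter_upwards [hφ.coeFn_toLp] with u hu
        rw [hu]
    · rw [hc.integral_B hI]
      have h6 : ∫ u, varEll P α θ Γ u * (K P α θ Γ t u *
          (cov P α θ Γ f (ellPrime α θ Γ) u / varEll P α θ Γ u)) ∂(EN P) =
          ∫ u, K P α θ Γ t u * cov P α θ Γ f (ellPrime α θ Γ) u ∂(EN P) := by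
        refine integral_congr_ae ?_
        filter_upwards [hc.ae_var_mul_div hI hF] with u hu
        rw [mul_left_comm, hu]
      rw [← h6, ← hc.integral_B hI, ← hc.integral_B hI]
      refine integral_congr_ae ?_
      filter_upwards [hc.adjoint_embEll_coeFn hI hF] with u hu
      rw [hu]
  rw [← hV, IsFredholmSol, and_iff_right hφ]
  constructor
  · intro h
    refine Lp.ext ?_
    filter_upwards [hφ.coeFn_toLp, h, hrhs] with t h1 h2 h3
    rw [h1, h2, h3]
  · intro h
    rw [← h] at hrhs
    filter_upwards [hφ.coeFn_toLp, hrhs] with t h1 h3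
    rw [← h1, h3]

/-- The Fredholm equation is uniquely solvable in `L₂(B)`. -/
lemma existsUnique_fredholm {f : ℝ → Vec k → ℝ}
    (hf : MemLp (fun q : ℝ × Vec k => f q.1 q.2) 2 (subLaw P true)) :
    (∃ φ, IsFredholmSol P α θ Γ f φ) ∧
      ∀ φ φ', IsFredholmSol P α θ Γ f φ → IsFredholmSol P α θ Γ f φ' → φ =ᵐ[B P α θ Γ] φ' := by
  rw [← compProd_failCov] at hf
  obtain ⟨V, hV⟩ : ∃ V, V = hc.volterraOp hI := ⟨_, rfl⟩
  have hiff : ∀ {φ : ℝ → ℝ} (hφ : MemLp φ 2 (B P α θ Γ)), IsFredholmSol P α θ Γ f φ ↔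
      hφ.toLp φ + V (adjoint V (hφ.toLp φ)) =
        V (adjoint hc.embOne (hf.toLp _) + adjoint V (adjoint (hc.embEll hI) (hf.toLp _))) := by
    intro φ hφ
    rw [hc.isFredholmSol_iff hI hf.coeFn_toLp hφ, ← hV]
    simp only [map_add, map_sub]
    rw [← add_sub_assoc, eq_sub_iff_add_eq]
  have hb := bijective_one_add_mul_adjoint V
  constructor
  · obtain ⟨φ, hφ⟩ := hb.2 (V (adjoint hc.embOne (hf.toLp _) +
      adjoint V (adjoint (hc.embEll hI) (hf.toLp _))))
    refine ⟨φ, (hiff (Lp.memLp φ)).2 ?_⟩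
    rw [Lp.toLp_coeFn]
    exact hφ
  · intro φ φ' h h'
    have h1 := (hiff h.1).1 h
    have h2 := (hiff h'.1).1 h'
    have h3 : h.1.toLp φ = h'.1.toLp φ' := hb.1 (h1.trans h2.symm)
    exact (MemLp.toLp_eq_toLp_iff _ _).1 h3

end CoreFacts

end Fredholm

/-! ### Directions of the transformation and the residual `W` -/

section Directions

variable {d k : ℕ} {P : Measure (Obs k)} [IsFiniteMeasure P] {α : ℝ → Vec d → Vec k → ℝ}
  {θ : Vec d} {Γ : ℝ → ℝ} {Λ : Measure ℝ} {τ : ℝ≥0∞}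

open ContinuousLinearMap (adjoint)

lemma ae_compProd_failCov_fst {pr : ℝ → Prop} (h : ∀ᵐ u ∂(EN P), pr u) :
    ∀ᵐ q ∂(EN P ⊗ₘ failCov P), pr q.1 := by
  rw [compProd_failCov]
  rw [← fst_subLaw] at h
  exact ae_of_ae_map measurable_fst.aemeasurable h

namespace CoreFacts

lemma EN_absolutelyContinuous_C (hc : CoreFacts P α θ Γ Λ) : EN P ≪ C P α θ Γ := by
  refine withDensity_absolutelyContinuous' ?_ ?_
  · exact hc.isWeight_one.aemeasurable.ennreal_ofReal
  · filter_upwards [hc.risk] with u hu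
    exact (ENNReal.ofReal_pos.2 (inv_pos.2 (pow_pos hu.1 2))).ne'

lemma setIntegral_B (hc : CoreFacts P α θ Γ Λ) (hI : IntegrabilityCondition P α θ Γ) {S : Set ℝ}
    (hS : MeasurableSet S) (f : ℝ → ℝ) :
    ∫ u in S, f u ∂(B P α θ Γ) = ∫ u in S, varEll P α θ Γ u * f u ∂(EN P) := by
  rw [← integral_indicator hS, hc.integral_B hI, ← integral_indicator hS]
  refine integral_congr_ae (ae_of_all _ fun u => ?_)
  by_cases hu : u ∈ S <;> simp [hu]

/-- `W` is the residual of `f` from the range of `J₁ + J₂ V`. -/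
lemma W_ae_eq (hc : CoreFacts P α θ Γ Λ) (hI : IntegrabilityCondition P α θ Γ)
    {f : ℝ → Vec k → ℝ} {F : Lp ℝ 2 (EN P ⊗ₘ failCov P)}
    (hF : F =ᵐ[EN P ⊗ₘ failCov P] fun q => f q.1 q.2) {φ : ℝ → ℝ}
    (hφ : MemLp φ 2 (B P α θ Γ)) :
    (F - hc.embOne (adjoint hc.embOne F + adjoint (hc.volterraOp hI)
        (adjoint (hc.embEll hI) F - hφ.toLp φ)) - hc.embEll hI (hφ.toLp φ) :
      Lp ℝ 2 (EN P ⊗ₘ failCov P)) =ᵐ[EN P ⊗ₘ failCov P] fun q => W P α θ Γ f φ q.1 q.2 := by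
  obtain ⟨ψ, hψ⟩ : ∃ ψ, ψ = adjoint (hc.embEll hI) F - hφ.toLp φ := ⟨_, rfl⟩
  obtain ⟨h, hh⟩ : ∃ h, h = adjoint hc.embOne F + adjoint (hc.volterraOp hI) ψ := ⟨_, rfl⟩
  rw [← hψ, ← hh]
  have hψ' : ∀ᵐ v ∂(B P α θ Γ),
      ψ v = cov P α θ Γ f (ellPrime α θ Γ) v / varEll P α θ Γ v - φ v := by
    filter_upwards [Lp.coeFn_sub (adjoint (hc.embEll hI) F) (hφ.toLp φ),
      hc.adjoint_embEll_coeFn hI hF, hφ.coeFn_toLp] with v h1 h2 h3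
    rw [hψ, h1, Pi.sub_apply, h2, h3]
  have hadj : ∀ u, 0 < u → ∫ v, volterra P α θ Γ v u * ψ v ∂(B P α θ Γ) =
      ∫ v in timeIoc u (tau0 P), prodInt P α θ Γ u v * rho P α θ Γ f φ v ∂(EN P) := by
    intro u hu
    rw [hc.integral_volterra_swap hu, integral_congr_ae (ae_restrict_of_ae
      (hψ'.mono fun v hv => by rw [hv])), hc.setIntegral_B hI (measurableSet_timeIoc _ _)]
    refine integral_congr_ae (ae_restrict_of_ae ?_)
    filter_upwards [hc.ae_var_mul_div hI hF] with v hv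
    have h1 : rho P α θ Γ f φ v = varEll P α θ Γ v *
        (cov P α θ Γ f (ellPrime α θ Γ) v / varEll P α θ Γ v) - φ v * varEll P α θ Γ v := by
      rw [rho, hv]
    rw [h1]
    ring
  have hh' : ∀ᵐ u ∂(EN P), h u = s P α θ Γ f u +
      ∫ v in timeIoc u (tau0 P), prodInt P α θ Γ u v * rho P α θ Γ f φ v ∂(EN P) := by
    refine hc.EN_absolutelyContinuous_C.ae_le ?_
    filter_upwards [Lp.coeFn_add (adjoint hc.embOne F) (adjoint (hc.volterraOp hI) ψ),
      hc.adjoint_embOne_coeFn hF, hc.adjoint_volterraOp_coeFn hI ψ, hc.ae_C_mem] with u h1 h2 h3 h4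
    rw [hh, h1, Pi.add_apply, h2, h3, hadj u h4.1]
  filter_upwards [Lp.coeFn_sub (F - hc.embOne h) (hc.embEll hI (hφ.toLp φ)),
    Lp.coeFn_sub F (hc.embOne h), hF, hc.embOne_coeFn h, hc.embEll_coeFn hI (hφ.toLp φ),
    (hc.isWeight_ell hI).congr_ae hφ.coeFn_toLp, ae_compProd_failCov_fst hh']
    with q h1 h2 h3 h4 h5 h6 h7
  rw [h1, Pi.sub_apply, h2, Pi.sub_apply, h3, h4, h5, h6, h7]
  simp only [W, e]
  ring

/-- Every element of the range of `J₁ + J₂ V` is a direction of the transformation: if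
`φ = V h` then `φ = ∫ g dΓ` with `g = (h - s[ℓ'] φ) / s[1]`. -/
lemma exists_isTransDir (hc : CoreFacts P α θ Γ (stieltjes Γ τ))
    (hI : IntegrabilityCondition P α θ Γ) (h : Lp ℝ 2 (C P α θ Γ)) :
    ∃ g, IsTransDir P α θ Γ τ g ∧
      (hc.embOne h + hc.embEll hI (hc.volterraOp hI h) : Lp ℝ 2 (EN P ⊗ₘ failCov P))
        =ᵐ[EN P ⊗ₘ failCov P] fun q => transDir α θ Γ τ g q.1 q.2 := by
  have hna := hc.nullSingletonClass_C
  obtain ⟨φ, hφ⟩ : ∃ φ : ℝ → ℝ, φ = fun t =>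
      ∫ u in Ioc 0 t, prodInt P α θ Γ u t * h u ∂(C P α θ Γ) := ⟨_, rfl⟩
  obtain ⟨g, hg⟩ : ∃ g : ℝ → ℝ, g = fun u => (s P α θ Γ (fun _ _ => 1) u)⁻¹ *
      (h u - s P α θ Γ (ellPrime α θ Γ) u * φ u) := ⟨_, rfl⟩
  have hvar : ∀ t ∈ timeIco (tau0 P),
      IntegrableOn (fun u => h u - s P α θ Γ (ellPrime α θ Γ) u * φ u) (Ioc 0 t) (C P α θ Γ) ∧
      (0 ≤ t → φ t = ∫ u in Ioc 0 t, (h u - s P α θ Γ (ellPrime α θ Γ) u * φ u) ∂(C P α θ Γ)) := by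
    intro t ht
    have hfin : IsFiniteMeasure ((C P α θ Γ).restrict (Ioc 0 t)) :=
      ⟨by rw [Measure.restrict_apply_univ]; exact hc.C_lt_top t ht⟩
    have hi : IntegrableOn h (Ioc 0 t) (C P α θ Γ) :=
      ((Lp.memLp h).restrict _).integrable (by norm_num)
    exact variation_of_constants (hI.exponent t ht) hi fun r hr => by rw [hφ]; rfl
  have hgint : ∀ t ∈ timeIco (tau0 P), IntegrableOn g (Ioc 0 t) (stieltjes Γ τ) := by
    intro t ht
    have h1 := (hc.integrableOn_C_iff ht).1 (hvar t ht).1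
    rwa [hg]
  have hgφ : ∀ t ∈ timeIco (tau0 P), ∫ u in Ioc 0 t, g u ∂(stieltjes Γ τ) = φ t := by
    intro t ht
    rw [(hvar t ht).2 ht.1, hc.setIntegral_C ht, hg]
  have heq : (hc.embOne h + hc.embEll hI (hc.volterraOp hI h) : Lp ℝ 2 (EN P ⊗ₘ failCov P))
        =ᵐ[EN P ⊗ₘ failCov P] fun q => transDir α θ Γ τ g q.1 q.2 := by
    filter_upwards [Lp.coeFn_add (hc.embOne h) (hc.embEll hI (hc.volterraOp hI h)),
      hc.embOne_coeFn h, hc.embEll_coeFn hI (hc.volterraOp hI h),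
      (hc.isWeight_ell hI).congr_ae (hc.volterraOp_coeFn hI h),
      ae_compProd_failCov_fst hc.carrier, ae_compProd_failCov_fst hc.risk] with q h1 h2 h3 h4 h5 h6
    have h7 : φ q.1 = ∫ u in Ioc 0 q.1, prodInt P α θ Γ u q.1 * h u ∂(C P α θ Γ) := by rw [hφ]
    rw [h1, Pi.add_apply, h2, h3, h4, ← h7, transDir, hgφ _ h5.2, hg, e]
    have := h6.1.ne'
    field_simp
    ring
  refine ⟨g, ⟨hgint, ?_⟩, heq⟩
  rw [← compProd_failCov]
  exact (Lp.memLp _).ae_eq heq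

/-- Conversely, every direction `g` of the transformation arises from `h = s[g + ℓ' ∫ g dΓ]`. -/
lemma exists_of_isTransDir (hc : CoreFacts P α θ Γ (stieltjes Γ τ))
    (hI : IntegrabilityCondition P α θ Γ) {g : ℝ → ℝ} (hg : IsTransDir P α θ Γ τ g) :
    ∃ h : Lp ℝ 2 (C P α θ Γ),
      (hc.embOne h + hc.embEll hI (hc.volterraOp hI h) : Lp ℝ 2 (EN P ⊗ₘ failCov P))
        =ᵐ[EN P ⊗ₘ failCov P] fun q => transDir α θ Γ τ g q.1 q.2 := by
  have hna := hc.nullSingletonClass_C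
  have hG := hg.2
  rw [← compProd_failCov] at hG
  obtain ⟨φ, hφ⟩ : ∃ φ : ℝ → ℝ, φ = fun t => ∫ u in Ioc 0 t, g u ∂(stieltjes Γ τ) := ⟨_, rfl⟩
  have hdir : ∀ u z, transDir α θ Γ τ g u z = g u + ellPrime α θ Γ u z * φ u := fun u z => by
    rw [hφ]; rfl
  obtain ⟨h, hh⟩ : ∃ h, h = adjoint hc.embOne (hG.toLp _) := ⟨_, rfl⟩
  have hhs : ∀ᵐ u ∂(EN P), h u = s P α θ Γ (fun _ _ => 1) u * g u +
      s P α θ Γ (ellPrime α θ Γ) u * φ u := by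
    have h1 := hc.EN_absolutelyContinuous_C.ae_le (hc.adjoint_embOne_coeFn hG.coeFn_toLp)
    filter_upwards [h1, hc.ae_s_eq, hc.ae_memLp_ell hI] with u hu1 hu2 hu3
    have hi : Integrable (ellPrime α θ Γ u) (failCov P u) := hu3.integrable (by norm_num)
    have h2 : transDir α θ Γ τ g u = fun z => g u + ellPrime α θ Γ u z * φ u := funext (hdir u)
    rw [hh, hu1, hu2 (transDir α θ Γ τ g)
      (by rw [h2]; exact ((integrable_const _).add (hi.mul_const _)).1), hu2 _ hu3.1, h2,
      integral_add (integrable_const _) (hi.mul_const _), integral_const, probReal_univ, one_smul,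
      integral_mul_const]
    ring
  have hV : ∀ t ∈ timeIco (tau0 P),
      ∫ u in Ioc 0 t, prodInt P α θ Γ u t * h u ∂(C P α θ Γ) = φ t := by
    intro t ht
    have hy : IntegrableOn (fun u => s P α θ Γ (fun _ _ => 1) u * g u) (Ioc 0 t) (C P α θ Γ) := by
      rw [hc.integrableOn_C_iff ht]
      refine (hg.1 t ht).congr ?_
      filter_upwards [hc.s_one_pos t ht] with u hu
      rw [inv_mul_cancel_left₀ hu.ne']
    have hφy : ∀ r ∈ Icc 0 t,
        φ r = ∫ u in Ioc 0 r, s P α θ Γ (fun _ _ => 1) u * g u ∂(C P α θ Γ) := by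
      intro r hr
      have hr' := timeIco_mono hr.1 hr.2 ht
      rw [hc.setIntegral_C hr', hφ]
      refine integral_congr_ae ?_
      filter_upwards [hc.s_one_pos r hr'] with u hu
      rw [inv_mul_cancel_left₀ hu.ne']
    rw [eq_variation_of_constants (hI.exponent t ht) hy hφy ht.1]
    refine integral_congr_ae (ae_restrict_of_ae ?_)
    filter_upwards [C_absolutelyContinuous.ae_le hhs] with u hu
    rw [hu]
    rfl
  refine ⟨h, ?_⟩
  filter_upwards [Lp.coeFn_add (hc.embOne h) (hc.embEll hI (hc.volterraOp hI h)),
    hc.embOne_coeFn h, hc.embEll_coeFn hI (hc.volterraOp hI h),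
    (hc.isWeight_ell hI).congr_ae (hc.volterraOp_coeFn hI h),
    ae_compProd_failCov_fst hc.carrier, ae_compProd_failCov_fst hc.risk,
    ae_compProd_failCov_fst hhs] with q h1 h2 h3 h4 h5 h6 h7
  rw [h1, Pi.add_apply, h2, h3, h4, hV _ h5.2, hdir, h7, e]
  have := h6.1.ne'
  field_simp
  ring

/-- `f = W + a` with `a` a direction of the transformation and `W` orthogonal to all of them. -/
lemma W_decomposition (hc : CoreFacts P α θ Γ (stieltjes Γ τ))
    (hI : IntegrabilityCondition P α θ Γ) {f : ℝ → Vec k → ℝ}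
    (hf : MemLp (fun q : ℝ × Vec k => f q.1 q.2) 2 (subLaw P true)) {φ : ℝ → ℝ}
    (hφ : IsFredholmSol P α θ Γ f φ) :
    MemLp (fun q : ℝ × Vec k => W P α θ Γ f φ q.1 q.2) 2 (subLaw P true) ∧
      (∃ g, IsTransDir P α θ Γ τ g ∧
        (fun q : ℝ × Vec k => f q.1 q.2 - W P α θ Γ f φ q.1 q.2) =ᵐ[subLaw P true]
          fun q => transDir α θ Γ τ g q.1 q.2) ∧
      ∀ g, IsTransDir P α θ Γ τ g →
        ∫ q, W P α θ Γ f φ q.1 q.2 * transDir α θ Γ τ g q.1 q.2 ∂(subLaw P true) = 0 := by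
  rw [← compProd_failCov] at hf ⊢
  obtain ⟨F, hF⟩ : ∃ F, F = hf.toLp _ := ⟨_, rfl⟩
  have hFf : F =ᵐ[EN P ⊗ₘ failCov P] fun q => f q.1 q.2 := by rw [hF]; exact hf.coeFn_toLp
  have hW := hc.W_ae_eq hI hFf hφ.1
  have hsol := (hc.isFredholmSol_iff hI hFf hφ.1).1 hφ
  obtain ⟨h, hh⟩ : ∃ h, h = adjoint hc.embOne F + adjoint (hc.volterraOp hI)
    (adjoint (hc.embEll hI) F - hφ.1.toLp φ) := ⟨_, rfl⟩
  have horth := fun h' => inner_residual_eq_zero (hc.volterraOp hI) hc.embOne (hc.embEll hI)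
    (inner_weightOp_self hc.isWeight_one) (inner_weightOp_self (hc.isWeight_ell hI))
    (inner_weightOp_of_orthogonal hc.isWeight_one (hc.isWeight_ell hI) (hc.weights_orthogonal hI))
    F (hφ.1.toLp φ) h'
  rw [← hh] at hW hsol horth
  refine ⟨(Lp.memLp _).ae_eq hW, ?_, ?_⟩
  · obtain ⟨g, hg, hge⟩ := hc.exists_isTransDir hI h
    refine ⟨g, hg, ?_⟩
    rw [← hsol] at hge
    filter_upwards [hge, hW, hFf, Lp.coeFn_add (hc.embOne h) (hc.embEll hI (hφ.1.toLp φ)),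
      Lp.coeFn_sub (F - hc.embOne h) (hc.embEll hI (hφ.1.toLp φ)),
      Lp.coeFn_sub F (hc.embOne h)] with q h1 h2 h3 h4 h5 h6
    rw [← h1, ← h2, ← h3, h4, h5, Pi.add_apply, Pi.sub_apply, h6, Pi.sub_apply]
    ring
  · intro g hg
    obtain ⟨h', hh'⟩ := hc.exists_of_isTransDir hI hg
    rw [← horth h', integral_inner_eq]
    refine integral_congr_ae ?_
    filter_upwards [hW, hh'] with q h1 h2
    rw [h1, h2]

end CoreFacts

end Directions

/-! ### The orthocomplement of the nuisance tangent space -/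

section Projection

variable {d k : ℕ} {P : Measure (Obs k)} {α : ℝ → Vec d → Vec k → ℝ} {θ : Vec d} {Γ : ℝ → ℝ}
  {τ : ℝ≥0∞}

lemma closedSpan_le_orthogonal {S : Set (Obs k → ℝ)} {w : Lp ℝ 2 P}
    (h : ∀ g ∈ S, ∀ u : Lp ℝ 2 P, u =ᵐ[P] g → ⟪w, u⟫_ℝ = 0) :
    closedSpan P S ≤ (Submodule.span ℝ {w})ᗮ := by
  refine Submodule.topologicalClosure_minimal _ (Submodule.span_le.2 ?_)
    (Submodule.isClosed_orthogonal _)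
  rintro u ⟨g, hg, hu⟩
  exact Submodule.mem_orthogonal_singleton_iff_inner_right.2 (h g hg u hu)

lemma mem_closedSpan {S : Set (Obs k → ℝ)} {g : Obs k → ℝ} (hg : g ∈ S) {u : Lp ℝ 2 P}
    (hu : u =ᵐ[P] g) : u ∈ closedSpan P S :=
  Submodule.le_topologicalClosure _ (Submodule.subset_span ⟨g, hg, hu⟩)

variable [IsFiniteMeasure P]

lemma residual_martInt_of_memLp
    (hat : ∀ᵐ z ∂(covLaw P), NullSingletonClass (condTime P true z)) {b : Bool}
    {h : ℝ → Vec k → ℝ} (h2 : MemLp (fun q : ℝ × Vec k => h q.1 q.2) 2 (subLaw P b)) :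
    (fun q : ℝ × Vec k => residual P true (martInt P b h) q.1 q.2) =ᵐ[subLaw P true]
      fun q => if b = true then h q.1 q.2 else 0 := by
  obtain ⟨g, hg⟩ : ∃ g : ℝ → Vec k → ℝ, g = fun u z => h2.1.mk _ (u, z) := ⟨_, rfl⟩
  have hm : Measurable fun q : ℝ × Vec k => g q.1 q.2 := by
    rw [hg]; exact h2.1.stronglyMeasurable_mk.measurable
  have hhg : (fun q : ℝ × Vec k => h q.1 q.2) =ᵐ[subLaw P b] fun q => g q.1 q.2 := by
    rw [hg]; exact h2.1.ae_eq_mk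
  have hi : Integrable (fun q : ℝ × Vec k => g q.1 q.2) (subLaw P b) :=
    (h2.integrable (by norm_num)).congr hhg
  refine (residual_congr (martInt_congr hhg)).trans
    ((residual_martInt hat hm hi).trans ?_)
  cases b with
  | false => exact ae_of_all _ fun q => by simp
  | true =>
    filter_upwards [hhg] with q hq
    simp only [if_true]
    exact hq.symm

lemma inner_martInt (hat : ∀ᵐ z ∂(covLaw P), NullSingletonClass (condTime P true z))
    {h : ℝ → Vec k → ℝ} (h2 : MemLp (fun q : ℝ × Vec k => h q.1 q.2) 2 (subLaw P true))
    (u : Lp ℝ 2 P) :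
    ⟪(memLp_martInt hat h2).toLp _, u⟫_ℝ =
      ∫ q, h q.1 q.2 * residual P true u q.1 q.2 ∂(subLaw P true) := by
  rw [integral_inner_eq, ← integral_martInt_mul hat h2 (Lp.stronglyMeasurable u).measurable
    (Lp.memLp u)]
  refine integral_congr_ae ?_
  filter_upwards [(memLp_martInt hat h2).coeFn_toLp] with p hp
  rw [hp]

/-- The stochastic integral of `h` is orthogonal to the nuisance tangent space if `h` is orthogonal
to all directions of the transformation. -/
lemma martInt_mem_nuisancePerp
    (hat : ∀ᵐ z ∂(covLaw P), NullSingletonClass (condTime P true z)) {h : ℝ → Vec k → ℝ}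
    (h2 : MemLp (fun q : ℝ × Vec k => h q.1 q.2) 2 (subLaw P true))
    (horth : ∀ g, IsTransDir P α θ Γ τ g →
      ∫ q, h q.1 q.2 * transDir α θ Γ τ g q.1 q.2 ∂(subLaw P true) = 0) :
    (memLp_martInt hat h2).toLp _ ∈ nuisancePerp P α θ Γ τ := by
  have hzero : ∀ {v : ℝ × Vec k → ℝ}, v =ᵐ[subLaw P true] 0 →
      ∫ q, h q.1 q.2 * v q ∂(subLaw P true) = 0 := fun hv =>
    integral_eq_zero_of_ae (hv.mono fun q hq => by simp [hq])
  refine ⟨?_, ?_⟩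
  · have h1 := integral_martInt_mul hat h2 (v := fun p => (fun _ => (1 : ℝ)) p.2.2)
      measurable_const (memLp_const _)
    rw [hzero (residual_cov measurable_const)] at h1
    change ∫ p, (memLp_martInt hat h2).toLp _ p ∂P = 0
    rw [integral_congr_ae (memLp_martInt hat h2).coeFn_toLp]
    simpa using h1
  · rw [SetLike.mem_coe, Submodule.mem_orthogonal']
    intro u hu
    have hle : nuisance P α θ Γ τ ≤
        (Submodule.span ℝ {(memLp_martInt hat h2).toLp (martInt P true h)})ᗮ := by
      refine sup_le (sup_le ?_ ?_) ?_
      · refine closedSpan_le_orthogonal ?_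
        rintro _ ⟨g, hg, rfl⟩ u hu
        rw [inner_martInt hat h2 u, ← horth g hg]
        refine integral_congr_ae ?_
        filter_upwards [residual_congr hu, residual_martInt_of_memLp hat (b := true) hg.2]
          with q h3 h4
        rw [h3, h4, if_pos rfl]
      · refine closedSpan_le_orthogonal ?_
        rintro _ ⟨b, hb, rfl⟩ u hu
        rw [inner_martInt hat h2 u]
        refine hzero ((residual_congr hu).trans ?_)
        filter_upwards [residual_martInt_of_memLp hat (b := false) hb] with q h4
        rw [h4]
        rfl
      · refine closedSpan_le_orthogonal ?_
        rintro _ ⟨c, hc, -, rfl⟩ u hu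
        rw [inner_martInt hat h2 u]
        have h3 : (fun p : Obs k => c p.2.2) =ᵐ[P] fun p => hc.1.mk c p.2.2 :=
          ae_of_ae_map (f := fun p : Obs k => p.2.2) (by fun_prop) hc.1.ae_eq_mk
        exact hzero ((residual_congr (hu.trans h3)).trans
          (residual_cov hc.1.stronglyMeasurable_mk.measurable))
    exact Submodule.mem_orthogonal_singleton_iff_inner_right.1 (hle hu)

lemma integral_mul_eq_zero {g : Obs k → ℝ} (hg : MemLp g 2 P) {w : Lp ℝ 2 P}
    (hw : w ∈ nuisancePerp P α θ Γ τ) (hmem : hg.toLp g ∈ nuisance P α θ Γ τ) :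
    ∫ p, g p * w p ∂P = 0 := by
  rw [← (Submodule.mem_orthogonal _ _).1 hw.2 _ hmem, integral_inner_eq]
  refine integral_congr_ae ?_
  filter_upwards [hg.coeFn_toLp] with p hp
  rw [hp]

/-- The elements of the orthocomplement are stochastic integrals with respect to `M`. -/
lemma ae_eq_martInt_of_mem_nuisancePerp [IsProbabilityMeasure P]
    (hat : ∀ᵐ z ∂(covLaw P), NullSingletonClass (condTime P true z)) {w : Lp ℝ 2 P}
    (hw : w ∈ nuisancePerp P α θ Γ τ) : w =ᵐ[P] martInt P true (residual P true w) := by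
  refine ae_eq_martInt_residual hat (Lp.stronglyMeasurable w).measurable (Lp.memLp w) ?_ ?_
  · intro h hh
    refine integral_mul_eq_zero (hh.memLp_martInt false 2) hw ?_
    refine Submodule.mem_sup_left (Submodule.mem_sup_right ?_)
    refine mem_closedSpan ?_ (MemLp.coeFn_toLp _)
    exact ⟨h, hh.memLp false 2, rfl⟩
  · intro A hA
    have hZ : Measurable fun p : Obs k => p.2.2 := by fun_prop
    have hμ : IsProbabilityMeasure (P.map fun p : Obs k => p.2.2) :=
      Measure.isProbabilityMeasure_map hZ.aemeasurable
    -- the centred indicator of `A` is a direction for the law of the covariate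
    obtain ⟨a, ha⟩ : ∃ a : ℝ, a = (P.map fun p : Obs k => p.2.2).real A := ⟨_, rfl⟩
    obtain ⟨c, hc⟩ : ∃ c : Vec k → ℝ, c = fun z => A.indicator (fun _ => (1 : ℝ)) z - a := ⟨_, rfl⟩
    have hi : MemLp (A.indicator fun _ => (1 : ℝ)) 2 (P.map fun p : Obs k => p.2.2) :=
      memLp_indicator_const 2 hA 1 (Or.inr (measure_ne_top _ _))
    have hc2 : MemLp c 2 (P.map fun p : Obs k => p.2.2) := by
      rw [hc]; exact hi.sub (memLp_const a)
    have hc0 : ∫ z, c z ∂(P.map fun p : Obs k => p.2.2) = 0 := by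
      rw [hc, integral_sub (hi.integrable (by norm_num)) (integrable_const _),
        integral_indicator_const _ hA, smul_eq_mul, mul_one, integral_const, probReal_univ, one_smul, ha,
        sub_self]
    have hcP : MemLp (fun p : Obs k => c p.2.2) 2 P :=
      (memLp_map_measure_iff hc2.1 hZ.aemeasurable).1 hc2
    have h1 : ∫ p, c p.2.2 * w p ∂P = 0 := by
      refine integral_mul_eq_zero hcP hw (Submodule.mem_sup_right ?_)
      refine mem_closedSpan ?_ (MemLp.coeFn_toLp _)
      exact ⟨c, hc2, hc0, rfl⟩
    have h2 : ∫ p, w p ∂P = 0 := hw.1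
    have hwi : Integrable w P := (Lp.memLp w).integrable (by norm_num)
    have h3 : ∀ p : Obs k, A.indicator (fun _ => (1 : ℝ)) p.2.2 * w p =
        c p.2.2 * w p + a * w p := fun p => by rw [hc]; ring
    simp only [h3]
    rw [integral_add (memLp_two_mul_integrable hcP (Lp.memLp w)) (hwi.const_mul a), h1,
      integral_const_mul, h2, mul_zero, add_zero]

variable (hc : CoreFacts P α θ Γ (stieltjes Γ τ)) (hI : IntegrabilityCondition P α θ Γ)
  (hat : ∀ᵐ z ∂(covLaw P), NullSingletonClass (condTime P true z))
include hc hI hat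

/-- `W_f` is orthogonal to all directions of the transformation, and stochastic integrals of the
failure martingale are orthogonal to the censoring integrals and to the functions of `Z`. -/
lemma U_mem_nuisancePerp {f : ℝ → Vec k → ℝ}
    (hf : MemLp (fun q : ℝ × Vec k => f q.1 q.2) 2 (subLaw P true)) {φ : ℝ → ℝ}
    (hφ : IsFredholmSol P α θ Γ f φ) :
    ∃ hU : MemLp (U P α θ Γ f φ) 2 P, hU.toLp _ ∈ nuisancePerp P α θ Γ τ := by
  obtain ⟨h1, -, h3⟩ := hc.W_decomposition hI hf hφ
  exact ⟨memLp_martInt hat h1, martInt_mem_nuisancePerp hat h1 h3⟩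

/-- The projection of `b` onto the orthocomplement of the nuisance tangent space. -/
lemma starProjection_nuisancePerp_ae_eq [IsProbabilityMeasure P] (b : Lp ℝ 2 P) {φ : ℝ → ℝ}
    (hφ : IsFredholmSol P α θ Γ (R1 P b) φ) :
    (nuisancePerp P α θ Γ τ).starProjection b =ᵐ[P] U P α θ Γ (R1 P b) φ := by
  rw [R1_eq_residual] at hφ ⊢
  have hbm := (Lp.stronglyMeasurable b).measurable
  have hb := memLp_residual hat hbm (Lp.memLp b)
  obtain ⟨hW, ⟨g, hg, hge⟩, horth⟩ := hc.W_decomposition hI hb hφ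
  have hmem := martInt_mem_nuisancePerp hat hW horth
  have key : (nuisancePerp P α θ Γ τ).starProjection b = (memLp_martInt hat hW).toLp _ := by
    refine Submodule.eq_starProjection_of_mem_of_inner_eq_zero hmem fun w hw => ?_
    have hwm := (Lp.stronglyMeasurable w).measurable
    have hR := memLp_residual hat hwm (Lp.memLp w)
    have hwI := ae_eq_martInt_of_mem_nuisancePerp hat hw
    have e1 : ⟪b, w⟫_ℝ =
        ∫ q, residual P true b q.1 q.2 * residual P true w q.1 q.2 ∂(subLaw P true) := by
      rw [integral_inner_eq]
      calc ∫ p, b p * w p ∂P = ∫ p, martInt P true (residual P true w) p * b p ∂P := by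
            refine integral_congr_ae ?_
            filter_upwards [hwI] with p hp
            rw [mul_comm, ← hp]
        _ = ∫ q, residual P true w q.1 q.2 * residual P true b q.1 q.2 ∂(subLaw P true) :=
            integral_martInt_mul hat hR hbm (Lp.memLp b)
        _ = _ := integral_congr_ae (ae_of_all _ fun q => mul_comm _ _)
    have hT := memLp_martInt hat hg.2
    have e2 : ∫ p, martInt P true (transDir α θ Γ τ g) p * w p ∂P = 0 := by
      refine integral_mul_eq_zero hT hw (Submodule.mem_sup_left (Submodule.mem_sup_left ?_))
      refine mem_closedSpan ?_ (MemLp.coeFn_toLp _)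
      exact ⟨g, hg, rfl⟩
    rw [integral_martInt_mul hat hg.2 hwm (Lp.memLp w)] at e2
    rw [inner_sub_left, e1, inner_martInt hat hW w, ← e2,
      ← integral_sub (memLp_two_mul_integrable hb hR) (memLp_two_mul_integrable hW hR)]
    refine integral_congr_ae ?_
    filter_upwards [hge] with q hq
    rw [← hq]
    ring
  rw [key]
  exact MemLp.coeFn_toLp _

end Projection

end CensTrans

theorem proposition2p1 {Ω : Type*} [MeasurableSpace Ω] (Pr : Measure Ω) [IsProbabilityMeasure Pr]
    {d k : ℕ} (T : Ω → ℝ≥0) (T' : Ω → ℝ≥0∞) (Z : Ω → Vec k)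
    (hT : Measurable T) (hT' : Measurable T') (hZ : Measurable Z)
    (Θ : Set (Vec d)) (α : ℝ → Vec d → Vec k → ℝ)
    (θ₀ : Vec d) (hθ₀ : θ₀ ∈ Θ) (Γ₀ : ℝ → ℝ)
    (hcore : CoreConditions Θ α (Pr.map Z))
    (hmodel : IsTransformationModel Pr T T' Z α θ₀ Γ₀)
    (hnuis : NuisanceConditions Pr T T' Z Γ₀)
    (P : Measure (Obs k)) [IsFiniteMeasure P] (hP : P = obsLaw Pr T T' Z)
    (hint : IntegrabilityCondition P α θ₀ Γ₀) :
    -- the Fredholm equation has a unique solution in `L₂(B)`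
    (∀ f : ℝ → Vec k → ℝ,
      MemLp (fun q : ℝ × Vec k => f q.1 q.2) 2 (subLaw P true) →
      (∃ φ, IsFredholmSol P α θ₀ Γ₀ f φ) ∧
      ∀ φ φ', IsFredholmSol P α θ₀ Γ₀ f φ → IsFredholmSol P α θ₀ Γ₀ f φ' →
        φ =ᵐ[B P α θ₀ Γ₀] φ') ∧
    -- (i)
    (∀ (f : ℝ → Vec k → ℝ) (φ : ℝ → ℝ),
      MemLp (fun q : ℝ × Vec k => f q.1 q.2) 2 (subLaw P true) →
      IsFredholmSol P α θ₀ Γ₀ f φ →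
      ∃ hU : MemLp (U P α θ₀ Γ₀ f φ) 2 P,
        hU.toLp _ ∈ meanZero P ∧
        ∀ v ∈ nuisance P α θ₀ Γ₀ (tauF Pr T), ⟪hU.toLp _, v⟫_ℝ = 0) ∧
    -- (ii)
    (∀ b ∈ meanZero P,
      MemLp (fun q : ℝ × Vec k => R1 P b q.1 q.2) 2
        (subLaw P true) ∧
      ∀ φ, IsFredholmSol P α θ₀ Γ₀ (R1 P b) φ →
        ((nuisancePerp P α θ₀ Γ₀ (tauF Pr T)).starProjection b :
            Obs k → ℝ)
          =ᵐ[P] U P α θ₀ Γ₀ (R1 P b) φ) ∧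
    -- (iii)
    (nuisancePerp P α θ₀ Γ₀ (tauF Pr T) : Set (Lp ℝ 2 P)) =
      {u : Lp ℝ 2 P | ∃ (f : ℝ → Vec k → ℝ) (φ : ℝ → ℝ),
        MemLp (fun q : ℝ × Vec k => f q.1 q.2) 2 (subLaw P true) ∧
        IsFredholmSol P α θ₀ Γ₀ f φ ∧
        (u : Obs k → ℝ) =ᵐ[P] U P α θ₀ Γ₀ f φ} := by
  subst hP
  have hna := nullSingletonClass_condTime hT hT' hZ hθ₀ hcore hmodel hnuis.transformation
  have hc := coreFacts_obsLaw hT hT' hZ hθ₀ hcore hmodel hnuis.transformation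
  have hprob : IsProbabilityMeasure (obsLaw Pr T T' Z) :=
    Measure.isProbabilityMeasure_map (measurable_observation hT hT' hZ).aemeasurable
  have hR : ∀ b : Lp ℝ 2 (obsLaw Pr T T' Z),
      MemLp (fun q : ℝ × Vec k => R1 (obsLaw Pr T T' Z) b q.1 q.2) 2
        (subLaw (obsLaw Pr T T' Z) true) :=
    fun b => memLp_residual hna (Lp.stronglyMeasurable b).measurable (Lp.memLp b)
  refine ⟨fun f hf => hc.existsUnique_fredholm hint hf, ?_, ?_, ?_⟩
  · intro f φ hf hφ
    obtain ⟨hU, hmem⟩ := U_mem_nuisancePerp hc hint hna hf hφ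
    exact ⟨hU, hmem.1, fun v hv => (Submodule.mem_orthogonal' _ _).1 hmem.2 v hv⟩
  · exact fun b _ => ⟨hR b, fun φ hφ => starProjection_nuisancePerp_ae_eq hc hint hna b hφ⟩
  · ext u
    constructor
    · intro hu
      obtain ⟨φ, hφ⟩ := (hc.existsUnique_fredholm hint (hR u)).1
      refine ⟨R1 _ u, φ, hR u, hφ, ?_⟩
      have h1 := starProjection_nuisancePerp_ae_eq hc hint hna u hφ
      rwa [Submodule.starProjection_eq_self_iff.2 hu] at h1
    · rintro ⟨f, φ, hf, hφ, hu⟩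
      obtain ⟨hU, hmem⟩ := U_mem_nuisancePerp hc hint hna hf hφ
      have h1 : u = hU.toLp _ := Lp.ext (hu.trans hU.coeFn_toLp.symm)
      rw [SetLike.mem_coe, h1]
      exact hmem
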